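/- **Setting.** Let $\Lambda<0$, $R,T>0$. On $\{0\le\tau\le T,\ 0\le z\le 1/R\}\times S^2$ (with $z=1/r$) consider the conformal metric of an asymptotically anti-de Sitter metric in Bondi–Sachs coordinates, $$g=-z^2V\,d\tau^2+2\,d\tau\,dz+e^{-2\eta}h_{AB}(dx^A-U^Ad\tau)(dx^B-U^Bd\tau),$$ of class $C^1$ up to $z=0$, where $h_{AB}$ is a Riemannian metric on the spheres $\tau,z=\mathrm{const}$ with the area form $d\sigma$ of the round unit sphere, and where at $z=0$: $z^2V=-\Lambda/3$, $\eta=0$, $U^A=\partial_zU^A=0$, and $h_{AB}$ is the round metric. Put $N_1=\nabla\tau=\partial_z$ and $N_2=-(\partial_\tau+\frac12z^2V\partial_z+U^A\partial_A)$. Let $\mathcal H$ be the ingoing null cone issuing from the sphere $\{\tau=z=0\}$: a $C^1$ null hypersurface through this sphere that is nowhere tangent to $N_1$ and that stays in the slab, so that it is a graph $z=\zeta(\tau,x)$, $0\le\tau\le T$, with $\zeta(0,\cdot)=0$ and $0<\zeta\le 1/R$ for $\tau>0$. Let $\mathcal D=\mathcal M_2\cap\Omega_T=\{0<\tau<T,\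 0<z<\zeta(\tau,x)\}$ be the region bounded by $\mathcal H$, by conformal infinity $\mathcal I=\{z=0,\ 0<\tau<T\}$ and by $\Sigma_T\cap\mathcal M_2=\{\tau=T,\ 0<z<\zeta(T,x)\}$. Write the null normal of $\mathcal H$ as $N_{\mathcal H}=\nabla(\zeta-z)=l_1N_1+l_2N_2+l_3e_3+l_4e_4$ with $l_2=1$, where $e_3,e_4$ is a $g$-orthonormal frame of the spheres $\tau,z=\mathrm{const}$, and let $E_1=\frac{l_3}{l_2}N_1+e_3$, $E_2=\frac{l_4}{l_2}N_1+e_4$, $E_3=N_2+\frac{l_3}{2l_2}e_3+\frac{l_4}{2l_2}e_4$, $$E_{\mathcal H}[\phi,b_1,b_2]=\tfrac{b_1l_2}{2}\big[(E_1\phi)^2+(E_2\phi)^2\big]+b_2l_2(E_3\phi)^2+\tfrac{b_2l_2}{4}(l_3E_2\phi-l_4E_1\phi)^2+(b_2l_1+b_1l_2)\phi^2,$$ and let $d\mathcal H=e^{-2\eta}d\tau\,d\sigma$ be the volume element of $\mathcal H$ adapted to $N_{\mathcal H}$. For a weight $h>0$, $\|F\|_{L^2_h(S)}=(\int_S hF^2)^{1/2}$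 and $\|v\|_{H^1_h(S)}=\|v\|_{L^2_h(S)}+\|\,|\nabla v|\,\|_{L^2_h(S)}$, where the measures are $d\tau\,dz\,d\sigma$ on $\mathcal D$, $dz\,d\sigma$ on $\Sigma_T$, $d\tau\,d\sigma$ on $\mathcal I$, and $|\nabla v|^2$ is the sum of the squares of the derivatives in the variables of $S$ only (among $\partial_\tau v$, $\partial_zv$ and the gradient on the round sphere). **Theorem.** Given $\Lambda<0$ and constants $K$, $c>0$, $K_\omega$, $K_a$, there are $q_0>0$, $l>0$, $C>0$, depending only on these numbers, such that the following holds for all $R,T>0$ and all $g$, $\mathcal H$ as above with $|g^{ij}|_{C^1(\mathcal D)}\le K$ and $g^{AB}\xi_A\xi_B\ge c|\xi|^2$ on $\mathcal D$. Let $|\omega|\le K_\omega$ and $|a^i|\le K_a$ almost everywhere on $\mathcal D$ ($a^i$, $\omega$ measurable), let $v$ be of class $C^2$ up to the boundary of $\mathcal D$, and let $$\Box_gv+a^i\partial_iv+\omega v=f\quad\text{almost everywhere in }\mathcal D.$$ Then for every $q\ge q_0$, with $h=e^{-ql\tau+qz}$, $$q^{1/2}\|v\|_{H^1_h(\mathcal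 D)}+\|v\|_{H^1_h(\Sigma_T\cap\mathcal M_2)}+\|\partial_zv\|_{L^2_h(\mathcal I)}\le C\Big\{\Big(\int_{\mathcal H}h\,E_{\mathcal H}[v,1,1]\,d\mathcal H\Big)^{1/2}+\|v\|_{H^1_h(\mathcal I)}+\|f\|_{L^2_h(\mathcal D)}\Big\}.$$ In particular ($a=0$, $K_a=0$) for $\Box_gv+\omega v=f$ the constants depend only on $\Lambda$ and on the bounds for $g$ and $\omega$. -/

import Mathlib

open MeasureTheory Set
open scoped RealInnerProductSpace

noncomputable section

namespace AdSWave

/-! ### Coordinates and calculus on `ℝ × ℝ × S²` -/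

/-- Euclidean three-space. -/
abbrev E3 := EuclideanSpace ℝ (Fin 3)

/-- The unit sphere `S² ⊂ ℝ³`. -/
abbrev S2 := Metric.sphere (0 : E3) 1

/-- Points `(τ, z, x)` with `x ∈ S²`. -/
abbrev Pt := ℝ × ℝ × S2

/-- Vectors `(X^τ, X^z, X^S)`; the angular part is a vector of `ℝ³`, tangent to `S²` at the
base point. -/
abbrev Vec := ℝ × ℝ × E3

/-- Radial projection of `ℝ³` without the origin onto `S²` (the value at the origin is irrelevant). -/
def proj (y : E3) : S2 :=
  if hy : y = 0 then ⟨EuclideanSpace.single 0 1, by simp⟩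
  else ⟨‖y‖⁻¹ • y, by simp [norm_smul, hy]⟩

/-- A point of `ℝ × ℝ × S²` as a point of `ℝ × ℝ × ℝ³`. -/
def emb (p : Pt) : Vec := (p.1, p.2.1, (p.2.2 : E3))

/-- The extension of a field on `ℝ × ℝ × S²` to `ℝ × ℝ × ℝ³`, constant along rays of `ℝ³`. -/
def lift {G : Type*} (F : Pt → G) : Vec → G := fun y => F (y.1, y.2.1, proj y.2.2)

/-- `F` is of class `C^k` near every point of `s` (so, for closed `s`, of class `C^k` up to the
boundary of `s`). -/
def IsCk {G : Type*} [NormedAddCommGroup G] [NormedSpace ℝ G] (k : ℕ) (F : Pt → G) (s : Set Pt) :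
    Prop :=
  ∀ p ∈ s, ContDiffAt ℝ k (lift F) (emb p)

/-- The differential of `F` at `p`. It vanishes on the direction normal to `S²`. -/
def D {G : Type*} [NormedAddCommGroup G] [NormedSpace ℝ G] (F : Pt → G) (p : Pt) : Vec →L[ℝ] G :=
  fderiv ℝ (lift F) (emb p)

/-- `∂_τ F`. -/
def Dτ {G : Type*} [NormedAddCommGroup G] [NormedSpace ℝ G] (F : Pt → G) (p : Pt) : G :=
  D F p (1, 0, 0)

/-- `∂_z F`. -/
def Dz {G : Type*} [NormedAddCommGroup G] [NormedSpace ℝ G] (F : Pt → G) (p : Pt) : G :=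
  D F p (0, 1, 0)

/-- The gradient of `v` along the sphere, with respect to the round metric: the vector of
`T_x S² ⊂ ℝ³` that represents `ξ ↦ dv (0, 0, ξ)`. -/
def gradS (v : Pt → ℝ) (p : Pt) : E3 :=
  (InnerProductSpace.toDual ℝ E3).symm
    ((D v p).comp ((ContinuousLinearMap.inr ℝ ℝ (ℝ × E3)).comp (ContinuousLinearMap.inr ℝ ℝ E3)))

/-- The divergence along the round sphere of a field `Y` tangent to the sphere. -/
def divS (Y : Pt → E3) (p : Pt) : ℝ :=
  ∑ i : Fin 3, (D Y p (0, 0, EuclideanSpace.single i 1)) i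

/-- The `C¹` norm of `F` on `s` is at most `K`. -/
def C1BoundOn {G : Type*} [NormedAddCommGroup G] [NormedSpace ℝ G] (F : Pt → G) (s : Set Pt)
    (K : ℝ) : Prop :=
  ∀ p ∈ s, ‖F p‖ ≤ K ∧ ‖D F p‖ ≤ K

/-- The area measure of the round unit sphere. -/
def areaS2 : Measure S2 := (volume : Measure E3).toSphere

/-- The measure `dz dσ` (or `dτ dσ`) on `ℝ × S²`. -/
def vol3 : Measure (ℝ × S2) := (volume : Measure ℝ).prod areaS2

/-- The measure `dτ dz dσ` on `ℝ × ℝ × S²`. -/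
def vol4 : Measure Pt := (volume : Measure ℝ).prod vol3

/-! ### The conformal metric -/

/-- The closed coordinate slab `0 ≤ τ ≤ T`, `0 ≤ z ≤ 1/R`. -/
def closedSlab (R T : ℝ) : Set Pt := {p | p.1 ∈ Icc 0 T ∧ p.2.1 ∈ Icc 0 (1 / R)}

/-- Coefficients of the conformal metric
`-z²V dτ² + 2 dτ dz + e^{-2η} h_AB (dx^A - U^A dτ)(dx^B - U^B dτ)`
of an asymptotically anti-de Sitter metric in Bondi-Sachs coordinates, `z = 1/r`, of class `C¹` up
to conformal infinity `z = 0`. The field `W` is `z²V`. The symmetric form `h_AB` on `T_x S²` is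
represented by a symmetric operator of `ℝ³` which fixes the unit normal `x`; then the determinant
of `h_AB` relative to the round metric is the determinant of this operator. -/
structure ConformalMetric (Λ R T : ℝ) where
  /-- `z²V` -/
  W : Pt → ℝ
  /-- `η` -/
  η : Pt → ℝ
  /-- `U^A` -/
  U : Pt → E3
  /-- `h_AB` -/
  h : Pt → E3 →L[ℝ] E3
  U_tangent : ∀ p ∈ closedSlab R T, ⟪U p, (p.2.2 : E3)⟫ = 0
  h_symm : ∀ p ∈ closedSlab R T, ∀ ξ χ : E3, ⟪h p ξ, χ⟫ = ⟪ξ, h p χ⟫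
  h_normal : ∀ p ∈ closedSlab R T, h p (p.2.2 : E3) = (p.2.2 : E3)
  h_pos : ∀ p ∈ closedSlab R T, ∀ ξ : E3, ξ ≠ 0 → 0 < ⟪h p ξ, ξ⟫
  /-- `h_AB` has the area form of the round sphere -/
  h_det : ∀ p ∈ closedSlab R T, (h p).det = 1
  W_C1 : IsCk 1 W (closedSlab R T)
  η_C1 : IsCk 1 η (closedSlab R T)
  U_C1 : IsCk 1 U (closedSlab R T)
  h_C1 : IsCk 1 h (closedSlab R T)
  /-- `r⁻² V → -Λ/3` -/
  W_infinity : ∀ p ∈ closedSlab R T, p.2.1 = 0 → W p = -Λ / 3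
  /-- `η → 0` -/
  η_infinity : ∀ p ∈ closedSlab R T, p.2.1 = 0 → η p = 0
  /-- `r U^A → 0`, that is, `U^A` vanishes to first order at `z = 0` -/
  U_infinity : ∀ p ∈ closedSlab R T, p.2.1 = 0 → U p = 0 ∧ Dz U p = 0
  /-- `h_AB` tends to the round metric -/
  h_infinity : ∀ p ∈ closedSlab R T, p.2.1 = 0 → h p = ContinuousLinearMap.id ℝ E3

namespace ConformalMetric

variable {Λ R T : ℝ} (g : ConformalMetric Λ R T)

/-- The metric as a bilinear form. -/
def metric (p : Pt) (X Y : Vec) : ℝ :=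
  -(g.W p) * X.1 * Y.1 + (X.1 * Y.2.1 + X.2.1 * Y.1)
    + Real.exp (-2 * g.η p) * ⟪g.h p (X.2.2 - X.1 • g.U p), Y.2.2 - Y.1 • g.U p⟫

/-- The angular part `g^{AB} = e^{2η} h^{AB}` of the inverse metric. The other components are
`g^{τz} = 1`, `g^{zz} = W`, `g^{zA} = U^A`, `g^{ττ} = g^{τA} = 0`. -/
def angInv (p : Pt) : E3 →L[ℝ] E3 := Real.exp (2 * g.η p) • Ring.inverse (g.h p)

/-- The metric gradient `∇v`, with components `g^{ij} ∂_j v`. -/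
def grad (v : Pt → ℝ) (p : Pt) : Vec :=
  (Dz v p, Dτ v p + g.W p * Dz v p + ⟪g.U p, gradS v p⟫,
    Dz v p • g.U p + g.angInv p (gradS v p))

theorem mul_angInv {p : Pt} (hp : p ∈ closedSlab R T) (n : E3) :
    Real.exp (-2 * g.η p) • g.h p (g.angInv p n) = n := by
  have hk : LinearMap.ker (g.h p : E3 →ₗ[ℝ] E3) = ⊥ := by
    rw [LinearMap.ker_eq_bot']
    intro ξ hξ
    by_contra hne
    have h1 := g.h_pos p hp ξ hne
    have h2 : g.h p ξ = 0 := hξ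
    simp [h2] at h1
  have hu : IsUnit (g.h p) := (ContinuousLinearMap.isUnit_iff_bijective).mpr
    ⟨LinearMap.ker_eq_bot.mp hk, LinearMap.injective_iff_surjective.mp (LinearMap.ker_eq_bot.mp hk)⟩
  have hinv : g.h p (Ring.inverse (g.h p) n) = n := by
    have := congrArg (fun A : E3 →L[ℝ] E3 => A n) (Ring.mul_inverse_cancel _ hu)
    simpa using this
  have he : Real.exp (-2 * g.η p) * Real.exp (2 * g.η p) = 1 := by
    rw [← Real.exp_add]; simp
  have h3 : g.angInv p n = Real.exp (2 * g.η p) • Ring.inverse (g.h p) n := rfl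
  rw [h3, map_smul, hinv, smul_smul, he, one_smul]

theorem D_apply (v : Pt → ℝ) (p : Pt) (Y : Vec) :
    D v p Y = Y.1 * Dτ v p + Y.2.1 * Dz v p + ⟪gradS v p, Y.2.2⟫ := by
  have hS : ∀ ξ : E3, ⟪gradS v p, ξ⟫ = D v p (0, 0, ξ) := fun ξ => by
    simp [gradS]
  have e : Y = Y.1 • ((1, 0, 0) : Vec) + Y.2.1 • ((0, 1, 0) : Vec) + (0, 0, Y.2.2) := by
    ext <;> simp
  rw [hS]
  conv_lhs => rw [e]
  simp only [map_add, map_smul, smul_eq_mul, Dτ, Dz]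

/-- The defining property of the gradient: `g(∇v, Y) = Y v`. -/
theorem metric_grad {p : Pt} (hp : p ∈ closedSlab R T) (v : Pt → ℝ) (Y : Vec) :
    g.metric p (g.grad v p) Y = D v p Y := by
  have h := g.mul_angInv hp (gradS v p)
  have h2 : ∀ χ : E3, Real.exp (-2 * g.η p) * ⟪g.h p (g.angInv p (gradS v p)), χ⟫
      = ⟪gradS v p, χ⟫ := fun χ => by
    conv_rhs => rw [← h]
    rw [real_inner_smul_left]
  rw [D_apply]
  simp only [metric, grad, add_sub_cancel_left]
  rw [h2, inner_sub_right, inner_smul_right, real_inner_comm (g.U p)]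
  ring

/-- The wave operator `|g|^{-1/2} ∂_i (|g|^{1/2} g^{ij} ∂_j v)`; the volume form of the metric is
`e^{-2η} dτ dz dσ`. -/
def box (v : Pt → ℝ) (p : Pt) : ℝ :=
  Real.exp (2 * g.η p) *
    (Dτ (fun y => Real.exp (-2 * g.η y) * (g.grad v y).1) p
      + Dz (fun y => Real.exp (-2 * g.η y) * (g.grad v y).2.1) p
      + divS (fun y => Real.exp (-2 * g.η y) • (g.grad v y).2.2) p)

/-- The `C¹` norms on `s` of the components `g^{ij}` are at most `K`. -/
def InvC1BoundOn (s : Set Pt) (K : ℝ) : Prop :=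
  C1BoundOn g.W s K ∧ C1BoundOn g.U s K ∧ C1BoundOn g.angInv s K

/-- Uniform nondegeneracy on `s`: `g^{AB} ξ_A ξ_B ≥ c |ξ|²`. -/
def NondegOn (s : Set Pt) (c : ℝ) : Prop :=
  ∀ p ∈ s, ∀ ξ : E3, c * ‖ξ‖ ^ 2 ≤ ⟪g.angInv p ξ, ξ⟫

/-- The null vector field `N₁ = ∇τ = ∂_z`. -/
def N1 : Vec := (0, 1, 0)

/-- The null vector field `N₂ = -(∂_τ + ½ z²V ∂_z + g^{zA} ∂_A)`. -/
def N2 (p : Pt) : Vec := -(1, g.W p / 2, g.U p)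

/-! ### The null cone `H` and the region between `H` and conformal infinity -/

/-- The function `ζ(τ, x) - z`, whose zero set is the graph `z = ζ(τ, x)`. -/
def defFun (ζ : ℝ × S2 → ℝ) : Pt → ℝ := fun p => ζ (p.1, p.2.2) - p.2.1

/-- The point of the graph above `(τ, x)`. -/
def onGraph (ζ : ℝ × S2 → ℝ) (y : ℝ × S2) : Pt := (y.1, ζ y, y.2)

/-- The graph `z = ζ(τ, x)`, `0 ≤ τ ≤ T`, is the ingoing null cone issuing from the sphere
`τ = z = 0`: a `C¹` null hypersurface through this sphere, inside the slab. -/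
structure IsNullCone (ζ : ℝ × S2 → ℝ) : Prop where
  contDiff : IsCk 1 (defFun ζ) {p | p.1 ∈ Icc 0 T}
  start : ∀ x : S2, ζ (0, x) = 0
  inside : ∀ y : ℝ × S2, y.1 ∈ Ioc 0 T → 0 < ζ y ∧ ζ y ≤ 1 / R
  null : ∀ y : ℝ × S2, y.1 ∈ Icc 0 T →
    g.metric (onGraph ζ y) (g.grad (defFun ζ) (onGraph ζ y)) (g.grad (defFun ζ) (onGraph ζ y)) = 0

/-- The density `E_H[φ, b₁, b₂]` at a point `p` of the cone, for the null normal
`N_H = ∇(ζ - z) = l₁ N₁ + N₂ + l₃ e₃ + l₄ e₄` (so `l₂ = 1`), where `e₃, e₄` is an orthonormal frame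
of the sphere `τ, z = const`. With `E₁ = l₃ N₁ + e₃`, `E₂ = l₄ N₁ + e₄`,
`E₃ = N₂ + ½ (l₃ e₃ + l₄ e₄)` it is
`½ b₁ ((E₁φ)² + (E₂φ)²) + b₂ (E₃φ)² + ¼ b₂ (l₃ E₂φ - l₄ E₁φ)² + (b₂ l₁ + b₁) φ²`,
written without the frame by means of `l₃ = e₃ ζ`, `l₄ = e₄ ζ` and
`g^{AB} α_A β_B = α(e₃) β(e₃) + α(e₄) β(e₄)`; see `energyDensity_eq_frame`. -/
def energyDensity (ζ : ℝ × S2 → ℝ) (φ : Pt → ℝ) (b₁ b₂ : ℝ) (p : Pt) : ℝ :=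
  let s := gradS (defFun ζ) p
  let n := gradS φ p
  let l₁ := -g.metric p (g.grad (defFun ζ) p) (g.N2 p)
  b₁ / 2 * ⟪g.angInv p (n + Dz φ p • s), n + Dz φ p • s⟫
    + b₂ * (D φ p (g.N2 p) + ⟪g.angInv p s, n⟫ / 2) ^ 2
    + b₂ / 4 * (⟪g.angInv p s, s⟫ * ⟪g.angInv p n, n⟫ - ⟪g.angInv p s, n⟫ ^ 2)
    + (b₂ * l₁ + b₁) * φ p ^ 2

theorem gradS_tangent (v : Pt → ℝ) (p : Pt) : ⟪gradS v p, (p.2.2 : E3)⟫ = 0 := by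
  have hS : ⟪gradS v p, (p.2.2 : E3)⟫ = D v p (0, 0, (p.2.2 : E3)) := by simp [gradS]
  rw [hS]
  by_cases hd : DifferentiableAt ℝ (lift v) (emb p)
  · rw [D, ← hd.lineDeriv_eq_fderiv, lineDeriv]
    have hx : (p.2.2 : E3) ≠ 0 := by
      intro h
      have := p.2.2.2
      simp [h] at this
    have : (fun t : ℝ => lift v (emb p + t • (0, 0, (p.2.2 : E3)))) =ᶠ[nhds 0]
        fun _ => lift v (emb p) := by
      filter_upwards [lt_mem_nhds (show (-1 : ℝ) < 0 by norm_num)] with t ht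
      have ht' : 0 < 1 + t := by linarith
      have e : (p.2.2 : E3) + t • (p.2.2 : E3) = (1 + t) • (p.2.2 : E3) := by
        rw [add_smul, one_smul]
      have e2 : proj ((1 + t) • (p.2.2 : E3)) = proj (p.2.2 : E3) := by
        have : (1 + t) • (p.2.2 : E3) ≠ 0 := smul_ne_zero ht'.ne' hx
        simp only [proj, dif_neg hx, dif_neg this, Subtype.mk.injEq, norm_smul, Real.norm_eq_abs,
          abs_of_pos ht', smul_smul]
        congr 1
        field_simp
      simp [lift, emb, e, e2]
    rw [this.deriv_eq, deriv_const]
  · rw [D, fderiv_zero_of_not_differentiableAt hd]; rfl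

/-- The frame-free density agrees, for every orthonormal frame `e₃, e₄`, with the expression in
terms of the tangential fields `E₁, E₂, E₃`. -/
theorem energyDensity_eq_frame {p : Pt} (hp : p ∈ closedSlab R T) (ζ : ℝ × S2 → ℝ)
    (hζ : IsCk 1 (defFun ζ) {p}) (φ : Pt → ℝ) (b₁ b₂ l₁ l₂ l₃ l₄ : ℝ) (e₃ e₄ : E3)
    (t₃ : ⟪e₃, (p.2.2 : E3)⟫ = 0) (t₄ : ⟪e₄, (p.2.2 : E3)⟫ = 0)
    (h33 : g.metric p (0, 0, e₃) (0, 0, e₃) = 1) (h44 : g.metric p (0, 0, e₄) (0, 0, e₄) = 1)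
    (h34 : g.metric p (0, 0, e₃) (0, 0, e₄) = 0)
    (hN : g.grad (defFun ζ) p
      = l₁ • N1 + l₂ • g.N2 p + l₃ • ((0, 0, e₃) : Vec) + l₄ • ((0, 0, e₄) : Vec)) :
    let E₁φ := D φ p ((l₃ / l₂) • N1 + (0, 0, e₃))
    let E₂φ := D φ p ((l₄ / l₂) • N1 + (0, 0, e₄))
    let E₃φ := D φ p (g.N2 p + (0, 0, (l₃ / (2 * l₂)) • e₃ + (l₄ / (2 * l₂)) • e₄))
    l₂ = 1 ∧ g.energyDensity ζ φ b₁ b₂ p =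
      b₁ * l₂ / 2 * (E₁φ ^ 2 + E₂φ ^ 2) + b₂ * l₂ * E₃φ ^ 2
        + b₂ * l₂ / 4 * (l₃ * E₂φ - l₄ * E₁φ) ^ 2 + (b₂ * l₁ + b₁ * l₂) * φ p ^ 2 := by
  intro E₁φ E₂φ E₃φ
  have hF : Dz (defFun ζ) p = -1 := by
    have hd : DifferentiableAt ℝ (lift (defFun ζ)) (emb p) :=
      (hζ p rfl).differentiableAt (by norm_num)
    rw [Dz, D, ← hd.lineDeriv_eq_fderiv, lineDeriv]
    have : (fun t : ℝ => lift (defFun ζ) (emb p + t • ((0, 1, 0) : Vec)))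
        = fun t => (ζ (p.1, proj (p.2.2 : E3)) - p.2.1) - t := by
      funext t
      simp [lift, emb, defFun]
      ring
    rw [this]
    simp
  have hN1 := congrArg Prod.fst hN
  have hN2 := congrArg (fun y : Vec => y.2.1) hN
  have hN3 := congrArg (fun y : Vec => y.2.2) hN
  simp [grad, N1, N2, hF] at hN1 hN2 hN3
  have hl₂ : l₂ = 1 := by linarith
  refine ⟨hl₂, ?_⟩
  subst hl₂
  set s := gradS (defFun ζ) p with hs
  set n := gradS φ p with hn
  have hGs : g.angInv p s = l₃ • e₃ + l₄ • e₄ := by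
    have := congrArg (fun y : E3 => g.U p + y) hN3
    simp only [one_smul] at this
    rw [show g.U p + (-g.U p + g.angInv p s) = g.angInv p s by abel] at this
    rw [this]; abel
  set A : E3 →L[ℝ] E3 := Real.exp (-2 * g.η p) • g.h p with hA
  have hAG : ∀ m : E3, A (g.angInv p m) = m := fun m => g.mul_angInv hp m
  have hAs : ∀ ξ χ : E3, ⟪A ξ, χ⟫ = ⟪ξ, A χ⟫ := fun ξ χ => by
    have e1 : ∀ ξ, A ξ = Real.exp (-2 * g.η p) • g.h p ξ := fun _ => rfl
    rw [e1, e1, real_inner_smul_left, real_inner_smul_right, g.h_symm p hp]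
  have hAx : A (p.2.2 : E3) = Real.exp (-2 * g.η p) • (p.2.2 : E3) := by
    have e1 : ∀ ξ, A ξ = Real.exp (-2 * g.η p) • g.h p ξ := fun _ => rfl
    rw [e1, g.h_normal p hp]
  have hm : ∀ ξ χ : E3, g.metric p (0, 0, ξ) (0, 0, χ) = ⟪A ξ, χ⟫ := fun ξ χ => by
    have e1 : ∀ ξ, A ξ = Real.exp (-2 * g.η p) • g.h p ξ := fun _ => rfl
    rw [e1, real_inner_smul_left]
    simp [metric]
  rw [hm] at h33 h44 h34
  have h43 : ⟪A e₄, e₃⟫ = 0 := by rw [hAs, real_inner_comm]; exact h34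
  have hx1 : ⟪(p.2.2 : E3), (p.2.2 : E3)⟫ = 1 := by
    rw [real_inner_self_eq_norm_sq]; simp
  have hnx : ⟪n, (p.2.2 : E3)⟫ = 0 := gradS_tangent φ p
  -- the frame and the unit normal span `ℝ³`
  have hspan : ∀ r : E3, ⟪A r, e₃⟫ = 0 → ⟪A r, e₄⟫ = 0 → ⟪A r, (p.2.2 : E3)⟫ = 0 → A r = 0 := by
    intro r r3 r4 rx
    have hli : LinearIndependent ℝ ![e₃, e₄, (p.2.2 : E3)] := by
      rw [Fintype.linearIndependent_iff]
      intro u hu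
      simp only [Fin.sum_univ_three, Matrix.cons_val_zero, Matrix.cons_val_one,
        Matrix.cons_val_two, Matrix.head_cons, Matrix.tail_cons] at hu
      have a3 := congrArg (fun y => ⟪A e₃, y⟫) hu
      have a4 := congrArg (fun y => ⟪A e₄, y⟫) hu
      have ax := congrArg (fun y => ⟪(p.2.2 : E3), y⟫) hu
      have b3 : ⟪A e₃, (p.2.2 : E3)⟫ = 0 := by rw [hAs, hAx, real_inner_smul_right, t₃, mul_zero]
      have b4 : ⟪A e₄, (p.2.2 : E3)⟫ = 0 := by rw [hAs, hAx, real_inner_smul_right, t₄, mul_zero]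
      simp only [inner_add_right, real_inner_smul_right, h33, h34, h43, h44, b3, b4,
        inner_zero_right] at a3 a4
      rw [inner_add_right, inner_add_right, real_inner_smul_right, real_inner_smul_right,
        real_inner_smul_right, real_inner_comm, t₃, real_inner_comm, t₄, hx1,
        inner_zero_right] at ax
      intro i
      fin_cases i
      · simpa using a3
      · simpa using a4
      · simpa using ax
    have htop := hli.span_eq_top_of_card_eq_finrank' (by simp)
    have hmem : A r ∈ (⊤ : Submodule ℝ E3) := trivial
    rw [← htop] at hmem
    have : ∀ y ∈ Submodule.span ℝ (Set.range ![e₃, e₄, (p.2.2 : E3)]), ⟪A r, y⟫ = 0 := by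
      intro y hy
      induction hy using Submodule.span_induction with
      | mem y hy =>
        obtain ⟨i, rfl⟩ := hy
        fin_cases i
        · exact r3
        · exact r4
        · exact rx
      | zero => simp
      | add y z _ _ hy hz => rw [inner_add_right, hy, hz, add_zero]
      | smul t y _ hy => rw [real_inner_smul_right, hy, mul_zero]
    exact inner_self_eq_zero.mp (this _ hmem)
  have hGn : n = ⟪n, e₃⟫ • A e₃ + ⟪n, e₄⟫ • A e₄ := by
    have h0 := hspan (g.angInv p n - (⟪n, e₃⟫ • e₃ + ⟪n, e₄⟫ • e₄))
    rw [map_sub, hAG, map_add, map_smul, map_smul] at h0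
    have b3 : ⟪A e₃, (p.2.2 : E3)⟫ = 0 := by rw [hAs, hAx, real_inner_smul_right, t₃, mul_zero]
    have b4 : ⟪A e₄, (p.2.2 : E3)⟫ = 0 := by rw [hAs, hAx, real_inner_smul_right, t₄, mul_zero]
    refine sub_eq_zero.mp (h0 ?_ ?_ ?_)
    · simp only [inner_sub_left, inner_add_left, real_inner_smul_left, h33, h43]; ring
    · simp only [inner_sub_left, inner_add_left, real_inner_smul_left, h34, h44]; ring
    · simp only [inner_sub_left, inner_add_left, real_inner_smul_left, b3, b4, hnx]; ring
  have hGnn : ⟪g.angInv p n, n⟫ = ⟪n, e₃⟫ ^ 2 + ⟪n, e₄⟫ ^ 2 := by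
    have k : ∀ e : E3, ⟪g.angInv p n, A e⟫ = ⟪n, e⟫ := fun e => by rw [← hAs, hAG]
    calc ⟪g.angInv p n, n⟫ = ⟪g.angInv p n, ⟪n, e₃⟫ • A e₃ + ⟪n, e₄⟫ • A e₄⟫ := by rw [← hGn]
      _ = _ := by
        rw [inner_add_right, real_inner_smul_right, real_inner_smul_right, k, k]; ring
  have hGsn : ⟪g.angInv p s, n⟫ = l₃ * ⟪n, e₃⟫ + l₄ * ⟪n, e₄⟫ := by
    rw [hGs, inner_add_left, real_inner_smul_left, real_inner_smul_left, real_inner_comm,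
      real_inner_comm n e₄]
  have hGss : ⟪g.angInv p s, s⟫ = l₃ ^ 2 + l₄ ^ 2 := by
    have : s = l₃ • A e₃ + l₄ • A e₄ := by rw [← hAG s, hGs, map_add, map_smul, map_smul]
    rw [hGs, this]
    simp only [inner_add_left, inner_add_right, real_inner_smul_left, real_inner_smul_right,
      ← hAs, map_smul, h33, h34, h43, h44]
    ring
  have hGns : ⟪g.angInv p n, s⟫ = l₃ * ⟪n, e₃⟫ + l₄ * ⟪n, e₄⟫ := by
    rw [← hGsn]
    conv_lhs => rw [← hAG s]
    rw [← hAs, hAG, real_inner_comm]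
  have hl₁ : -g.metric p (g.grad (defFun ζ) p) (g.N2 p) = l₁ := by
    rw [g.metric_grad hp, D_apply, hF, N2]
    simp only [Prod.fst_neg, Prod.snd_neg, inner_neg_right]
    rw [← hs, real_inner_comm]
    linarith
  have hE₁ : E₁φ = l₃ * Dz φ p + ⟪n, e₃⟫ := by
    simp [E₁φ, D_apply, N1, hn]
  have hE₂ : E₂φ = l₄ * Dz φ p + ⟪n, e₄⟫ := by
    simp [E₂φ, D_apply, N1, hn]
  have hE₃ : E₃φ = D φ p (g.N2 p) + (l₃ * ⟪n, e₃⟫ + l₄ * ⟪n, e₄⟫) / 2 := by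
    simp only [E₃φ, map_add, add_right_inj]
    rw [D_apply, inner_add_right, real_inner_smul_right, real_inner_smul_right, ← hn]
    ring
  simp only [energyDensity]
  rw [← hs, ← hn, hl₁, hE₁, hE₂, hE₃]
  simp only [map_add, map_smul, inner_add_left, inner_add_right, real_inner_smul_left,
    real_inner_smul_right, hGnn, hGsn, hGss, hGns]
  ring

/-- The region between the cone and conformal infinity, up to time `T`. -/
def region (_ : ConformalMetric Λ R T) (ζ : ℝ × S2 → ℝ) : Set Pt :=
  {p | p.1 ∈ Ioo 0 T ∧ p.2.1 ∈ Ioo 0 (ζ (p.1, p.2.2))}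

/-- The same region with its boundary. -/
def closedRegion (_ : ConformalMetric Λ R T) (ζ : ℝ × S2 → ℝ) : Set Pt :=
  {p | p.1 ∈ Icc 0 T ∧ p.2.1 ∈ Icc 0 (ζ (p.1, p.2.2))}

/-- The null energy `∫_H w E_H[φ, b₁, b₂] dH` up to time `T`. The volume element of the cone adapted
to `N_H` is `e^{-2η} dτ dσ`. -/
def nullEnergy (w : Pt → ℝ) (ζ : ℝ × S2 → ℝ) (φ : Pt → ℝ) (b₁ b₂ : ℝ) : ℝ :=
  ∫ y in Ioo 0 T ×ˢ univ,
    w (onGraph ζ y) * g.energyDensity ζ φ b₁ b₂ (onGraph ζ y)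
      * Real.exp (-2 * g.η (onGraph ζ y)) ∂vol3

end ConformalMetric

/-! ### Weighted norms -/

/-- The weight `h = e^{-q l τ + q z}`. -/
def weight (q l : ℝ) (p : Pt) : ℝ := Real.exp (-(q * l * p.1) + q * p.2.1)

/-- The weighted norm `‖w^{1/2} F‖_{L²(s)}`. -/
def wL2 {X : Type*} [MeasurableSpace X] (μ : Measure X) (s : Set X) (w F : X → ℝ) : ℝ :=
  Real.sqrt (∫ x in s, w x * F x ^ 2 ∂μ)

/-- `‖v‖_{H¹_w(s)}` for a region `s` of spacetime. -/
def wH1 (s : Set Pt) (w v : Pt → ℝ) : ℝ :=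
  wL2 vol4 s w v
    + wL2 vol4 s w (fun p => Real.sqrt (Dτ v p ^ 2 + Dz v p ^ 2 + ‖gradS v p‖ ^ 2))

/-- `‖v‖_{H¹_w}` of the part `s` of the hypersurface `τ = T`. -/
def wH1Slice (T : ℝ) (s : Set (ℝ × S2)) (w v : Pt → ℝ) : ℝ :=
  wL2 vol3 s (fun y => w (T, y)) (fun y => v (T, y))
    + wL2 vol3 s (fun y => w (T, y))
        (fun y => Real.sqrt (Dz v (T, y) ^ 2 + ‖gradS v (T, y)‖ ^ 2))

/-- The point of conformal infinity `z = 0` with coordinates `(τ, x)`. -/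
def onInfinity (y : ℝ × S2) : Pt := (y.1, 0, y.2)

/-- `‖F‖_{L²_w}` of conformal infinity up to time `T`. -/
def wL2Infinity (T : ℝ) (w F : Pt → ℝ) : ℝ :=
  wL2 vol3 (Ioo 0 T ×ˢ univ) (fun y => w (onInfinity y)) (fun y => F (onInfinity y))

/-- `‖v‖_{H¹_w}` of conformal infinity up to time `T` (only tangential derivatives). -/
def wH1Infinity (T : ℝ) (w v : Pt → ℝ) : ℝ :=
  wL2Infinity T w v
    + wL2Infinity T w (fun p => Real.sqrt (Dτ v p ^ 2 + ‖gradS v p‖ ^ 2))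

end AdSWave

end

noncomputable section

namespace AdSWave

/-! ### Calculus of lifted fields -/

section Calculus

/-! The proof is an energy identity with an exponential weight. The current J = `current b v`
belongs to the multiplier X = b N₁ + N₂ with constant b > 0, which is timelike because g(X, X) =
-2b. Its term -v² X adds v itself to the energy. In the divergence of J the second derivatives of v
cancel except for those in □v (`Div_current`), so the wave equation bounds this divergence by v²,
the squares of the first derivatives, and f² (`BoundedAt.Div_current_le`). Multiplication by the
weight h adds -q h (l J^τ - J^z). The covector l dτ - dz is timelike when l > W/2, where W = z²V.
Hence this term is negative definite in v and all its first derivatives (`BoundedAt.jet_le`), and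
for large q it absorbs every error term, including those of a and ω (`BoundedAt.Div_weighted_le`).

What remains is the sign of three boundary fluxes. On τ = T the component J^τ is positive in v and
its tangential derivatives (`le_current_time`). On the null cone the flux is exactly E_H with b₁ = b
and b₂ = 1 (`flux_eq_energyDensity`). At conformal infinity the coefficient of (∂_z v)² in J^z is
½W(b - W/2). It is negative for b < W/2, so the boundary term yields ∂_z v there at the price of the
tangential derivatives and v (`current_radial_infinity_le`). This fixes the choice b = -Λ/12, a
quarter of W at infinity.

The divergence theorem has to be proved on a region that pinches off at τ = 0
(`IsConeGraph.integral_Div`). The substitution z = s ζ turns the region into a cylinder, on which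
one integrates by parts in τ and in s, and on each sphere the divergence of a tangent field
integrates to zero (`integral_sphere_divergence`).

All constants are powers of one number κ that dominates the data, so neither R nor T enters. Bounds
for η are not assumed separately; they are read off from g^{AB} (`D_eta`). -/

theorem sphere_ne_zero (x : S2) : (x : E3) ≠ 0 := by
  intro h
  have := x.2
  simp [h] at this

theorem sphere_inner_self (x : S2) : ⟪(x : E3), (x : E3)⟫ = 1 := by
  rw [real_inner_self_eq_norm_sq]; simp

@[simp] theorem proj_coe (x : S2) : proj (x : E3) = x := by
  simp [proj, sphere_ne_zero x]

theorem coe_proj {y : E3} (hy : y ≠ 0) : (proj y : E3) = ‖y‖⁻¹ • y := by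
  simp [proj, hy]

theorem proj_smul {t : ℝ} (ht : 0 < t) (y : E3) : proj (t • y) = proj y := by
  by_cases hy : y = 0
  · simp [hy]
  · have : t • y ≠ 0 := smul_ne_zero ht.ne' hy
    apply Subtype.ext
    rw [coe_proj hy, coe_proj this, norm_smul, Real.norm_eq_abs, abs_of_pos ht, smul_smul]
    congr 1
    field_simp

@[simp] theorem lift_emb {G : Type*} (F : Pt → G) (p : Pt) : lift F (emb p) = F p := by
  simp [lift, emb]

theorem continuous_emb : Continuous emb := by
  unfold emb; fun_prop

/-- The radial projection of `ℝ × ℝ × ℝ³` onto the image of `ℝ × ℝ × S²`. -/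
def radial (y : Vec) : Vec := (y.1, y.2.1, ‖y.2.2‖⁻¹ • y.2.2)

@[simp] theorem radial_emb (p : Pt) : radial (emb p) = emb p := by
  simp [radial, emb]

theorem emb_proj {y : Vec} (hy : y.2.2 ≠ 0) : emb (y.1, y.2.1, proj y.2.2) = radial y := by
  simp [emb, radial, coe_proj hy]

theorem emb_ne_zero (p : Pt) : (emb p).2.2 ≠ 0 := sphere_ne_zero p.2.2

theorem eventually_ne_zero (p : Pt) : ∀ᶠ y in nhds (emb p), y.2.2 ≠ 0 :=
  (continuous_snd.comp continuous_snd).continuousAt.eventually_ne (emb_ne_zero p)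

theorem contDiffAt_radial {n : WithTop ℕ∞} {y : Vec} (hy : y.2.2 ≠ 0) :
    ContDiffAt ℝ n radial y := by
  unfold radial
  have h1 : ContDiffAt ℝ n (fun y : Vec => ‖y.2.2‖⁻¹) y :=
    (ContDiffAt.norm ℝ (ContDiffAt.snd contDiffAt_snd) hy).inv (norm_ne_zero_iff.mpr hy)
  exact contDiffAt_fst.prodMk ((contDiffAt_snd.fst).prodMk (h1.smul contDiffAt_snd.snd))

/-- At a point of the unit sphere the norm has zero derivative in directions orthogonal to that
point, so dividing by it changes nothing to first order. -/
theorem fderiv_radial (p : Pt) {Y : Vec} (hY : ⟪(p.2.2 : E3), Y.2.2⟫ = 0) :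
    fderiv ℝ radial (emb p) Y = Y := by
  have hn : HasFDerivAt (fun y : Vec => ‖y.2.2‖ ^ 2)
      ((2 • innerSL ℝ (p.2.2 : E3)).comp
        ((ContinuousLinearMap.snd ℝ ℝ E3).comp (ContinuousLinearMap.snd ℝ ℝ (ℝ × E3)))) (emb p) :=
    HasFDerivAt.comp (g := fun y : E3 => ‖y‖ ^ 2) (emb p)
      (hasStrictFDerivAt_norm_sq (p.2.2 : E3)).hasFDerivAt
      ((ContinuousLinearMap.snd ℝ ℝ E3).comp
        (ContinuousLinearMap.snd ℝ ℝ (ℝ × E3))).hasFDerivAt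
  -- Factoring the inverse norm through ‖·‖² shows that its differential is a multiple of ⟪x, ·⟫;
  -- the value of the multiple is irrelevant.
  have hs : HasDerivAt (fun u : ℝ => (Real.sqrt u)⁻¹) (deriv (fun u : ℝ => (Real.sqrt u)⁻¹) 1)
      (‖(emb p).2.2‖ ^ 2) := by
    have : ‖(emb p).2.2‖ ^ 2 = (1 : ℝ) := by simp [emb]
    rw [this]
    exact DifferentiableAt.hasDerivAt (by
      refine DifferentiableAt.inv (DifferentiableAt.sqrt differentiableAt_id one_ne_zero) (by simp))
  have hc := hs.comp_hasFDerivAt (emb p) hn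
  have he : ((fun u : ℝ => (Real.sqrt u)⁻¹) ∘ fun y : Vec => ‖y.2.2‖ ^ 2)
      = fun y : Vec => ‖y.2.2‖⁻¹ := by
    funext y; simp [Real.sqrt_sq]
  rw [he] at hc
  have h3 := hc.smul ((ContinuousLinearMap.snd ℝ ℝ E3).comp
        (ContinuousLinearMap.snd ℝ ℝ (ℝ × E3))).hasFDerivAt
  have h1 : HasFDerivAt (fun y : Vec => y.1) (ContinuousLinearMap.fst ℝ ℝ (ℝ × E3)) (emb p) :=
    (ContinuousLinearMap.fst ℝ ℝ (ℝ × E3)).hasFDerivAt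
  have h2 : HasFDerivAt (fun y : Vec => y.2.1) ((ContinuousLinearMap.fst ℝ ℝ E3).comp
        (ContinuousLinearMap.snd ℝ ℝ (ℝ × E3))) (emb p) :=
    ((ContinuousLinearMap.fst ℝ ℝ E3).comp
        (ContinuousLinearMap.snd ℝ ℝ (ℝ × E3))).hasFDerivAt
  have h := h1.prodMk (h2.prodMk h3)
  have h' : HasFDerivAt radial _ (emb p) := h
  rw [h'.fderiv]
  ext1
  · simp
  · ext1
    · simp
    · simp [emb, hY]

variable {G H : Type*} [NormedAddCommGroup G] [NormedSpace ℝ G]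
  [NormedAddCommGroup H] [NormedSpace ℝ H]

/-- `F` has a derivative at `p`. -/
def DiffAt (F : Pt → G) (p : Pt) : Prop := DifferentiableAt ℝ (lift F) (emb p)

theorem IsCk.diffAt {k : ℕ} {F : Pt → G} {s : Set Pt} (h : IsCk k F s) (hk : k ≠ 0) {p : Pt}
    (hp : p ∈ s) : DiffAt F p :=
  (h p hp).differentiableAt (by exact_mod_cast hk)

theorem IsCk.mono {k : ℕ} {F : Pt → G} {s t : Set Pt} (h : IsCk k F t) (hst : s ⊆ t) :
    IsCk k F s := fun p hp => h p (hst hp)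

theorem IsCk.of_le {k m : ℕ} {F : Pt → G} {s : Set Pt} (h : IsCk k F s) (hm : m ≤ k) :
    IsCk m F s := fun p hp => (h p hp).of_le (by exact_mod_cast hm)

theorem IsCk.continuousAt {k : ℕ} {F : Pt → G} {s : Set Pt} (h : IsCk k F s) {p : Pt}
    (hp : p ∈ s) : ContinuousAt F p := by
  have : F = lift F ∘ emb := by funext p; simp
  rw [this]
  exact (h p hp).continuousAt.comp continuous_emb.continuousAt

theorem IsCk.continuousAt_D {k : ℕ} {F : Pt → G} {s : Set Pt} (h : IsCk k F s) (hk : k ≠ 0)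
    {p : Pt} (hp : p ∈ s) : ContinuousAt (D F) p := by
  have h1 : ContDiffAt ℝ 1 (lift F) (emb p) := (h p hp).of_le (by
    exact_mod_cast Nat.one_le_iff_ne_zero.mpr hk)
  exact (h1.fderiv_right (m := 0) (by norm_num)).continuousAt.comp continuous_emb.continuousAt

/-- Restricting an ambient function to the sphere and lifting it again does not return the function.
The result is constant along rays and agrees with the original to first order only in directions
tangent to the sphere. -/
theorem lift_comp_emb {G : Type*} (Φ : Vec → G) (p : Pt) :
    lift (fun p => Φ (emb p)) =ᶠ[nhds (emb p)] Φ ∘ radial := by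
  filter_upwards [eventually_ne_zero p] with y hy
  simp [lift, emb_proj hy]

theorem IsCk.of_comp_emb {k : ℕ} {Φ : Vec → G} {s : Set Pt}
    (h : ∀ p ∈ s, ContDiffAt ℝ k Φ (emb p)) : IsCk k (fun p => Φ (emb p)) s := by
  intro p hp
  refine ContDiffAt.congr_of_eventuallyEq ?_ (lift_comp_emb Φ p)
  refine ContDiffAt.comp _ ?_ (contDiffAt_radial (emb_ne_zero p))
  simpa using h p hp

theorem D_comp_emb {Φ : Vec → G} {p : Pt} (h : DifferentiableAt ℝ Φ (emb p)) {Y : Vec}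
    (hY : ⟪(p.2.2 : E3), Y.2.2⟫ = 0) :
    D (fun p => Φ (emb p)) p Y = fderiv ℝ Φ (emb p) Y := by
  have h' : DifferentiableAt ℝ Φ (radial (emb p)) := by simpa using h
  rw [D, (lift_comp_emb Φ p).fderiv_eq, fderiv_comp _ h'
    ((contDiffAt_radial (n := 1) (emb_ne_zero p)).differentiableAt (by norm_num))]
  simp [fderiv_radial p hY]

theorem IsCk.D {k : ℕ} {F : Pt → G} {s : Set Pt} (h : IsCk (k + 1) F s) : IsCk k (D F) s :=
  IsCk.of_comp_emb (Φ := fderiv ℝ (lift F)) fun p hp =>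
    (h p hp).fderiv_right (by push_cast; exact le_rfl)

/-- `lift (D v)` is constant along rays while `fderiv ℝ (lift v)` is not, so the iterated
differential is a genuine Hessian only when differentiated along the sphere. Hence both directions
must be tangent. -/
theorem D_D_apply_comm {v : Pt → ℝ} {s : Set Pt} (h : IsCk 2 v s) {p : Pt} (hp : p ∈ s)
    {X Y : Vec} (hX : ⟪(p.2.2 : E3), X.2.2⟫ = 0) (hY : ⟪(p.2.2 : E3), Y.2.2⟫ = 0) :
    D (D v) p X Y = D (D v) p Y X := by
  have hd : DifferentiableAt ℝ (fderiv ℝ (lift v)) (emb p) :=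
    ((h p hp).fderiv_right (m := 1) (by norm_num)).differentiableAt (by norm_num)
  have e : ∀ {Z : Vec}, ⟪(p.2.2 : E3), Z.2.2⟫ = 0 →
      D (D v) p Z = fderiv ℝ (fderiv ℝ (lift v)) (emb p) Z := fun hZ =>
    D_comp_emb (Φ := fderiv ℝ (lift v)) hd hZ
  rw [e hX, e hY]
  exact ((h p hp).isSymmSndFDerivAt (by simp)) X Y

/-! Composition with smooth maps and the rules of differentiation -/

theorem IsCk.clm_comp {k : ℕ} {F : Pt → G} {s : Set Pt} (h : IsCk k F s) (L : G →L[ℝ] H) :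
    IsCk k (fun p => L (F p)) s := fun p hp => L.contDiff.contDiffAt.comp _ (h p hp)

theorem D_clm_comp {F : Pt → G} {p : Pt} (h : DiffAt F p) (L : G →L[ℝ] H) (Y : Vec) :
    D (fun p => L (F p)) p Y = L (D F p Y) := by
  have hL : HasFDerivAt (lift fun p => L (F p)) (L.comp (D F p)) (emb p) :=
    L.hasFDerivAt.comp (emb p) h.hasFDerivAt
  rw [D, hL.fderiv]; rfl

theorem IsCk.mul {k : ℕ} {a b : Pt → ℝ} {s : Set Pt} (ha : IsCk k a s) (hb : IsCk k b s) :
    IsCk k (fun p => a p * b p) s := fun p hp => ContDiffAt.mul (ha p hp) (hb p hp)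

theorem IsCk.smul {k : ℕ} {a : Pt → ℝ} {F : Pt → G} {s : Set Pt} (ha : IsCk k a s)
    (hb : IsCk k F s) : IsCk k (fun p => a p • F p) s := fun p hp =>
  ContDiffAt.smul (ha p hp) (hb p hp)

theorem IsCk.add {k : ℕ} {a b : Pt → G} {s : Set Pt} (ha : IsCk k a s) (hb : IsCk k b s) :
    IsCk k (fun p => a p + b p) s := fun p hp => ContDiffAt.add (ha p hp) (hb p hp)

theorem IsCk.sub {k : ℕ} {a b : Pt → G} {s : Set Pt} (ha : IsCk k a s) (hb : IsCk k b s) :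
    IsCk k (fun p => a p - b p) s := fun p hp => ContDiffAt.sub (ha p hp) (hb p hp)

theorem IsCk.const {k : ℕ} (a : G) {s : Set Pt} : IsCk k (fun _ => a) s := fun _ _ =>
  contDiffAt_const

theorem IsCk.inner {k : ℕ} {a b : Pt → E3} {s : Set Pt} (ha : IsCk k a s) (hb : IsCk k b s) :
    IsCk k (fun p => ⟪a p, b p⟫) s := fun p hp => ContDiffAt.inner ℝ (ha p hp) (hb p hp)

theorem IsCk.clm_apply {k : ℕ} {A : Pt → G →L[ℝ] H} {b : Pt → G} {s : Set Pt} (ha : IsCk k A s)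
    (hb : IsCk k b s) : IsCk k (fun p => A p (b p)) s := fun p hp =>
  ContDiffAt.clm_apply (ha p hp) (hb p hp)

theorem IsCk.prodMk {k : ℕ} {a : Pt → G} {b : Pt → H} {s : Set Pt} (ha : IsCk k a s)
    (hb : IsCk k b s) : IsCk k (fun p => (a p, b p)) s := fun p hp =>
  ContDiffAt.prodMk (ha p hp) (hb p hp)

theorem IsCk.exp {k : ℕ} {a : Pt → ℝ} {s : Set Pt} (ha : IsCk k a s) :
    IsCk k (fun p => Real.exp (a p)) s := fun p hp => ContDiffAt.exp (ha p hp)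

theorem D_mul {a b : Pt → ℝ} {p : Pt} (ha : DiffAt a p) (hb : DiffAt b p) (Y : Vec) :
    D (fun p => a p * b p) p Y = a p * D b p Y + b p * D a p Y := by
  have : lift (fun p => a p * b p) = lift a * lift b := rfl
  rw [D, this, fderiv_mul ha hb]
  simp [D]

theorem D_smul {a : Pt → ℝ} {F : Pt → G} {p : Pt} (ha : DiffAt a p) (hb : DiffAt F p) (Y : Vec) :
    D (fun p => a p • F p) p Y = a p • D F p Y + D a p Y • F p := by
  have : lift (fun p => a p • F p) = lift a • lift F := rfl
  rw [D, this, fderiv_smul ha hb]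
  simp [D]

theorem D_sub {a b : Pt → G} {p : Pt} (ha : DiffAt a p) (hb : DiffAt b p) (Y : Vec) :
    D (fun p => a p - b p) p Y = D a p Y - D b p Y := by
  have : lift (fun p => a p - b p) = lift a - lift b := rfl
  rw [D, this, fderiv_sub ha hb]
  rfl

theorem D_clm_apply {A : Pt → G →L[ℝ] H} {b : Pt → G} {p : Pt} (ha : DiffAt A p)
    (hb : DiffAt b p) (Y : Vec) :
    D (fun p => A p (b p)) p Y = A p (D b p Y) + D A p Y (b p) := by
  have h := fderiv_clm_apply (𝕜 := ℝ) (c := lift A) (u := lift b) ha hb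
  rw [lift_emb, lift_emb] at h
  have h' := congrArg (fun L : Vec →L[ℝ] H => L Y) h
  exact h'

theorem D_const (a : G) (p : Pt) : D (fun _ => a) p = 0 := by
  have : lift (fun _ : Pt => a) = fun _ => a := rfl
  rw [D, this, fderiv_fun_const]; rfl

theorem D_exp {a : Pt → ℝ} {p : Pt} (ha : DiffAt a p) (Y : Vec) :
    D (fun p => Real.exp (a p)) p Y = Real.exp (a p) * D a p Y := by
  have h : HasFDerivAt (lift fun p => Real.exp (a p)) (Real.exp (lift a (emb p)) • D a p) (emb p) :=
    ha.hasFDerivAt.exp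
  rw [D, h.fderiv, lift_emb]; rfl

/-- Functions of the point that do not depend on the angular variable. -/
theorem IsCk.comp_time {k : ℕ} {f : ℝ × ℝ → G} (hf : ContDiff ℝ k f) {s : Set Pt} :
    IsCk k (fun p => f (p.1, p.2.1)) s := fun _ _ =>
  hf.contDiffAt.comp _ (contDiff_fst.prodMk contDiff_snd.fst).contDiffAt

/-- The divergence `∂_τ Z^τ + ∂_z Z^z + div_S Z^S` of a vector field. -/
def Div (Z : Pt → Vec) (p : Pt) : ℝ :=
  Dτ (fun y => (Z y).1) p + Dz (fun y => (Z y).2.1) p + divS (fun y => (Z y).2.2) p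

theorem E3_eq_sum (ξ : E3) : ξ = ∑ i : Fin 3, ξ i • EuclideanSpace.single i (1 : ℝ) := by
  ext j
  simp [Fin.sum_univ_three]
  fin_cases j <;> simp

theorem divS_smul {a : Pt → ℝ} {Y : Pt → E3} {p : Pt} (ha : DiffAt a p) (hY : DiffAt Y p) :
    divS (fun p => a p • Y p) p = a p * divS Y p + D a p (0, 0, Y p) := by
  have e : D a p (0, 0, Y p) = ∑ i : Fin 3, D a p (0, 0, EuclideanSpace.single i 1) * Y p i := by
    have h := congrArg (fun ξ : E3 => (((D a p).comp ((ContinuousLinearMap.inr ℝ ℝ (ℝ × E3)).comp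
      (ContinuousLinearMap.inr ℝ ℝ E3))) ξ)) (E3_eq_sum (Y p))
    simp only [map_sum, map_smul] at h
    refine Eq.trans h (Finset.sum_congr rfl fun i _ => ?_)
    simp [mul_comm]
  rw [e]
  simp only [divS, Finset.mul_sum, ← Finset.sum_add_distrib]
  refine Finset.sum_congr rfl fun i _ => ?_
  rw [D_smul ha hY]
  simp

theorem Div_smul {a : Pt → ℝ} {Z : Pt → Vec} {p : Pt} (ha : DiffAt a p) (hZ : DiffAt Z p) :
    Div (fun p => a p • Z p) p = a p * Div Z p + D a p (Z p) := by
  have h1 : DiffAt (fun p => (Z p).1) p := DifferentiableAt.fst hZ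
  have h2 : DiffAt (fun p => (Z p).2.1) p := DifferentiableAt.fst (DifferentiableAt.snd hZ)
  have h3 : DiffAt (fun p => (Z p).2.2) p := DifferentiableAt.snd (DifferentiableAt.snd hZ)
  have e : D a p (Z p) = (Z p).1 * D a p (1, 0, 0) + (Z p).2.1 * D a p (0, 1, 0)
      + D a p (0, 0, (Z p).2.2) := by
    have : Z p = (Z p).1 • ((1, 0, 0) : Vec) + (Z p).2.1 • ((0, 1, 0) : Vec)
        + (0, 0, (Z p).2.2) := by
      ext <;> simp
    conv_lhs => rw [this]
    simp only [map_add, map_smul, smul_eq_mul]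
  rw [e]
  have d1 := D_mul ha h1 (1, 0, 0)
  have d2 := D_mul ha h2 (0, 1, 0)
  have d3 := divS_smul ha h3
  simp only [Div, Dτ, Dz, Prod.smul_fst, Prod.smul_snd, smul_eq_mul]
  rw [d1, d2, d3]
  ring

theorem Div_sub {Y Z : Pt → Vec} {p : Pt} (hY : DiffAt Y p) (hZ : DiffAt Z p) :
    Div (fun p => Y p - Z p) p = Div Y p - Div Z p := by
  have y1 : DiffAt (fun p => (Y p).1) p := DifferentiableAt.fst hY
  have y2 : DiffAt (fun p => (Y p).2.1) p := DifferentiableAt.fst (DifferentiableAt.snd hY)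
  have y3 : DiffAt (fun p => (Y p).2.2) p := DifferentiableAt.snd (DifferentiableAt.snd hY)
  have h1 : DiffAt (fun p => (Z p).1) p := DifferentiableAt.fst hZ
  have h2 : DiffAt (fun p => (Z p).2.1) p := DifferentiableAt.fst (DifferentiableAt.snd hZ)
  have h3 : DiffAt (fun p => (Z p).2.2) p := DifferentiableAt.snd (DifferentiableAt.snd hZ)
  simp only [Div, divS, Dτ, Dz, Prod.fst_sub, Prod.snd_sub]
  rw [D_sub y1 h1, D_sub y2 h2]
  have : ∀ i : Fin 3, D (fun y => (Y y).2.2 - (Z y).2.2) p (0, 0, EuclideanSpace.single i 1)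
      = D (fun y => (Y y).2.2) p (0, 0, EuclideanSpace.single i 1)
        - D (fun y => (Z y).2.2) p (0, 0, EuclideanSpace.single i 1) := fun i => D_sub y3 h3 _
  simp only [this, PiLp.sub_apply, Finset.sum_sub_distrib]
  ring

end Calculus

end AdSWave

namespace AdSWave

/-! ### The divergence theorem on the sphere -/

section SphereDivergence

instance : IsFiniteMeasure areaS2 := inferInstanceAs (IsFiniteMeasure (volume : Measure E3).toSphere)

/-- Integration by parts against the constant function one. -/
theorem integral_fderiv_eq_zero {F : E3 → E3} (hF : ContDiff ℝ 1 F) (hc : HasCompactSupport F)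
    (e : E3) : ∫ y, fderiv ℝ F y e = 0 := by
  have hc' : HasCompactSupport fun y => fderiv ℝ F y e := hc.fderiv_apply (𝕜 := ℝ) e
  have hcont : Continuous fun y => fderiv ℝ F y e :=
    (hF.continuous_fderiv (by norm_num)).clm_apply continuous_const
  have h := integral_smul_fderiv_eq_neg_fderiv_smul_of_integrable (𝕜 := ℝ) (μ := (volume : Measure E3))
    (f := fun _ => (1 : ℝ)) (g := F) (v := e) (by simp)
    (by simpa using hcont.integrable_of_hasCompactSupport hc')
    (by simpa using hF.continuous.integrable_of_hasCompactSupport hc)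
    (fun x _ => differentiableAt_const _) (fun x _ => hF.differentiable (by norm_num) x)
  simpa using h

/-- Polar coordinates separate a function of the direction from a function of the radius;
`volumeIoiPow 2` is the measure r² dr. -/
theorem integral_polar (d : S2 → ℝ) (k : ℝ → ℝ) :
    ∫ y : E3, d (proj y) * k ‖y‖
      = (∫ x, d x ∂areaS2) * ∫ r : Ioi (0 : ℝ), k r ∂(Measure.volumeIoiPow 2) := by
  have hdim : Module.finrank ℝ E3 - 1 = 2 := by simp
  calc ∫ y : E3, d (proj y) * k ‖y‖
      = ∫ y : ({(0 : E3)}ᶜ : Set E3), d (proj y) * k ‖(y : E3)‖ ∂((volume : Measure E3).comap (↑)) := by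
        rw [integral_subtype_comap (measurableSet_singleton _).compl
          fun y : E3 => d (proj y) * k ‖y‖, restrict_compl_singleton]
    _ = ∫ x, d x.1 * k x.2 ∂(areaS2.prod (Measure.volumeIoiPow (Module.finrank ℝ E3 - 1))) := by
        rw [areaS2, ← (volume : Measure E3).measurePreserving_homeomorphUnitSphereProd.integral_comp
          (Homeomorph.measurableEmbedding _)]
        refine integral_congr_ae (Filter.Eventually.of_forall fun y => ?_)
        have hy : (y : E3) ≠ 0 := y.2
        have : (homeomorphUnitSphereProd E3 y).1 = proj y := by
          apply Subtype.ext
          rw [coe_proj hy]; simp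
        simp [this]
    _ = _ := by
        rw [hdim]
        exact integral_prod_mul (fun x : S2 => d x) (fun r : Ioi (0 : ℝ) => k r)

/-- A smooth radial cut-off function of `‖y‖²`, equal to one near the unit sphere and vanishing
near the origin. -/
def radialBump : ContDiffBump (1 : ℝ) := ⟨1 / 4, 1 / 2, by norm_num, by norm_num⟩

theorem radialBump_eq_zero {u : ℝ} (hu : u ≤ 1 / 2 ∨ 3 / 2 ≤ u) : radialBump u = 0 := by
  refine radialBump.zero_of_le_dist ?_
  rw [Real.dist_eq]
  change (1 / 2 : ℝ) ≤ _
  rcases hu with h | h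
  · rw [abs_of_nonpos (by linarith)]; linarith
  · rw [abs_of_nonneg (by linarith)]; linarith

theorem radialBump_sq_eventually_zero : ∀ᶠ y : E3 in nhds 0, radialBump (‖y‖ ^ 2) = 0 := by
  have : ∀ᶠ y : E3 in nhds 0, ‖y‖ ^ 2 < 1 / 2 :=
    (continuous_norm.pow 2).continuousAt.eventually_lt continuousAt_const (by norm_num)
  filter_upwards [this] with y hy
  exact radialBump_eq_zero (Or.inl hy.le)

theorem hasCompactSupport_radialBump_sq : HasCompactSupport fun y : E3 => radialBump (‖y‖ ^ 2) := by
  refine HasCompactSupport.intro (isCompact_closedBall (0 : E3) 2) fun y hy => ?_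
  refine radialBump_eq_zero (Or.inr ?_)
  have : 2 < ‖y‖ := by simpa using hy
  nlinarith

theorem contDiff_radialBump_sq : ContDiff ℝ 1 fun y : E3 => radialBump (‖y‖ ^ 2) :=
  radialBump.contDiff.comp (contDiff_norm_sq ℝ)

/-- Polar coordinates with trivial angular factor express a strictly positive integral over ℝ³ as
the sphere's area times this one. The cut-off makes the integrand continuous at the origin. -/
theorem radial_integral_pos :
    ∫ r : Ioi (0 : ℝ), radialBump ((r : ℝ) ^ 2) * (r : ℝ)⁻¹ ∂(Measure.volumeIoiPow 2) ≠ 0 := by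
  intro h0
  have h := integral_polar (fun _ => 1) fun r => radialBump (r ^ 2) * r⁻¹
  rw [h0, mul_zero] at h
  have hcont : Continuous fun y : E3 => radialBump (‖y‖ ^ 2) * ‖y‖⁻¹ := by
    rw [continuous_iff_continuousAt]
    intro y
    by_cases hy : y = 0
    · subst hy
      refine ContinuousAt.congr (f := fun _ => 0) continuousAt_const ?_
      filter_upwards [radialBump_sq_eventually_zero] with y hy
      simp [hy]
    · exact contDiff_radialBump_sq.continuous.continuousAt.mul
        (continuous_norm.continuousAt.inv₀ (norm_ne_zero_iff.mpr hy))
  have hpos := hcont.integral_pos_of_hasCompactSupport_nonneg_nonzero (μ := volume)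
    (hasCompactSupport_radialBump_sq.mul_right)
    (fun y => mul_nonneg radialBump.nonneg (inv_nonneg.mpr (norm_nonneg _)))
    (x := EuclideanSpace.single 0 1) (by
      have : radialBump (1 : ℝ) = 1 := radialBump.one_of_mem_closedBall (by
        simpa using radialBump.rIn_pos.le)
      simp [this])
  simp only [one_mul] at h
  exact hpos.ne' h

/-- The integral of the divergence of a tangent field over the sphere vanishes. -/
theorem integral_sphere_divergence (Y : S2 → E3)
    (hY : ∀ x : S2, ContDiffAt ℝ 1 (fun y => Y (proj y)) (x : E3))
    (ht : ∀ x : S2, ⟪Y x, (x : E3)⟫ = 0) :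
    ∫ x : S2, ∑ i : Fin 3, (fderiv ℝ (fun y => Y (proj y)) (x : E3) (EuclideanSpace.single i 1)) i
      ∂areaS2 = 0 := by
  set Z : E3 → E3 := fun y => Y (proj y) with hZdef
  set φ : E3 → ℝ := fun y => radialBump (‖y‖ ^ 2) with hφ
  set d : S2 → ℝ := fun x => ∑ i : Fin 3, (fderiv ℝ Z (x : E3) (EuclideanSpace.single i 1)) i with hd
  have hscale : ∀ {y : E3}, y ≠ 0 → ∀ w : E3, Z w = Z (‖y‖⁻¹ • w) := fun {y} hy w => by
    simp only [hZdef]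
    rw [proj_smul (inv_pos.mpr (norm_pos_iff.mpr hy))]
  have hZ : ∀ y : E3, y ≠ 0 → ContDiffAt ℝ 1 Z y := fun y hy => by
    have e : Z = Z ∘ fun w => ‖y‖⁻¹ • w := by
      funext w; exact hscale hy w
    rw [e]
    refine ContDiffAt.comp y ?_ (contDiff_const_smul _).contDiffAt
    rw [← coe_proj hy]
    exact hY _
  -- Z is homogeneous of degree zero, so its derivative is homogeneous of degree minus one.
  have hZ' : ∀ y : E3, y ≠ 0 → ∀ e : E3, fderiv ℝ Z y e = ‖y‖⁻¹ • fderiv ℝ Z (proj y : E3) e := by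
    intro y hy e
    have h1 : HasFDerivAt (fun w : E3 => ‖y‖⁻¹ • w) (‖y‖⁻¹ • ContinuousLinearMap.id ℝ E3) y :=
      HasFDerivAt.const_smul (f := fun w => w) (hasFDerivAt_id y) ‖y‖⁻¹
    have h2 : HasFDerivAt Z (fderiv ℝ Z (proj y : E3)) (‖y‖⁻¹ • y) := by
      rw [← coe_proj hy]
      exact ((hY (proj y)).differentiableAt (by norm_num)).hasFDerivAt
    have h3 : HasFDerivAt Z _ y := (h2.comp y h1).congr_of_eventuallyEq
      (Filter.Eventually.of_forall fun w => hscale hy w)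
    rw [h3.fderiv]
    simp
  -- The cut-off removes the singularity of Z at the origin and its tail, leaving a C¹ field of
  -- compact support whose divergence integrates to zero over ℝ³.
  set F : E3 → E3 := fun y => φ y • Z y with hF
  have hFC : ContDiff ℝ 1 F := by
    rw [contDiff_iff_contDiffAt]
    intro y
    by_cases hy : y = 0
    · subst hy
      refine ContDiffAt.congr_of_eventuallyEq (f := fun _ => (0 : E3)) contDiffAt_const ?_
      filter_upwards [radialBump_sq_eventually_zero] with w hw
      simp [hF, hφ, hw]
    · exact contDiff_radialBump_sq.contDiffAt.smul (hZ y hy)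
  have hFs : HasCompactSupport F := hasCompactSupport_radialBump_sq.smul_right
  have hint : ∀ i : Fin 3, Integrable fun y => fderiv ℝ F y (EuclideanSpace.single i 1) := fun i =>
    ((hFC.continuous_fderiv (by norm_num)).clm_apply
      continuous_const).integrable_of_hasCompactSupport (hFs.fderiv_apply (𝕜 := ℝ) _)
  have h0 : ∫ y : E3, ∑ i : Fin 3, (fderiv ℝ F y (EuclideanSpace.single i 1)) i = 0 := by
    rw [integral_finsetSum]
    · refine Finset.sum_eq_zero fun i _ => ?_
      have h := (EuclideanSpace.proj (𝕜 := ℝ) i : E3 →L[ℝ] ℝ).integral_comp_comm (hint i)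
      rw [integral_fderiv_eq_zero hFC hFs] at h
      simpa using h
    · exact fun i _ => (EuclideanSpace.proj (𝕜 := ℝ) i : E3 →L[ℝ] ℝ).integrable_comp (hint i)
  -- The gradient of the cut-off is radial and Z is tangent, so their product vanishes. A function
  -- of the direction times a function of the radius remains, as `integral_polar` requires.
  have hdiv : ∀ y : E3, y ≠ 0 → ∑ i : Fin 3, (fderiv ℝ F y (EuclideanSpace.single i 1)) i
      = d (proj y) * (radialBump (‖y‖ ^ 2) * ‖y‖⁻¹) := by
    intro y hy
    have hφd : HasFDerivAt φ (deriv radialBump (‖y‖ ^ 2) • (2 • innerSL ℝ y)) y := by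
      have h1 : HasDerivAt radialBump (deriv radialBump (‖y‖ ^ 2)) (‖y‖ ^ 2) :=
        ((radialBump.contDiff (n := 1)).differentiable (by norm_num) _).hasDerivAt
      exact HasDerivAt.comp_hasFDerivAt (f := fun w : E3 => ‖w‖ ^ 2) y h1 (hasStrictFDerivAt_norm_sq y).hasFDerivAt
    have hFd := hφd.smul ((hZ y hy).differentiableAt (by norm_num)).hasFDerivAt
    have hFd' : HasFDerivAt F _ y := hFd
    have ht' : ∑ i : Fin 3, y i * Z y i = 0 := by
      have h1 : ⟪Z y, y⟫ = 0 := by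
        have h2 := ht (proj y)
        rw [coe_proj hy, real_inner_smul_right] at h2
        exact (mul_eq_zero.mp h2).resolve_left (inv_ne_zero (norm_ne_zero_iff.mpr hy))
      rw [← h1, PiLp.inner_apply]
      simp
    rw [hFd'.fderiv]
    have : ∀ i : Fin 3, ((φ y • fderiv ℝ Z y + (deriv radialBump (‖y‖ ^ 2) •
        (2 • innerSL ℝ y)).smulRight (Z y)) (EuclideanSpace.single i 1)) i
        = φ y * ‖y‖⁻¹ * (fderiv ℝ Z (proj y : E3) (EuclideanSpace.single i 1)) i
          + 2 * deriv radialBump (‖y‖ ^ 2) * (y i * Z y i) := fun i => by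
      simp [hZ' y hy, EuclideanSpace.inner_single_right]
      ring
    rw [Finset.sum_congr rfl fun i _ => this i]
    simp only [Finset.sum_add_distrib, ← Finset.mul_sum, ht', hd, hφ]
    ring
  have h1 : ∫ y : E3, d (proj y) * (radialBump (‖y‖ ^ 2) * ‖y‖⁻¹) = 0 := by
    rw [← h0]
    refine integral_congr_ae ?_
    have : ∀ᵐ y : E3, y ≠ 0 := by simp [ae_iff]
    filter_upwards [this] with y hy
    rw [hdiv y hy]
  rw [integral_polar d fun r => radialBump (r ^ 2) * r⁻¹] at h1
  exact (mul_eq_zero.mp h1).resolve_right radial_integral_pos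

end SphereDivergence

end AdSWave

namespace AdSWave

open ConformalMetric

/-! ### The divergence theorem under a graph -/

section RegionDivergence

variable {G : Type*} [NormedAddCommGroup G] [NormedSpace ℝ G]

/-- The function `ζ` of `(τ, x)` as a function of `(τ, z, x)`. -/
def ext (ζ : ℝ × S2 → ℝ) (p : Pt) : ℝ := ζ (p.1, p.2.2)

/-- The open region `0 < τ < T`, `0 < z < ζ(τ, x)`. -/
def subgraph (T : ℝ) (ζ : ℝ × S2 → ℝ) : Set Pt :=
  {p | p.1 ∈ Ioo 0 T ∧ p.2.1 ∈ Ioo 0 (ζ (p.1, p.2.2))}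

/-- The region `0 ≤ τ ≤ T`, `0 ≤ z ≤ ζ(τ, x)`. -/
def closedSubgraph (T : ℝ) (ζ : ℝ × S2 → ℝ) : Set Pt :=
  {p | p.1 ∈ Icc 0 T ∧ p.2.1 ∈ Icc 0 (ζ (p.1, p.2.2))}

/-- The closed cylinder `0 ≤ τ ≤ T`, `0 ≤ s ≤ 1`. -/
def cyl (T : ℝ) : Set Pt := Icc 0 T ×ˢ (Icc 0 1 ×ˢ univ)

/-- The open cylinder `0 < τ < T`, `0 < s < 1`. -/
def openCyl (T : ℝ) : Set Pt := Ioo 0 T ×ˢ (Ioo 0 1 ×ˢ univ)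

/-- The map `(τ, s, x) ↦ (τ, s ζ(τ, x), x)`. -/
def stretch (ζ : ℝ × S2 → ℝ) (p : Pt) : Pt := (p.1, p.2.1 * ext ζ p, p.2.2)

theorem lift_stretch {G : Type*} (ζ : ℝ × S2 → ℝ) (F : Pt → G) :
    lift (fun p => F (stretch ζ p))
      = lift F ∘ fun y : Vec => (y.1, y.2.1 * lift (ext ζ) y, y.2.2) := rfl

theorem emb_stretch (ζ : ℝ × S2 → ℝ) (p : Pt) :
    ((emb p).1, (emb p).2.1 * lift (ext ζ) (emb p), (emb p).2.2) = emb (stretch ζ p) := by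
  rw [lift_emb]; rfl

theorem D_stretch {ζ : ℝ × S2 → ℝ} {F : Pt → G} {p : Pt} (hζ : DiffAt (ext ζ) p)
    (hF : DiffAt F (stretch ζ p)) (Y : Vec) :
    D (fun p => F (stretch ζ p)) p Y
      = D F (stretch ζ p) (Y.1, Y.2.1 * ext ζ p + p.2.1 * D (ext ζ) p Y, Y.2.2) := by
  have h1 : HasFDerivAt (fun y : Vec => y.1) (ContinuousLinearMap.fst ℝ ℝ (ℝ × E3)) (emb p) :=
    (ContinuousLinearMap.fst ℝ ℝ (ℝ × E3)).hasFDerivAt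
  have h2 : HasFDerivAt (fun y : Vec => y.2.1) ((ContinuousLinearMap.fst ℝ ℝ E3).comp
        (ContinuousLinearMap.snd ℝ ℝ (ℝ × E3))) (emb p) :=
    ((ContinuousLinearMap.fst ℝ ℝ E3).comp
        (ContinuousLinearMap.snd ℝ ℝ (ℝ × E3))).hasFDerivAt
  have h3 : HasFDerivAt (fun y : Vec => y.2.2) ((ContinuousLinearMap.snd ℝ ℝ E3).comp
        (ContinuousLinearMap.snd ℝ ℝ (ℝ × E3))) (emb p) :=
    ((ContinuousLinearMap.snd ℝ ℝ E3).comp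
        (ContinuousLinearMap.snd ℝ ℝ (ℝ × E3))).hasFDerivAt
  have h4 : HasFDerivAt (lift (ext ζ)) (D (ext ζ) p) (emb p) := DifferentiableAt.hasFDerivAt hζ
  have h5 := h1.prodMk ((h2.mul h4).prodMk h3)
  have hF' : HasFDerivAt (lift F) (D F (stretch ζ p))
      ((emb p).1, (emb p).2.1 * lift (ext ζ) (emb p), (emb p).2.2) := by
    rw [emb_stretch]; exact DifferentiableAt.hasFDerivAt hF
  have h6 := HasFDerivAt.comp (f := fun y : Vec => (y.1, y.2.1 * lift (ext ζ) y, y.2.2))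
    (emb p) hF' h5
  rw [D, lift_stretch, h6.fderiv]
  simp only [ContinuousLinearMap.comp_apply]
  congr 1
  ext1
  · simp
  · ext1
    · rw [← lift_emb (ext ζ) p]
      simp [emb, add_comm, mul_comm]
    · simp

theorem IsCk.stretch {k : ℕ} {ζ : ℝ × S2 → ℝ} {F : Pt → G} {s t : Set Pt} (hζ : IsCk k (ext ζ) s)
    (hF : IsCk k F t) (hst : ∀ p ∈ s, stretch ζ p ∈ t) :
    IsCk k (fun p => F (stretch ζ p)) s := by
  intro p hp
  rw [lift_stretch]
  refine ContDiffAt.comp _ ?_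
    (contDiffAt_fst.prodMk ((contDiffAt_snd.fst.mul (hζ p hp)).prodMk contDiffAt_snd.snd))
  rw [emb_stretch]
  exact hF _ (hst p hp)

theorem D_ext_shift (ζ : ℝ × S2 → ℝ) (τ s t : ℝ) (x : S2) :
    D (ext ζ) (τ, s, x) = D (ext ζ) (τ, t, x) := by
  have h : lift (ext ζ) = fun y => lift (ext ζ) (y + (0, t - s, 0)) := by
    funext y; simp [lift, ext]
  rw [D, h, fderiv_comp_add_right]
  simp [D, emb]

theorem D_defFun {ζ : ℝ × S2 → ℝ} {p : Pt} (h : DiffAt (ext ζ) p) (Y : Vec) :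
    D (defFun ζ) p Y = D (ext ζ) p Y - Y.2.1 := by
  have h2 : HasFDerivAt (fun y : Vec => y.2.1) ((ContinuousLinearMap.fst ℝ ℝ E3).comp
        (ContinuousLinearMap.snd ℝ ℝ (ℝ × E3))) (emb p) :=
    ((ContinuousLinearMap.fst ℝ ℝ E3).comp
        (ContinuousLinearMap.snd ℝ ℝ (ℝ × E3))).hasFDerivAt
  have h4 : HasFDerivAt (lift (ext ζ)) (D (ext ζ) p) (emb p) := DifferentiableAt.hasFDerivAt h
  have h5 : HasFDerivAt (lift (defFun ζ)) _ (emb p) := h4.sub h2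
  rw [D, h5.fderiv]
  simp

theorem IsCk.ext_of_defFun {k : ℕ} {ζ : ℝ × S2 → ℝ} {s : Set Pt} (h : IsCk k (defFun ζ) s) :
    IsCk k (ext ζ) s := by
  intro p hp
  have e : lift (ext ζ) = fun y => lift (defFun ζ) y + y.2.1 := by
    funext y; simp [lift, ext, defFun]
  rw [e]
  exact (h p hp).add contDiffAt_snd.fst

/-- A positive `C¹` graph over `0 < τ ≤ T` that vanishes at `τ = 0`. -/
structure IsConeGraph (T : ℝ) (ζ : ℝ × S2 → ℝ) : Prop where
  time_pos : 0 < T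
  contDiff : IsCk 1 (ext ζ) {p | p.1 ∈ Icc 0 T}
  start : ∀ x : S2, ζ (0, x) = 0
  pos : ∀ y : ℝ × S2, y.1 ∈ Ioc 0 T → 0 < ζ y

variable {T : ℝ} {ζ : ℝ × S2 → ℝ}

theorem isCompact_cyl : IsCompact (cyl T) :=
  isCompact_Icc.prod (isCompact_Icc.prod isCompact_univ)

theorem openCyl_subset_cyl : openCyl T ⊆ cyl T :=
  prod_mono Ioo_subset_Icc_self (prod_mono Ioo_subset_Icc_self Subset.rfl)

theorem subgraph_subset_closedSubgraph : subgraph T ζ ⊆ closedSubgraph T ζ := fun _ hp =>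
  ⟨Ioo_subset_Icc_self hp.1, Ioo_subset_Icc_self hp.2⟩

/-! ### Topology of the region under the graph -/

namespace IsConeGraph

variable (hζ : IsConeGraph T ζ)

include hζ

theorem nonneg {y : ℝ × S2} (hy : y.1 ∈ Icc 0 T) : 0 ≤ ζ y := by
  rcases hy.1.eq_or_lt with h | h
  · have : y = (0, y.2) := by ext1 <;> simp [← h]
    rw [this, hζ.start]
  · exact (hζ.pos y ⟨h, hy.2⟩).le

theorem stretch_mem {p : Pt} (hp : p ∈ cyl T) : stretch ζ p ∈ closedSubgraph T ζ := by
  obtain ⟨h1, h2, -⟩ := hp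
  have h := hζ.nonneg (y := (p.1, p.2.2)) h1
  exact ⟨h1, mul_nonneg h2.1 h, mul_le_of_le_one_left h h2.2⟩

theorem diffAt_ext {p : Pt} (hp : p.1 ∈ Icc 0 T) : DiffAt (ext ζ) p :=
  hζ.contDiff.diffAt one_ne_zero hp

theorem continuousAt_ext {p : Pt} (hp : p.1 ∈ Icc 0 T) : ContinuousAt (ext ζ) p :=
  hζ.contDiff.continuousAt hp

theorem continuousAt_stretch {p : Pt} (hp : p ∈ cyl T) : ContinuousAt (stretch ζ) p :=
  continuousAt_fst.prodMk
    ((continuousAt_snd.fst.mul (hζ.continuousAt_ext hp.1)).prodMk continuousAt_snd.snd)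

theorem continuousOn_stretch : ContinuousOn (stretch ζ) (cyl T) := fun _ hp =>
  (hζ.continuousAt_stretch hp).continuousWithinAt

theorem continuousAt_graph {y : ℝ × S2} (hy : y.1 ∈ Icc 0 T) : ContinuousAt ζ y := by
  have h := (hζ.continuousAt_ext (p := (y.1, 0, y.2)) hy)
  have h' : ContinuousAt (fun y : ℝ × S2 => ((y.1, 0, y.2) : Pt)) y := by fun_prop
  exact ContinuousAt.comp (f := fun y : ℝ × S2 => ((y.1, 0, y.2) : Pt)) h h'

theorem image_cyl : stretch ζ '' cyl T = closedSubgraph T ζ := by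
  refine Subset.antisymm (image_subset_iff.mpr fun p hp => hζ.stretch_mem hp) ?_
  rintro ⟨τ, z, x⟩ ⟨h1, h2⟩
  simp only at h1 h2
  have h := hζ.nonneg (y := (τ, x)) h1
  rcases h.eq_or_lt with h0 | h0
  -- Over a point where ζ vanishes the fibre is the single point z = 0, and s = 0 represents it.
  · rw [← h0] at h2
    have hz : z = 0 := le_antisymm h2.2 h2.1
    exact ⟨(τ, 0, x), ⟨h1, by simp⟩, by simp [stretch, hz]⟩
  · refine ⟨(τ, z / ζ (τ, x), x), ⟨h1, ⟨div_nonneg h2.1 h, div_le_one_of_le₀ h2.2 h⟩, trivial⟩, ?_⟩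
    simp [stretch, ext, h0.ne']

theorem image_openCyl : stretch ζ '' openCyl T ⊆ subgraph T ζ := by
  rintro _ ⟨p, ⟨h1, h2, -⟩, rfl⟩
  have h := hζ.pos (p.1, p.2.2) (Ioo_subset_Ioc_self h1)
  exact ⟨h1, mul_pos h2.1 h, mul_lt_of_lt_one_left h h2.2⟩

theorem isCompact_closedSubgraph : IsCompact (closedSubgraph T ζ) := by
  rw [← hζ.image_cyl]
  exact isCompact_cyl.image_of_continuousOn hζ.continuousOn_stretch

/-- The closed cylinder is the closure of the open one, and `stretch ζ` is continuous on it. This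
also covers the sphere τ = z = 0, where the region degenerates. -/
theorem closedSubgraph_subset_closure : closedSubgraph T ζ ⊆ closure (subgraph T ζ) := by
  have hc : closure (openCyl T) = cyl T := by
    rw [openCyl, closure_prod_eq, closure_prod_eq, closure_Ioo hζ.time_pos.ne, closure_Ioo (by simp),
      closure_univ]
    rfl
  rw [← hζ.image_cyl, ← hc]
  refine (ContinuousOn.image_closure ?_).trans (closure_mono hζ.image_openCyl)
  rw [hc]
  exact hζ.continuousOn_stretch

theorem isOpen_subgraph : IsOpen (subgraph T ζ) := by
  rw [isOpen_iff_mem_nhds]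
  intro p hp
  have hc := hζ.continuousAt_ext (Ioo_subset_Icc_self hp.1)
  have h1 : ∀ᶠ q : Pt in nhds p, q.1 ∈ Ioo 0 T :=
    continuousAt_fst.eventually_mem (isOpen_Ioo.mem_nhds hp.1)
  have h2 : ∀ᶠ q : Pt in nhds p, 0 < q.2.1 :=
    continuousAt_const.eventually_lt continuousAt_snd.fst hp.2.1
  have h3 : ∀ᶠ q : Pt in nhds p, q.2.1 < ext ζ q :=
    ContinuousAt.eventually_lt continuousAt_snd.fst hc hp.2.2
  filter_upwards [h1, h2, h3] with q a b c using ⟨a, b, c⟩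

/-- The bounds on the metric are assumed in the open region only; continuity carries them to the
boundary, where the flux through τ = T is estimated. -/
theorem le_on_closedSubgraph {F : Pt → ℝ} {B : ℝ} (hF : ∀ p ∈ closedSubgraph T ζ, ContinuousAt F p)
    (h : ∀ p ∈ subgraph T ζ, F p ≤ B) {p : Pt} (hp : p ∈ closedSubgraph T ζ) : F p ≤ B := by
  have h2 : ∃ᶠ q in nhds p, q ∈ subgraph T ζ :=
    mem_closure_iff_frequently.mp (hζ.closedSubgraph_subset_closure hp)
  by_contra hlt
  have h3 : ∀ᶠ q in nhds p, B < F q := continuousAt_const.eventually_lt (hF p hp) (not_le.mp hlt)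
  obtain ⟨q, hq, hq'⟩ := (h2.and_eventually h3).exists
  exact absurd (h q hq) (not_le.mpr hq')

end IsConeGraph

/-! Measures and slices -/

instance : IsFiniteMeasureOnCompacts vol3 := by unfold vol3; infer_instance
instance : SFinite vol3 := by unfold vol3; infer_instance
instance : IsFiniteMeasureOnCompacts vol4 := by unfold vol4; infer_instance
instance : SFinite vol4 := by unfold vol4; infer_instance

theorem IsConeGraph.integrableOn_subgraph (hζ : IsConeGraph T ζ) {F : Pt → ℝ}
    (hF : ∀ p ∈ closedSubgraph T ζ, ContinuousAt F p) : IntegrableOn F (subgraph T ζ) vol4 :=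
  (ContinuousOn.integrableOn_compact hζ.isCompact_closedSubgraph
    fun p hp => (hF p hp).continuousWithinAt).mono_set subgraph_subset_closedSubgraph

theorem integrableOn_openCyl {F : Pt → ℝ} (hF : ∀ p ∈ cyl T, ContinuousAt F p) :
    IntegrableOn F (openCyl T) vol4 :=
  (ContinuousOn.integrableOn_compact isCompact_cyl
    fun p hp => (hF p hp).continuousWithinAt).mono_set openCyl_subset_cyl

/-- Rescaling of the variable `z` in the integral over a slice. -/
theorem integral_slice {ρ : S2 → ℝ} (hρ : Continuous ρ) (hpos : ∀ x, 0 < ρ x) {F : ℝ × S2 → ℝ}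
    (hF : ∀ y : ℝ × S2, y.1 ∈ Icc 0 (ρ y.2) → ContinuousAt F y) :
    IntegrableOn F {y | y.1 ∈ Ioo 0 (ρ y.2)} vol3 ∧
    ∫ y in {y : ℝ × S2 | y.1 ∈ Ioo 0 (ρ y.2)}, F y ∂vol3
      = ∫ y in Ioo (0 : ℝ) 1 ×ˢ univ, ρ y.2 * F (y.1 * ρ y.2, y.2) ∂vol3 := by
  have hc : IsCompact {y : ℝ × S2 | y.1 ∈ Icc 0 (ρ y.2)} := by
    have : {y : ℝ × S2 | y.1 ∈ Icc 0 (ρ y.2)}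
        = (fun y : ℝ × S2 => (y.1 * ρ y.2, y.2)) '' (Icc 0 1 ×ˢ univ) := by
      ext ⟨z, x⟩
      have h0 := hpos x
      constructor
      · rintro ⟨h1, h2⟩
        refine ⟨(z / ρ x, x), ⟨⟨div_nonneg h1 h0.le, div_le_one_of_le₀ h2 h0.le⟩, trivial⟩, ?_⟩
        simp [h0.ne']
      · rintro ⟨⟨s, x'⟩, ⟨⟨h1, h2⟩, -⟩, h⟩
        simp only [Prod.mk.injEq] at h
        obtain ⟨rfl, rfl⟩ := h
        exact ⟨mul_nonneg h1 h0.le, mul_le_of_le_one_left h0.le h2⟩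
    rw [this]
    exact (isCompact_Icc.prod isCompact_univ).image (by fun_prop)
  have hm : MeasurableSet {y : ℝ × S2 | y.1 ∈ Ioo 0 (ρ y.2)} := by
    have : IsOpen {y : ℝ × S2 | y.1 ∈ Ioo 0 (ρ y.2)} :=
      (isOpen_lt continuous_const continuous_fst).inter
        (isOpen_lt continuous_fst (hρ.comp continuous_snd))
    exact this.measurableSet
  have hi : IntegrableOn F {y : ℝ × S2 | y.1 ∈ Ioo 0 (ρ y.2)} vol3 :=
    (ContinuousOn.integrableOn_compact hc fun y hy => (hF y hy).continuousWithinAt).mono_set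
      fun y hy => Ioo_subset_Icc_self hy
  refine ⟨hi, ?_⟩
  have hi2 : IntegrableOn (fun y : ℝ × S2 => ρ y.2 * F (y.1 * ρ y.2, y.2)) (Ioo (0 : ℝ) 1 ×ˢ univ)
      vol3 := by
    refine (ContinuousOn.integrableOn_compact (K := Icc (0 : ℝ) 1 ×ˢ univ)
      (isCompact_Icc.prod isCompact_univ) fun y hy => ?_).mono_set
      (prod_mono Ioo_subset_Icc_self Subset.rfl)
    have h1 : ContinuousAt (fun y : ℝ × S2 => (y.1 * ρ y.2, y.2)) y := by fun_prop
    have h2 : ContinuousAt F (y.1 * ρ y.2, y.2) :=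
      hF _ ⟨mul_nonneg hy.1.1 (hpos _).le, mul_le_of_le_one_left (hpos _).le hy.1.2⟩
    exact ((hρ.comp continuous_snd).continuousAt.mul
      (ContinuousAt.comp (f := fun y : ℝ × S2 => (y.1 * ρ y.2, y.2)) h2 h1)).continuousWithinAt
  rw [← integral_indicator hm, ← integral_indicator (measurableSet_Ioo.prod MeasurableSet.univ)]
  rw [← integrable_indicator_iff hm] at hi
  rw [← integrable_indicator_iff (measurableSet_Ioo.prod MeasurableSet.univ)] at hi2
  rw [vol3] at hi hi2 ⊢
  -- With x as the outer variable the claim is a linear substitution in one real variable.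
  rw [integral_prod_symm _ hi, integral_prod_symm _ hi2]
  refine integral_congr_ae (Filter.Eventually.of_forall fun x => ?_)
  have e1 : (fun z : ℝ => indicator {y : ℝ × S2 | y.1 ∈ Ioo 0 (ρ y.2)} F (z, x))
      = indicator (Ioo 0 (ρ x)) fun z => F (z, x) := by
    funext z; simp [indicator]
  have e2 : (fun s : ℝ => indicator (Ioo (0 : ℝ) 1 ×ˢ univ)
        (fun y : ℝ × S2 => ρ y.2 * F (y.1 * ρ y.2, y.2)) (s, x))
      = indicator (Ioo 0 1) fun s => ρ x * F (s * ρ x, x) := by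
    funext z; simp [indicator]
  simp only
  rw [e1, e2, integral_indicator measurableSet_Ioo, integral_indicator measurableSet_Ioo,
    ← integral_Ioc_eq_integral_Ioo, ← integral_Ioc_eq_integral_Ioo,
    ← intervalIntegral.integral_of_le (hpos x).le, ← intervalIntegral.integral_of_le zero_le_one,
    intervalIntegral.integral_const_mul]
  have h := intervalIntegral.mul_integral_comp_mul_right (a := 0) (b := 1)
    (f := fun z => F (z, x)) (c := ρ x)
  rw [zero_mul, one_mul] at h
  exact h.symm

/-- The substitution z = s ζ has Jacobian ζ and is made for each τ separately. The collapsed fibre τ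
= 0 lies outside both open domains. -/
theorem IsConeGraph.integral_subgraph (hζ : IsConeGraph T ζ) {F : Pt → ℝ}
    (hF : ∀ p ∈ closedSubgraph T ζ, ContinuousAt F p) :
    ∫ p in subgraph T ζ, F p ∂vol4 = ∫ p in openCyl T, ext ζ p * F (stretch ζ p) ∂vol4 := by
  have hm : MeasurableSet (subgraph T ζ) := hζ.isOpen_subgraph.measurableSet
  have hi := hζ.integrableOn_subgraph hF
  have hi2 : IntegrableOn (fun p => ext ζ p * F (stretch ζ p)) (openCyl T) vol4 :=
    integrableOn_openCyl fun p hp => (hζ.continuousAt_ext hp.1).mul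
      (ContinuousAt.comp (hF _ (hζ.stretch_mem hp)) (hζ.continuousAt_stretch hp))
  rw [← integral_indicator hm]
  rw [← integrable_indicator_iff hm] at hi
  rw [openCyl, vol4] at hi2 ⊢
  rw [vol4] at hi
  rw [integral_prod _ hi, setIntegral_prod _ hi2, ← integral_indicator measurableSet_Ioo]
  refine integral_congr_ae (Filter.Eventually.of_forall fun τ => ?_)
  simp only
  by_cases hτ : τ ∈ Ioo 0 T
  · rw [indicator_of_mem hτ]
    have hτ' : τ ∈ Icc 0 T := Ioo_subset_Icc_self hτ
    have e : (fun y : ℝ × S2 => indicator (subgraph T ζ) F (τ, y))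
        = indicator {y : ℝ × S2 | y.1 ∈ Ioo 0 (ζ (τ, y.2))} fun y => F (τ, y) := by
      funext y
      have : (τ, y) ∈ subgraph T ζ ↔ y ∈ {y : ℝ × S2 | y.1 ∈ Ioo 0 (ζ (τ, y.2))} :=
        ⟨fun h => h.2, fun h => ⟨hτ, h⟩⟩
      by_cases hy : y ∈ {y : ℝ × S2 | y.1 ∈ Ioo 0 (ζ (τ, y.2))}
      · rw [indicator_of_mem hy, indicator_of_mem (this.mpr hy)]
      · rw [indicator_of_notMem hy, indicator_of_notMem fun h => hy (this.mp h)]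
    have hcont : Continuous fun x : S2 => ζ (τ, x) := continuous_iff_continuousAt.mpr fun x =>
      ContinuousAt.comp (f := fun x : S2 => (τ, x)) (hζ.continuousAt_graph (y := (τ, x)) hτ')
        (by fun_prop)
    have hm' : MeasurableSet {y : ℝ × S2 | y.1 ∈ Ioo 0 (ζ (τ, y.2))} := by
      have : IsOpen {y : ℝ × S2 | y.1 ∈ Ioo 0 (ζ (τ, y.2))} :=
        (isOpen_lt continuous_const continuous_fst).inter
          (isOpen_lt continuous_fst (hcont.comp continuous_snd))
      exact this.measurableSet
    rw [e, integral_indicator hm']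
    exact (integral_slice hcont (fun x => hζ.pos (τ, x) (Ioo_subset_Ioc_self hτ))
      (F := fun y => F (τ, y)) fun y hy =>
        ContinuousAt.comp (f := fun y : ℝ × S2 => ((τ, y) : Pt)) (hF (τ, y) ⟨hτ', hy⟩)
          (by fun_prop)).2
  · rw [indicator_of_notMem hτ]
    have : (fun y : ℝ × S2 => indicator (subgraph T ζ) F (τ, y)) = fun _ => 0 := by
      funext y
      exact indicator_of_notMem (fun h => hτ h.1) _
    rw [this]; simp

/-! ### Derivatives along coordinate lines and the field in stretched coordinates -/

variable {G : Type*} [NormedAddCommGroup G] [NormedSpace ℝ G] {T : ℝ} {ζ : ℝ × S2 → ℝ}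

theorem D_eq_sum {G : Type*} [NormedAddCommGroup G] [NormedSpace ℝ G] (F : Pt → G) (p : Pt)
    (Y : Vec) : D F p Y = Y.1 • Dτ F p + Y.2.1 • Dz F p
      + ∑ i : Fin 3, Y.2.2 i • D F p (0, 0, EuclideanSpace.single i 1) := by
  have e : D F p (0, 0, Y.2.2) = ∑ i : Fin 3, Y.2.2 i • D F p (0, 0, EuclideanSpace.single i 1) := by
    have h := congrArg (fun ξ : E3 => (((D F p).comp ((ContinuousLinearMap.inr ℝ ℝ (ℝ × E3)).comp
      (ContinuousLinearMap.inr ℝ ℝ E3))) ξ)) (E3_eq_sum Y.2.2)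
    simp only [map_sum, map_smul] at h
    exact h
  rw [← e]
  have : Y = Y.1 • ((1, 0, 0) : Vec) + Y.2.1 • ((0, 1, 0) : Vec) + (0, 0, Y.2.2) := by
    ext <;> simp
  conv_lhs => rw [this]
  simp only [map_add, map_smul, Dτ, Dz]

theorem hasDerivAt_time {F : Pt → G} {τ z : ℝ} {x : S2} (h : DiffAt F (τ, z, x)) :
    HasDerivAt (fun t => F (t, z, x)) (Dτ F (τ, z, x)) τ := by
  have h1 : HasFDerivAt (lift F) (D F (τ, z, x)) ((τ, z, (x : E3)) : Vec) :=
    DifferentiableAt.hasFDerivAt h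
  have h2 : HasDerivAt (fun t : ℝ => ((t, z, (x : E3)) : Vec)) (1, 0, 0) τ :=
    (hasDerivAt_id τ).prodMk ((hasDerivAt_const τ z).prodMk (hasDerivAt_const τ (x : E3)))
  have h3 := h1.comp_hasDerivAt τ h2
  have e : lift F ∘ (fun t : ℝ => ((t, z, (x : E3)) : Vec)) = fun t => F (t, z, x) := by
    funext t; simp [lift]
  rwa [e] at h3

theorem hasDerivAt_radial {F : Pt → G} {τ z : ℝ} {x : S2} (h : DiffAt F (τ, z, x)) :
    HasDerivAt (fun t => F (τ, t, x)) (Dz F (τ, z, x)) z := by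
  have h1 : HasFDerivAt (lift F) (D F (τ, z, x)) ((τ, z, (x : E3)) : Vec) :=
    DifferentiableAt.hasFDerivAt h
  have h2 : HasDerivAt (fun t : ℝ => ((τ, t, (x : E3)) : Vec)) (0, 1, 0) z :=
    (hasDerivAt_const z τ).prodMk ((hasDerivAt_id z).prodMk (hasDerivAt_const z (x : E3)))
  have h3 := h1.comp_hasDerivAt z h2
  have e : lift F ∘ (fun t : ℝ => ((τ, t, (x : E3)) : Vec)) = fun t => F (τ, t, x) := by
    funext t; simp [lift]
  rwa [e] at h3

/-- The sphere divergence theorem on the spheres `τ, z = const`. -/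
theorem integral_divS {Y : Pt → E3} {τ z : ℝ} (h : ∀ x : S2, IsCk 1 Y {(τ, z, x)})
    (ht : ∀ x : S2, ⟪Y (τ, z, x), (x : E3)⟫ = 0) : ∫ x, divS Y (τ, z, x) ∂areaS2 = 0 := by
  have hl : ∀ x : S2, HasFDerivAt (fun y : E3 => ((τ, z, y) : Vec))
      ((ContinuousLinearMap.inr ℝ ℝ (ℝ × E3)).comp (ContinuousLinearMap.inr ℝ ℝ E3)) (x : E3) :=
    fun x => ((hasFDerivAt_const τ (x : E3)).prodMk
      ((hasFDerivAt_const z (x : E3)).prodMk (hasFDerivAt_id (x : E3)))).congr_fderiv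
        (ContinuousLinearMap.ext fun _ => rfl)
  rw [← integral_sphere_divergence (fun x => Y (τ, z, x)) ?_ ht]
  · refine integral_congr_ae (Filter.Eventually.of_forall fun x => ?_)
    have h1 : HasFDerivAt (lift Y) (D Y (τ, z, x)) ((τ, z, (x : E3)) : Vec) :=
      DifferentiableAt.hasFDerivAt ((h x).diffAt one_ne_zero rfl)
    have h2 := h1.comp (x : E3) (hl x)
    have h3 : HasFDerivAt (fun y : E3 => Y (τ, z, proj y)) _ (x : E3) := h2
    simp only [divS]
    rw [h3.fderiv]
    simp
  · intro x
    have h1 : ContDiffAt ℝ 1 (lift Y) ((τ, z, (x : E3)) : Vec) := h x _ rfl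
    exact ContDiffAt.comp (x : E3) (f := fun y : E3 => ((τ, z, y) : Vec)) h1
      (contDiffAt_const.prodMk (contDiffAt_const.prodMk contDiffAt_id))

theorem IsCk.continuousAt_Dτ {F : Pt → G} {s : Set Pt} (h : IsCk 1 F s) {p : Pt} (hp : p ∈ s) :
    ContinuousAt (Dτ F) p := (h.continuousAt_D one_ne_zero hp).clm_apply continuousAt_const

theorem IsCk.continuousAt_Dz {F : Pt → G} {s : Set Pt} (h : IsCk 1 F s) {p : Pt} (hp : p ∈ s) :
    ContinuousAt (Dz F) p := (h.continuousAt_D one_ne_zero hp).clm_apply continuousAt_const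

theorem IsCk.continuousAt_divS {F : Pt → E3} {s : Set Pt} (h : IsCk 1 F s) {p : Pt} (hp : p ∈ s) :
    ContinuousAt (divS F) p := by
  unfold divS
  refine tendsto_finsetSum _ fun i _ => ?_
  exact (EuclideanSpace.proj (𝕜 := ℝ) i : E3 →L[ℝ] ℝ).continuous.continuousAt.comp
    ((h.continuousAt_D one_ne_zero hp).clm_apply continuousAt_const)

theorem IsCk.fst {k : ℕ} {M : Pt → Vec} {s : Set Pt} (h : IsCk k M s) :
    IsCk k (fun p => (M p).1) s := fun p hp => (h p hp).fst

theorem IsCk.snd_fst {k : ℕ} {M : Pt → Vec} {s : Set Pt} (h : IsCk k M s) :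
    IsCk k (fun p => (M p).2.1) s := fun p hp => (h p hp).snd.fst

theorem IsCk.snd_snd {k : ℕ} {M : Pt → Vec} {s : Set Pt} (h : IsCk k M s) :
    IsCk k (fun p => (M p).2.2) s := fun p hp => (h p hp).snd.snd

theorem IsCk.continuousAt_Div {M : Pt → Vec} {s : Set Pt} (h : IsCk 1 M s) {p : Pt} (hp : p ∈ s) :
    ContinuousAt (Div M) p :=
  ((h.fst.continuousAt_Dτ hp).add (h.snd_fst.continuousAt_Dz hp)).add
    (h.snd_snd.continuousAt_divS hp)

theorem D_apply_stretch (F : Pt → ℝ) (p : Pt) (a b : ℝ) (ξ : E3) :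
    D F p (a, b, ξ) = a * Dτ F p + b * Dz F p + D F p (0, 0, ξ) := by
  have : ((a, b, ξ) : Vec) = a • ((1, 0, 0) : Vec) + b • ((0, 1, 0) : Vec) + (0, 0, ξ) := by
    ext <;> simp
  rw [this]
  simp only [map_add, map_smul, smul_eq_mul, Dτ, Dz]

namespace IsConeGraph

theorem isCk_stretch (hζ : IsConeGraph T ζ) {F : Pt → G} (hF : IsCk 1 F (closedSubgraph T ζ)) :
    IsCk 1 (fun p => F (stretch ζ p)) (cyl T) :=
  (hζ.contDiff.mono fun _ hp => hp.1).stretch hF fun _ hp => hζ.stretch_mem hp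

variable (hζ : IsConeGraph T ζ) {M : Pt → Vec} (hM : IsCk 1 M (closedSubgraph T ζ))

include hζ hM

/-- The part of the divergence that comes from the time component, in stretched coordinates. -/
theorem Dτ_stretch {p : Pt} (hp : p ∈ cyl T) :
    Dτ (fun p => ext ζ p * (M (stretch ζ p)).1) p
      = Dτ (ext ζ) p * (M (stretch ζ p)).1 + ext ζ p * (Dτ (fun q => (M q).1) (stretch ζ p)
        + p.2.1 * Dτ (ext ζ) p * Dz (fun q => (M q).1) (stretch ζ p)) := by
  have hz := hζ.diffAt_ext hp.1
  have h1 : DiffAt (fun q => (M q).1) (stretch ζ p) :=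
    hM.fst.diffAt one_ne_zero (hζ.stretch_mem hp)
  have h2 : DiffAt (fun p => (M (stretch ζ p)).1) p :=
    (hζ.isCk_stretch hM.fst).diffAt one_ne_zero hp
  rw [Dτ, D_mul hz h2, D_stretch (F := fun q => (M q).1) hz h1, D_apply_stretch]
  simp only [Dτ]
  have : D (fun q => (M q).1) (stretch ζ p) (0, 0, 0) = 0 := map_zero _
  rw [this]
  ring

/-- The part of the divergence that comes from the angular components, in stretched coordinates. -/
theorem divS_stretch {p : Pt} (hp : p ∈ cyl T) :
    divS (fun p => ext ζ p • (M (stretch ζ p)).2.2) p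
      = D (ext ζ) p (0, 0, (M (stretch ζ p)).2.2)
        + ext ζ p * (divS (fun q => (M q).2.2) (stretch ζ p)
          + p.2.1 * D (ext ζ) p (0, 0, Dz (fun q => (M q).2.2) (stretch ζ p))) := by
  have hz := hζ.diffAt_ext hp.1
  have h1 : DiffAt (fun q => (M q).2.2) (stretch ζ p) :=
    hM.snd_snd.diffAt one_ne_zero (hζ.stretch_mem hp)
  have h2 : DiffAt (fun p => (M (stretch ζ p)).2.2) p :=
    (hζ.isCk_stretch hM.snd_snd).diffAt one_ne_zero hp
  rw [divS_smul hz h2]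
  have e : divS (fun p => (M (stretch ζ p)).2.2) p = divS (fun q => (M q).2.2) (stretch ζ p)
      + p.2.1 * D (ext ζ) p (0, 0, Dz (fun q => (M q).2.2) (stretch ζ p)) := by
    rw [D_eq_sum (ext ζ) p (0, 0, _)]
    simp only [divS, zero_smul, zero_add, Finset.mul_sum, ← Finset.sum_add_distrib]
    refine Finset.sum_congr rfl fun i _ => ?_
    rw [D_stretch (F := fun q => (M q).2.2) hz h1]
    have : ((0, 0 * ext ζ p + p.2.1 * D (ext ζ) p (0, 0, EuclideanSpace.single i 1),
        EuclideanSpace.single i 1) : Vec) = (0, 0, EuclideanSpace.single i 1)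
          + (p.2.1 * D (ext ζ) p (0, 0, EuclideanSpace.single i 1)) • ((0, 1, 0) : Vec) := by
      ext1
      · simp
      · ext1 <;> simp
    simp only
    rw [this, map_add, map_smul]
    simp only [Dz, PiLp.add_apply, PiLp.smul_apply, smul_eq_mul]
    ring
  rw [e]
  ring

/-- The part of the divergence that comes from the radial component, in stretched coordinates. -/
theorem hasDerivAt_stretch {τ s : ℝ} {x : S2} (hp : (τ, s, x) ∈ cyl T) :
    HasDerivAt (fun s => -D (defFun ζ) (τ, s, x)
        ((s * (M (stretch ζ (τ, s, x))).1, (M (stretch ζ (τ, s, x))).2.1,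
          s • (M (stretch ζ (τ, s, x))).2.2) : Vec))
      (ext ζ (τ, s, x) * Div M (stretch ζ (τ, s, x))
        - Dτ (fun p => ext ζ p * (M (stretch ζ p)).1) (τ, s, x)
        - divS (fun p => ext ζ p • (M (stretch ζ p)).2.2) (τ, s, x)) s := by
  have hτ : τ ∈ Icc 0 T := hp.1
  have hm := hζ.stretch_mem hp
  have hin : HasDerivAt (fun s => s * ζ (τ, x)) (ζ (τ, x)) s := by
    simpa using (hasDerivAt_id s).mul_const (ζ (τ, x))
  have d : ∀ {G : Type} [NormedAddCommGroup G] [NormedSpace ℝ G] {F : Pt → G},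
      IsCk 1 F (closedSubgraph T ζ) → HasDerivAt (fun s => F (stretch ζ (τ, s, x)))
        (ζ (τ, x) • Dz F (stretch ζ (τ, s, x))) s := fun {G} _ _ {F} hF => by
    have h := hasDerivAt_radial (F := F) (τ := τ) (z := s * ζ (τ, x)) (x := x)
      (hF.diffAt one_ne_zero hm)
    exact HasDerivAt.scomp s h hin
  have d1 := (hasDerivAt_id s).mul (d hM.fst)
  have d2 := d hM.snd_fst
  have d3 := (hasDerivAt_id s).smul (d hM.snd_snd)
  -- As ζ does not depend on z, the function is M^z - s dζ(M^τ, 0, M^S). Together with ζ M^τ and ζ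
  -- M^S it forms the pulled-back field, whose divergence in (τ, s, x) is ζ times the divergence of
  -- M.
  have e : (fun s => -D (defFun ζ) (τ, s, x)
        ((s * (M (stretch ζ (τ, s, x))).1, (M (stretch ζ (τ, s, x))).2.1,
          s • (M (stretch ζ (τ, s, x))).2.2) : Vec))
      = fun s => (M (stretch ζ (τ, s, x))).2.1 - D (ext ζ) (τ, 0, x)
        ((s * (M (stretch ζ (τ, s, x))).1, 0, s • (M (stretch ζ (τ, s, x))).2.2) : Vec) := by
    funext s'
    rw [D_defFun (hζ.diffAt_ext hτ), D_ext_shift ζ τ s' 0 x, D_apply_stretch,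
      D_apply_stretch _ _ (s' * _) 0]
    have : Dz (ext ζ) (τ, 0, x) = 0 := by
      have h := hasDerivAt_radial (hζ.diffAt_ext (p := (τ, 0, x)) hτ)
      exact h.unique (hasDerivAt_const (0 : ℝ) (ζ (τ, x)))
    rw [this]
    ring
  rw [e]
  have d4 : HasDerivAt (fun s => D (ext ζ) (τ, 0, x)
        ((s * (M (stretch ζ (τ, s, x))).1, 0, s • (M (stretch ζ (τ, s, x))).2.2) : Vec)) _ s :=
    (D (ext ζ) (τ, 0, x)).hasFDerivAt.comp_hasDerivAt s
      (d1.prodMk ((hasDerivAt_const s (0 : ℝ)).prodMk d3))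
  refine (d2.sub d4).congr_deriv ?_
  rw [hζ.Dτ_stretch hM hp, hζ.divS_stretch hM hp]
  rw [D_apply_stretch, show D (ext ζ) (τ, s, x) = D (ext ζ) (τ, 0, x) from D_ext_shift ζ τ s 0 x,
    show Dτ (ext ζ) (τ, s, x) = Dτ (ext ζ) (τ, 0, x) by rw [Dτ, D_ext_shift ζ τ s 0 x]; rfl]
  have lin : ∀ (a b : ℝ) (ξ χ : E3), D (ext ζ) (τ, 0, x) (0, 0, a • ξ + b • χ)
      = a * D (ext ζ) (τ, 0, x) (0, 0, ξ) + b * D (ext ζ) (τ, 0, x) (0, 0, χ) := by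
    intro a b ξ χ
    have : ((0, 0, a • ξ + b • χ) : Vec) = a • ((0, 0, ξ) : Vec) + b • ((0, 0, χ) : Vec) := by
      ext <;> simp
    rw [this, map_add, map_smul, map_smul]; rfl
  simp only [id, smul_smul, smul_eq_mul, lin, Div, ext, one_mul]
  ring

end IsConeGraph

variable {T : ℝ} {ζ : ℝ × S2 → ℝ}

theorem integral_Ioo_eq_sub {f f' : ℝ → ℝ} {a b : ℝ} (hab : a ≤ b)
    (h : ∀ t ∈ Icc a b, HasDerivAt f (f' t) t) (hc : ∀ t ∈ Icc a b, ContinuousAt f' t) :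
    ∫ t in Ioo a b, f' t = f b - f a := by
  rw [← integral_Ioc_eq_integral_Ioo, ← intervalIntegral.integral_of_le hab]
  refine intervalIntegral.integral_eq_sub_of_hasDerivAt (fun t ht => h t ?_) ?_
  · rwa [uIcc_of_le hab] at ht
  · refine ContinuousOn.intervalIntegrable fun t ht => (hc t ?_).continuousWithinAt
    rwa [uIcc_of_le hab] at ht

/-! ### The boundary terms of the divergence theorem -/

namespace IsConeGraph

variable (hζ : IsConeGraph T ζ) {M : Pt → Vec} (hM : IsCk 1 M (closedSubgraph T ζ))

include hζ

theorem continuous_time {τ : ℝ} (hτ : τ ∈ Icc 0 T) : Continuous fun x : S2 => ζ (τ, x) :=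
  continuous_iff_continuousAt.mpr fun x =>
    ContinuousAt.comp (f := fun x : S2 => (τ, x)) (hζ.continuousAt_graph (y := (τ, x)) hτ)
      (by fun_prop)

theorem onGraph_mem {y : ℝ × S2} (hy : y.1 ∈ Icc 0 T) : onGraph ζ y ∈ closedSubgraph T ζ :=
  ⟨hy, hζ.nonneg hy, le_rfl⟩

theorem onInfinity_mem {y : ℝ × S2} (hy : y.1 ∈ Icc 0 T) : onInfinity y ∈ closedSubgraph T ζ :=
  ⟨hy, le_rfl, hζ.nonneg hy⟩

theorem integrableOn_onGraph {F : Pt → ℝ} (hF : ∀ p ∈ closedSubgraph T ζ, ContinuousAt F p) :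
    IntegrableOn (fun y => F (onGraph ζ y)) (Ioo 0 T ×ˢ univ) vol3 := by
  refine (ContinuousOn.integrableOn_compact (K := Icc (0 : ℝ) T ×ˢ univ)
    (isCompact_Icc.prod isCompact_univ) fun y hy => ?_).mono_set
    (prod_mono Ioo_subset_Icc_self Subset.rfl)
  refine (ContinuousAt.comp (f := onGraph ζ) (hF _ (hζ.onGraph_mem hy.1)) ?_).continuousWithinAt
  exact continuousAt_fst.prodMk ((hζ.continuousAt_graph hy.1).prodMk continuousAt_snd)

theorem integrableOn_onInfinity {F : Pt → ℝ} (hF : ∀ p ∈ closedSubgraph T ζ, ContinuousAt F p) :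
    IntegrableOn (fun y => F (onInfinity y)) (Ioo 0 T ×ˢ univ) vol3 := by
  refine (ContinuousOn.integrableOn_compact (K := Icc (0 : ℝ) T ×ˢ univ)
    (isCompact_Icc.prod isCompact_univ) fun y hy => ?_).mono_set
    (prod_mono Ioo_subset_Icc_self Subset.rfl)
  refine (ContinuousAt.comp (f := onInfinity) (hF _ (hζ.onInfinity_mem hy.1)) ?_).continuousWithinAt
  exact continuousAt_fst.prodMk (continuousAt_const.prodMk continuousAt_snd)

theorem integrableOn_slice {F : Pt → ℝ} (hF : ∀ p ∈ closedSubgraph T ζ, ContinuousAt F p) :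
    IntegrableOn (fun y => F (T, y)) {y | y.1 ∈ Ioo 0 (ζ (T, y.2))} vol3 ∧
    ∫ y in {y : ℝ × S2 | y.1 ∈ Ioo 0 (ζ (T, y.2))}, F (T, y) ∂vol3
      = ∫ y in Ioo (0 : ℝ) 1 ×ˢ univ, ζ (T, y.2) * F (T, y.1 * ζ (T, y.2), y.2) ∂vol3 :=
  integral_slice (hζ.continuous_time ⟨hζ.time_pos.le, le_rfl⟩)
    (fun x => hζ.pos (T, x) ⟨hζ.time_pos, le_rfl⟩) (F := fun y => F (T, y)) fun y hy =>
      ContinuousAt.comp (f := fun y : ℝ × S2 => ((T, y) : Pt))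
        (hF (T, y) ⟨⟨hζ.time_pos.le, le_rfl⟩, hy⟩) (by fun_prop)

theorem D_defFun_onGraph {τ s : ℝ} {x : S2} (hτ : τ ∈ Icc 0 T) (Y : Vec) :
    D (defFun ζ) (τ, s, x) Y = D (defFun ζ) (onGraph ζ (τ, x)) Y := by
  rw [D_defFun (hζ.diffAt_ext hτ), onGraph, D_defFun (hζ.diffAt_ext hτ),
    D_ext_shift ζ τ s (ζ (τ, x)) x]

include hM

theorem continuousAt_flux {p : Pt} (hp : p ∈ closedSubgraph T ζ) :
    ContinuousAt (fun p => D (defFun ζ) p (M p)) p := by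
  have h : IsCk 1 (defFun ζ) {p | p.1 ∈ Icc 0 T} := by
    intro p hp
    have e : lift (defFun ζ) = fun y => lift (ext ζ) y - y.2.1 := rfl
    rw [e]
    exact (hζ.contDiff p hp).sub contDiffAt_snd.fst
  exact (h.continuousAt_D one_ne_zero (p := p) hp.1).clm_apply (hM.continuousAt hp)

/-- Integrating in τ first leaves the two end points. The one at τ = 0 drops out because ζ vanishes
there, and the factor ζ at τ = T undoes the rescaling of the slice. -/
theorem integral_Dτ_stretch :
    ∫ p in openCyl T, Dτ (fun p => ext ζ p * (M (stretch ζ p)).1) p ∂vol4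
      = ∫ y in {y : ℝ × S2 | y.1 ∈ Ioo 0 (ζ (T, y.2))}, (M (T, y)).1 ∂vol3 := by
  have hA : IsCk 1 (fun p => ext ζ p * (M (stretch ζ p)).1) (cyl T) :=
    (hζ.contDiff.mono fun _ hp => hp.1).mul (hζ.isCk_stretch hM.fst)
  have hi := integrableOn_openCyl (T := T) fun p hp => hA.continuousAt_Dτ hp
  rw [(hζ.integrableOn_slice fun p hp => hM.fst.continuousAt hp).2]
  rw [IntegrableOn, openCyl, vol4, ← Measure.prod_restrict] at hi
  rw [openCyl, vol4, ← Measure.prod_restrict, integral_prod_symm _ hi]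
  refine setIntegral_congr_fun (measurableSet_Ioo.prod MeasurableSet.univ) fun y hy => ?_
  have hm : ∀ t ∈ Icc 0 T, ((t, y) : Pt) ∈ cyl T := fun t ht =>
    ⟨ht, Ioo_subset_Icc_self hy.1, trivial⟩
  rw [integral_Ioo_eq_sub (f := fun t => ext ζ (t, y) * (M (stretch ζ (t, y))).1) hζ.time_pos.le
    (fun t ht => hasDerivAt_time (z := y.1) (x := y.2) (hA.diffAt one_ne_zero (hm t ht)))
    (fun t ht => ContinuousAt.comp (f := fun t : ℝ => ((t, y) : Pt)) (hA.continuousAt_Dτ (hm t ht))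
      (by fun_prop))]
  simp [ext, stretch, hζ.start]

theorem integral_divS_stretch (ht : ∀ p ∈ closedSubgraph T ζ, ⟪(M p).2.2, (p.2.2 : E3)⟫ = 0) :
    ∫ p in openCyl T, divS (fun p => ext ζ p • (M (stretch ζ p)).2.2) p ∂vol4 = 0 := by
  have hA : IsCk 1 (fun p => ext ζ p • (M (stretch ζ p)).2.2) (cyl T) :=
    (hζ.contDiff.mono fun _ hp => hp.1).smul (hζ.isCk_stretch hM.snd_snd)
  have hi := integrableOn_openCyl (T := T) fun p hp => hA.continuousAt_divS hp
  rw [openCyl, vol4] at hi ⊢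
  rw [setIntegral_prod _ hi]
  refine setIntegral_eq_zero_of_forall_eq_zero fun τ hτ => ?_
  have hc : ∀ y ∈ Icc (0 : ℝ) 1 ×ˢ (univ : Set S2),
      ContinuousAt (fun y : ℝ × S2 => divS (fun p => ext ζ p • (M (stretch ζ p)).2.2) (τ, y)) y :=
    fun y hy => ContinuousAt.comp (f := fun y : ℝ × S2 => ((τ, y) : Pt))
      (hA.continuousAt_divS ⟨Ioo_subset_Icc_self hτ, hy⟩) (by fun_prop)
  have hi2 : IntegrableOn (fun y : ℝ × S2 =>
      divS (fun p => ext ζ p • (M (stretch ζ p)).2.2) (τ, y)) (Ioo (0 : ℝ) 1 ×ˢ univ) vol3 :=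
    (ContinuousOn.integrableOn_compact (isCompact_Icc.prod isCompact_univ)
      fun y hy => (hc y hy).continuousWithinAt).mono_set
      (prod_mono Ioo_subset_Icc_self Subset.rfl)
  rw [vol3] at hi2 ⊢
  rw [setIntegral_prod _ hi2]
  refine setIntegral_eq_zero_of_forall_eq_zero fun s hs => ?_
  rw [Measure.restrict_univ]
  have hm : ∀ x, ((τ, s, x) : Pt) ∈ cyl T := fun x =>
    ⟨Ioo_subset_Icc_self hτ, Ioo_subset_Icc_self hs, trivial⟩
  refine integral_divS (fun x => hA.mono (singleton_subset_iff.mpr (hm x))) fun x => ?_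
  rw [real_inner_smul_left]
  have := ht _ (hζ.stretch_mem (hm x))
  simp only [stretch] at this ⊢
  rw [this, mul_zero]

/-- By `hasDerivAt_stretch` the integrand is an s-derivative. The end point s = 1 is the graph and s
= 0 is conformal infinity, where only M^z survives. -/
theorem integral_radial_stretch :
    ∫ p in openCyl T, (ext ζ p * Div M (stretch ζ p)
        - Dτ (fun p => ext ζ p * (M (stretch ζ p)).1) p
        - divS (fun p => ext ζ p • (M (stretch ζ p)).2.2) p) ∂vol4
      = -(∫ y in Ioo 0 T ×ˢ univ, D (defFun ζ) (onGraph ζ y) (M (onGraph ζ y)) ∂vol3)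
        - ∫ y in Ioo 0 T ×ˢ univ, (M (onInfinity y)).2.1 ∂vol3 := by
  have hζ' : IsCk 1 (ext ζ) (cyl T) := hζ.contDiff.mono fun _ hp => hp.1
  have hA : IsCk 1 (fun p => ext ζ p * (M (stretch ζ p)).1) (cyl T) :=
    hζ'.mul (hζ.isCk_stretch hM.fst)
  have hB : IsCk 1 (fun p => ext ζ p • (M (stretch ζ p)).2.2) (cyl T) :=
    hζ'.smul (hζ.isCk_stretch hM.snd_snd)
  have hc : ∀ p ∈ cyl T, ContinuousAt (fun p => ext ζ p * Div M (stretch ζ p)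
        - Dτ (fun p => ext ζ p * (M (stretch ζ p)).1) p
        - divS (fun p => ext ζ p • (M (stretch ζ p)).2.2) p) p := fun p hp =>
    (((hζ'.continuousAt hp).mul (ContinuousAt.comp (f := stretch ζ)
      (hM.continuousAt_Div (hζ.stretch_mem hp)) (hζ.continuousAt_stretch hp))).sub
      (hA.continuousAt_Dτ hp)).sub (hB.continuousAt_divS hp)
  have hi := integrableOn_openCyl hc
  have hG := hζ.integrableOn_onGraph (F := fun p => -D (defFun ζ) p (M p))
    fun p hp => (hζ.continuousAt_flux hM hp).neg
  have hI := hζ.integrableOn_onInfinity (F := fun p => (M p).2.1)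
    fun p hp => hM.snd_fst.continuousAt hp
  rw [← integral_neg, ← integral_sub hG hI]
  have hGI := hG.sub hI
  rw [openCyl, vol4] at hi ⊢
  rw [setIntegral_prod _ hi]
  rw [IntegrableOn, vol3, ← Measure.prod_restrict] at hi
  have hGI' : IntegrableOn (fun y => -D (defFun ζ) (onGraph ζ y) (M (onGraph ζ y))
    - (M (onInfinity y)).2.1) (Ioo 0 T ×ˢ univ) (volume.prod areaS2) := hGI
  conv_rhs => rw [vol3, setIntegral_prod _ hGI']
  refine setIntegral_congr_fun measurableSet_Ioo fun τ hτ => ?_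
  have hτ' := Ioo_subset_Icc_self hτ
  have hi2 : IntegrableOn (fun y : ℝ × S2 => ext ζ (τ, y) * Div M (stretch ζ (τ, y))
        - Dτ (fun p => ext ζ p * (M (stretch ζ p)).1) (τ, y)
        - divS (fun p => ext ζ p • (M (stretch ζ p)).2.2) (τ, y)) (Ioo (0 : ℝ) 1 ×ˢ univ) vol3 :=
    (ContinuousOn.integrableOn_compact (isCompact_Icc.prod isCompact_univ)
      fun y hy => (ContinuousAt.comp (f := fun y : ℝ × S2 => ((τ, y) : Pt)) (hc (τ, y) ⟨hτ', hy⟩)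
        (by fun_prop)).continuousWithinAt).mono_set
      (prod_mono Ioo_subset_Icc_self Subset.rfl)
  rw [IntegrableOn, vol3, ← Measure.prod_restrict] at hi2
  rw [vol3, ← Measure.prod_restrict, integral_prod_symm _ hi2]
  refine integral_congr_ae (Filter.Eventually.of_forall fun x => ?_)
  simp only
  have hm : ∀ s ∈ Icc (0 : ℝ) 1, ((τ, s, x) : Pt) ∈ cyl T := fun s hs => ⟨hτ', hs, trivial⟩
  rw [integral_Ioo_eq_sub zero_le_one (fun s hs => hζ.hasDerivAt_stretch hM (hm s hs))
    (fun s hs => ContinuousAt.comp (f := fun s : ℝ => ((τ, s, x) : Pt)) (hc _ (hm s hs))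
      (by fun_prop))]
  rw [hζ.D_defFun_onGraph hτ', D_defFun (hζ.diffAt_ext hτ') (p := (τ, 0, x))]
  have e1 : stretch ζ (τ, 1, x) = onGraph ζ (τ, x) := by simp [stretch, onGraph, ext]
  have e0 : stretch ζ (τ, 0, x) = onInfinity (τ, x) := by simp [stretch, onInfinity]
  rw [e1, e0]
  have : ((0 * (M (onInfinity (τ, x))).1, (M (onInfinity (τ, x))).2.1,
      (0 : ℝ) • (M (onInfinity (τ, x))).2.2) : Vec) = (0, (M (onInfinity (τ, x))).2.1, 0) := by
    simp
  rw [this, D_apply_stretch (ext ζ)]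
  have hz : Dz (ext ζ) (τ, 0, x) = 0 :=
    (hasDerivAt_radial (hζ.diffAt_ext (p := (τ, 0, x)) hτ')).unique
      (hasDerivAt_const (0 : ℝ) (ζ (τ, x)))
  have h0 : D (ext ζ) (τ, 0, x) (0, 0, 0) = 0 := map_zero _
  rw [hz, h0]
  simp

/-- The divergence theorem on `0 < τ < T`, `0 < z < ζ(τ, x)`. -/
theorem integral_Div (ht : ∀ p ∈ closedSubgraph T ζ, ⟪(M p).2.2, (p.2.2 : E3)⟫ = 0) :
    ∫ p in subgraph T ζ, Div M p ∂vol4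
      = (∫ y in {y : ℝ × S2 | y.1 ∈ Ioo 0 (ζ (T, y.2))}, (M (T, y)).1 ∂vol3)
        - (∫ y in Ioo 0 T ×ˢ univ, D (defFun ζ) (onGraph ζ y) (M (onGraph ζ y)) ∂vol3)
        - ∫ y in Ioo 0 T ×ˢ univ, (M (onInfinity y)).2.1 ∂vol3 := by
  have hζ' : IsCk 1 (ext ζ) (cyl T) := hζ.contDiff.mono fun _ hp => hp.1
  have hA : IsCk 1 (fun p => ext ζ p * (M (stretch ζ p)).1) (cyl T) :=
    hζ'.mul (hζ.isCk_stretch hM.fst)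
  have hB : IsCk 1 (fun p => ext ζ p • (M (stretch ζ p)).2.2) (cyl T) :=
    hζ'.smul (hζ.isCk_stretch hM.snd_snd)
  have i1 := integrableOn_openCyl (T := T) fun p hp => hA.continuousAt_Dτ hp
  have i2 := integrableOn_openCyl (T := T) fun p hp => hB.continuousAt_divS hp
  have i3 := integrableOn_openCyl (T := T) (F := fun p => ext ζ p * Div M (stretch ζ p))
    fun p hp => (hζ'.continuousAt hp).mul (ContinuousAt.comp (f := stretch ζ)
      (hM.continuousAt_Div (hζ.stretch_mem hp)) (hζ.continuousAt_stretch hp))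
  rw [hζ.integral_subgraph fun p hp => hM.continuousAt_Div hp]
  have h1 := hζ.integral_radial_stretch hM
  have i31 : IntegrableOn (fun p => ext ζ p * Div M (stretch ζ p)
    - Dτ (fun p => ext ζ p * (M (stretch ζ p)).1) p) (openCyl T) vol4 := i3.sub i1
  rw [integral_sub i31 i2, integral_sub i3 i1, hζ.integral_Dτ_stretch hM,
    hζ.integral_divS_stretch hM ht] at h1
  linarith

end IsConeGraph

end RegionDivergence

end AdSWave

namespace AdSWave

/-! ### Second derivatives -/

section SecondDerivatives

/-- The angular part of a covector, as a vector of `ℝ³`. -/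
def angular : (Vec →L[ℝ] ℝ) →L[ℝ] E3 :=
  ∑ i : Fin 3, (ContinuousLinearMap.apply ℝ ℝ
    ((0, 0, EuclideanSpace.single i 1) : Vec)).smulRight (EuclideanSpace.single i (1 : ℝ))

theorem inner_angular (A : Vec →L[ℝ] ℝ) (ξ : E3) : ⟪angular A, ξ⟫ = A (0, 0, ξ) := by
  have h := congrArg (fun ξ : E3 => ((A.comp ((ContinuousLinearMap.inr ℝ ℝ (ℝ × E3)).comp
    (ContinuousLinearMap.inr ℝ ℝ E3))) ξ)) (E3_eq_sum ξ)
  simp only [map_sum, map_smul] at h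
  refine Eq.trans ?_ h.symm
  simp [angular, Fin.sum_univ_three, inner_add_left, real_inner_smul_left,
    EuclideanSpace.inner_single_left]
  ring

theorem gradS_eq (v : Pt → ℝ) (p : Pt) : gradS v p = angular (D v p) := by
  refine ext_inner_right ℝ fun ξ => ?_
  rw [inner_angular]
  simp [gradS]

theorem covector_apply (A : Vec →L[ℝ] ℝ) (Y : Vec) :
    A Y = Y.1 * A (1, 0, 0) + Y.2.1 * A (0, 1, 0) + ⟪angular A, Y.2.2⟫ := by
  have e : Y = Y.1 • ((1, 0, 0) : Vec) + Y.2.1 • ((0, 1, 0) : Vec) + (0, 0, Y.2.2) := by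
    ext <;> simp
  rw [inner_angular]
  conv_lhs => rw [e]
  simp only [map_add, map_smul, smul_eq_mul]

variable {k : ℕ} {v : Pt → ℝ} {s : Set Pt}

theorem IsCk.Dτ (h : IsCk (k + 1) v s) : IsCk k (Dτ v) s :=
  h.D.clm_comp (ContinuousLinearMap.apply ℝ ℝ ((1, 0, 0) : Vec))

theorem IsCk.Dz (h : IsCk (k + 1) v s) : IsCk k (Dz v) s :=
  h.D.clm_comp (ContinuousLinearMap.apply ℝ ℝ ((0, 1, 0) : Vec))

theorem IsCk.gradS (h : IsCk (k + 1) v s) : IsCk k (gradS v) s := by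
  have : AdSWave.gradS v = fun p => angular (AdSWave.D v p) := funext (gradS_eq v)
  rw [this]
  exact h.D.clm_comp angular

theorem D_Dτ {p : Pt} (h : DiffAt (D v) p) (Y : Vec) : D (Dτ v) p Y = D (D v) p Y (1, 0, 0) :=
  D_clm_comp h (ContinuousLinearMap.apply ℝ ℝ ((1, 0, 0) : Vec)) Y

theorem D_Dz {p : Pt} (h : DiffAt (D v) p) (Y : Vec) : D (Dz v) p Y = D (D v) p Y (0, 1, 0) :=
  D_clm_comp h (ContinuousLinearMap.apply ℝ ℝ ((0, 1, 0) : Vec)) Y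

theorem D_gradS {p : Pt} (h : DiffAt (D v) p) (Y : Vec) :
    D (gradS v) p Y = angular (D (D v) p Y) := by
  have : gradS v = fun p => angular (D v p) := funext (gradS_eq v)
  rw [this]
  exact D_clm_comp h angular Y

theorem DiffAt.hasFDerivAt {G : Type*} [NormedAddCommGroup G] [NormedSpace ℝ G] {F : Pt → G}
    {p : Pt} (h : DiffAt F p) : HasFDerivAt (lift F) (D F p) (emb p) :=
  DifferentiableAt.hasFDerivAt h

end SecondDerivatives

/-! ### The inverse metric on the spheres -/

namespace ConformalMetric

variable {Λ R T : ℝ} (g : ConformalMetric Λ R T)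

theorem isUnit_h {p : Pt} (hp : p ∈ closedSlab R T) : IsUnit (g.h p) := by
  have hk : LinearMap.ker (g.h p : E3 →ₗ[ℝ] E3) = ⊥ := by
    rw [LinearMap.ker_eq_bot']
    intro ξ hξ
    by_contra hne
    have h1 := g.h_pos p hp ξ hne
    have h2 : g.h p ξ = 0 := hξ
    simp [h2] at h1
  exact (ContinuousLinearMap.isUnit_iff_bijective).mpr
    ⟨LinearMap.ker_eq_bot.mp hk, LinearMap.injective_iff_surjective.mp (LinearMap.ker_eq_bot.mp hk)⟩

theorem isCk_angInv : IsCk 1 g.angInv (closedSlab R T) := by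
  refine IsCk.smul (IsCk.exp (IsCk.const (2 : ℝ) |>.mul g.η_C1)) fun p hp => ?_
  have e : lift (fun p => Ring.inverse (g.h p)) = Ring.inverse ∘ lift g.h := rfl
  rw [e]
  refine ContDiffAt.comp _ ?_ (g.h_C1 p hp)
  obtain ⟨u, hu⟩ := g.isUnit_h hp
  rw [lift_emb, ← hu]
  exact contDiffAt_ringInverse ℝ u

theorem angInv_symm {p : Pt} (hp : p ∈ closedSlab R T) (ξ χ : E3) :
    ⟪g.angInv p ξ, χ⟫ = ⟪ξ, g.angInv p χ⟫ := by
  conv_lhs => rw [← g.mul_angInv hp χ]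
  conv_rhs => rw [← g.mul_angInv hp ξ]
  rw [real_inner_smul_right, real_inner_smul_left, g.h_symm p hp]

/-- The operator h fixes the unit normal, so g^{AB} carries e^{2η} as its normal eigenvalue. All
later control of η comes from here. -/
theorem angInv_normal {p : Pt} (hp : p ∈ closedSlab R T) :
    g.angInv p (p.2.2 : E3) = Real.exp (2 * g.η p) • (p.2.2 : E3) := by
  have h := congrArg (fun A : E3 →L[ℝ] E3 => A (p.2.2 : E3))
    (Ring.inverse_mul_cancel _ (g.isUnit_h hp))
  change Ring.inverse (g.h p) (g.h p (p.2.2 : E3)) = (p.2.2 : E3) at h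
  rw [g.h_normal p hp] at h
  have h3 : g.angInv p (p.2.2 : E3) = Real.exp (2 * g.η p) • Ring.inverse (g.h p) (p.2.2 : E3) := rfl
  rw [h3, h]

theorem angInv_tangent {p : Pt} (hp : p ∈ closedSlab R T) {ξ : E3} (hξ : ⟪ξ, (p.2.2 : E3)⟫ = 0) :
    ⟪g.angInv p ξ, (p.2.2 : E3)⟫ = 0 := by
  rw [g.angInv_symm hp, g.angInv_normal hp, real_inner_smul_right, hξ, mul_zero]

theorem angInv_nonneg {p : Pt} (hp : p ∈ closedSlab R T) (ξ : E3) : 0 ≤ ⟪g.angInv p ξ, ξ⟫ := by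
  conv_rhs => rw [← g.mul_angInv hp ξ]
  rw [real_inner_smul_right, g.mul_angInv hp]
  refine mul_nonneg (Real.exp_pos _).le ?_
  rw [real_inner_comm]
  by_cases h : g.angInv p ξ = 0
  · simp [h]
  · exact (g.h_pos p hp _ h).le

theorem angInv_cauchy {p : Pt} (hp : p ∈ closedSlab R T) (ξ χ : E3) :
    ⟪g.angInv p ξ, χ⟫ ^ 2 ≤ ⟪g.angInv p ξ, ξ⟫ * ⟪g.angInv p χ, χ⟫ := by
  have h : ∀ t : ℝ, 0 ≤ ⟪g.angInv p χ, χ⟫ * (t * t) + 2 * ⟪g.angInv p ξ, χ⟫ * t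
      + ⟪g.angInv p ξ, ξ⟫ := fun t => by
    have h1 := g.angInv_nonneg hp (ξ + t • χ)
    have h2 : ⟪g.angInv p χ, ξ⟫ = ⟪g.angInv p ξ, χ⟫ := by
      rw [g.angInv_symm hp, real_inner_comm]
    simp only [map_add, map_smul, inner_add_left, inner_add_right, real_inner_smul_left,
      real_inner_smul_right, h2] at h1
    linarith
  have := discrim_le_zero h
  rw [discrim] at this
  linarith

/-! ### The energy current -/

/-- The multiplier `b N₁ + N₂`. -/
def mult (b : ℝ) (p : Pt) : Vec := (-1, b - g.W p / 2, -g.U p)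

/-- `g^{ij} ∂_i v ∂_j v`. -/
def gradSq (v : Pt → ℝ) (p : Pt) : ℝ := D v p (g.grad v p)

/-- The density `e^{-2η} ((Xv) ∇v - ½ |∇v|² X - v² X)` of the energy current of the multiplier
`X = b N₁ + N₂`. -/
def current (b : ℝ) (v : Pt → ℝ) (p : Pt) : Vec :=
  D v p (g.mult b p) • Real.exp (-2 * g.η p) • g.grad v p
    - (g.gradSq v p / 2 + v p ^ 2) • Real.exp (-2 * g.η p) • g.mult b p

theorem gradSq_eq (v : Pt → ℝ) (p : Pt) : g.gradSq v p = 2 * (Dz v p * Dτ v p)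
    + g.W p * (Dz v p * Dz v p) + 2 * (Dz v p * ⟪g.U p, gradS v p⟫)
    + ⟪g.angInv p (gradS v p), gradS v p⟫ := by
  rw [gradSq, D_apply, grad]
  simp only [inner_add_right, real_inner_smul_right]
  rw [real_inner_comm (g.U p), real_inner_comm (g.angInv p (gradS v p))]
  ring

theorem D_mult (b : ℝ) (v : Pt → ℝ) (p : Pt) : D v p (g.mult b p)
    = -Dτ v p + (b - g.W p / 2) * Dz v p - ⟪g.U p, gradS v p⟫ := by
  rw [D_apply, mult]
  simp only [inner_neg_right]
  rw [real_inner_comm]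
  ring

theorem D_N2 (v : Pt → ℝ) (p : Pt) : D v p (g.N2 p)
    = -(Dτ v p + g.W p / 2 * Dz v p + ⟪g.U p, gradS v p⟫) := by
  rw [D_apply, N2]
  simp only [Prod.fst_neg, Prod.snd_neg, inner_neg_right]
  rw [real_inner_comm]
  ring

/-- The derivative ∂_τ v is absent because dτ is null: this flux sees only the derivatives tangent
to the slice. -/
theorem current_time (b : ℝ) (v : Pt → ℝ) (p : Pt) : (g.current b v p).1
    = Real.exp (-2 * g.η p) * (b * Dz v p ^ 2 + ⟪g.angInv p (gradS v p), gradS v p⟫ / 2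
      + v p ^ 2) := by
  simp only [current, D_mult, gradSq_eq]
  simp only [mult, grad, Prod.fst_sub, Prod.smul_fst, smul_eq_mul]
  ring

/-- Expressing ∂_τ v through N₂ v removes the mixed terms and makes the form diagonal. The sign of b
- W/2 can then be read off at infinity. -/
theorem current_radial (b : ℝ) (v : Pt → ℝ) (p : Pt) : (g.current b v p).2.1
    = Real.exp (-2 * g.η p) * (b * g.W p / 2 * Dz v p ^ 2 - D v p (g.N2 p) ^ 2
      - (b - g.W p / 2) * (⟪g.angInv p (gradS v p), gradS v p⟫ / 2 + v p ^ 2)) := by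
  simp only [current, D_mult, D_N2, gradSq_eq]
  simp only [mult, grad, Prod.snd_sub, Prod.fst_sub, Prod.smul_snd, Prod.smul_fst, smul_eq_mul]
  ring

theorem current_tangent {p : Pt} (hp : p ∈ closedSlab R T) (b : ℝ) (v : Pt → ℝ) :
    ⟪(g.current b v p).2.2, (p.2.2 : E3)⟫ = 0 := by
  have h1 := g.U_tangent p hp
  have h2 := g.angInv_tangent hp (gradS_tangent v p)
  simp only [current, mult, grad, Prod.snd_sub, Prod.smul_snd, inner_sub_left,
    real_inner_smul_left, inner_add_left, inner_neg_left, h1, h2]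
  ring

/-- On a null graph the flux of the energy current is the energy density. -/
theorem flux_eq_energyDensity {p : Pt} (hp : p ∈ closedSlab R T) {ζ : ℝ × S2 → ℝ}
    (hz : Dz (defFun ζ) p = -1)
    (hnull : g.metric p (g.grad (defFun ζ) p) (g.grad (defFun ζ) p) = 0) (b : ℝ) (v : Pt → ℝ) :
    D (defFun ζ) p (g.current b v p) = Real.exp (-2 * g.η p) * g.energyDensity ζ v b 1 p := by
  rw [g.metric_grad hp] at hnull
  have hn := g.gradSq_eq (defFun ζ) p
  rw [gradSq, hnull, hz] at hn
  have e : D (defFun ζ) p (g.current b v p) = Real.exp (-2 * g.η p) *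
      (D v p (g.mult b p) * D (defFun ζ) p (g.grad v p)
        - (g.gradSq v p / 2 + v p ^ 2) * D (defFun ζ) p (g.mult b p)) := by
    simp only [current, map_sub, map_smul, smul_eq_mul]
    ring
  rw [e]
  have hg : D (defFun ζ) p (g.grad v p) = Dz v p * Dτ (defFun ζ) p
      - (Dτ v p + g.W p * Dz v p + ⟪g.U p, gradS v p⟫) + Dz v p * ⟪g.U p, gradS (defFun ζ) p⟫
      + ⟪g.angInv p (gradS (defFun ζ) p), gradS v p⟫ := by
    rw [D_apply, grad, hz]
    simp only [inner_add_right, real_inner_smul_right]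
    rw [real_inner_comm (g.U p), ← g.angInv_symm hp]
    ring
  have hsn : ⟪g.angInv p (gradS v p), gradS (defFun ζ) p⟫
      = ⟪g.angInv p (gradS (defFun ζ) p), gradS v p⟫ := by
    rw [g.angInv_symm hp, real_inner_comm]
  simp only [energyDensity]
  rw [g.metric_grad hp, hg, D_mult, D_mult, D_N2, D_N2, hz, gradSq_eq]
  simp only [map_add, map_smul, inner_add_left, inner_add_right, real_inner_smul_left,
    real_inner_smul_right, hsn]
  -- The null condition is the eikonal equation for ζ, solved here for ∂_τ ζ. With this value the
  -- flux is made of derivatives tangent to the cone.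
  have ht : Dτ (defFun ζ) p = g.W p / 2 - ⟪g.U p, gradS (defFun ζ) p⟫
      + ⟪g.angInv p (gradS (defFun ζ) p), gradS (defFun ζ) p⟫ / 2 := by linarith
  rw [ht]
  ring

/-- Nullity gives l₁ = ½ g^{AB} ∂_A ζ ∂_B ζ ≥ 0, and Cauchy–Schwarz handles the cross term. So the
density has the form b P + Q with P, Q ≥ 0, which is at most (b + 1)(P + Q). -/
theorem energyDensity_nonneg_le {p : Pt} (hp : p ∈ closedSlab R T) {ζ : ℝ × S2 → ℝ}
    (hz : Dz (defFun ζ) p = -1)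
    (hnull : g.metric p (g.grad (defFun ζ) p) (g.grad (defFun ζ) p) = 0) {b : ℝ} (hb : 0 ≤ b)
    (v : Pt → ℝ) :
    0 ≤ g.energyDensity ζ v 1 1 p ∧
      g.energyDensity ζ v b 1 p ≤ (b + 1) * g.energyDensity ζ v 1 1 p := by
  rw [g.metric_grad hp] at hnull
  have hn := g.gradSq_eq (defFun ζ) p
  rw [gradSq, hnull, hz] at hn
  have hl : -g.metric p (g.grad (defFun ζ) p) (g.N2 p)
      = ⟪g.angInv p (gradS (defFun ζ) p), gradS (defFun ζ) p⟫ / 2 := by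
    rw [g.metric_grad hp, D_N2, hz]; linarith
  simp only [energyDensity]
  rw [hl]
  have h1 := g.angInv_nonneg hp (gradS v p + Dz v p • gradS (defFun ζ) p)
  have h2 := sq_nonneg (D v p (g.N2 p) + ⟪g.angInv p (gradS (defFun ζ) p), gradS v p⟫ / 2)
  have h3 := g.angInv_cauchy hp (gradS (defFun ζ) p) (gradS v p)
  have h4 := g.angInv_nonneg hp (gradS (defFun ζ) p)
  have h5 := mul_nonneg h4 (sq_nonneg (v p))
  have h6 := sq_nonneg (v p)
  set A := ⟪g.angInv p (gradS v p + Dz v p • gradS (defFun ζ) p),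
    gradS v p + Dz v p • gradS (defFun ζ) p⟫
  set B := (D v p (g.N2 p) + ⟪g.angInv p (gradS (defFun ζ) p), gradS v p⟫ / 2) ^ 2
  set σ := ⟪g.angInv p (gradS (defFun ζ) p), gradS (defFun ζ) p⟫
  set C := σ * ⟪g.angInv p (gradS v p), gradS v p⟫
    - ⟪g.angInv p (gradS (defFun ζ) p), gradS v p⟫ ^ 2 with hC
  have h3' : 0 ≤ C := by rw [hC]; linarith
  have k1 := mul_nonneg hb h2
  have k2 := mul_nonneg hb h3'
  have k3 := mul_nonneg hb h5
  constructor
  · nlinarith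
  · nlinarith

/-! ### Regularity and divergence of the current -/

variable {v : Pt → ℝ} {s : Set Pt}

theorem isCk_grad (hs : s ⊆ closedSlab R T) (hv : IsCk 2 v s) : IsCk 1 (g.grad v) s := by
  have hz : IsCk 1 (Dz v) s := IsCk.Dz hv
  have ht : IsCk 1 (Dτ v) s := IsCk.Dτ hv
  have hn : IsCk 1 (gradS v) s := IsCk.gradS hv
  have hW := g.W_C1.mono hs
  have hU := g.U_C1.mono hs
  exact hz.prodMk (((ht.add (hW.mul hz)).add (hU.inner hn)).prodMk
    ((hz.smul hU).add ((g.isCk_angInv.mono hs).clm_apply hn)))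

theorem isCk_mult (hs : s ⊆ closedSlab R T) (b : ℝ) : IsCk 1 (g.mult b) s := by
  have hW := g.W_C1.mono hs
  have hU := g.U_C1.mono hs
  have h : IsCk 1 (fun p => ((-1, b - (2⁻¹ : ℝ) * g.W p, (-1 : ℝ) • g.U p) : Vec)) s :=
    (IsCk.const (-1 : ℝ)).prodMk (((IsCk.const b).sub ((IsCk.const (2⁻¹ : ℝ)).mul hW)).prodMk
      ((IsCk.const (-1 : ℝ)).smul hU))
  have e : g.mult b = fun p => ((-1, b - (2⁻¹ : ℝ) * g.W p, (-1 : ℝ) • g.U p) : Vec) := by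
    funext p
    simp [mult, div_eq_inv_mul]
  rw [e]; exact h

theorem isCk_density (hs : s ⊆ closedSlab R T) : IsCk 1 (fun p => Real.exp (-2 * g.η p)) s :=
  IsCk.exp ((IsCk.const (-2 : ℝ)).mul (g.η_C1.mono hs))

theorem isCk_gradSq (hs : s ⊆ closedSlab R T) (hv : IsCk 2 v s) : IsCk 1 (g.gradSq v) s :=
  (IsCk.D hv : IsCk 1 (D v) s).clm_apply (g.isCk_grad hs hv)

theorem isCk_mult_apply (hs : s ⊆ closedSlab R T) (hv : IsCk 2 v s) (b : ℝ) :
    IsCk 1 (fun p => D v p (g.mult b p)) s :=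
  (IsCk.D hv : IsCk 1 (D v) s).clm_apply (g.isCk_mult hs b)

theorem isCk_current (hs : s ⊆ closedSlab R T) (hv : IsCk 2 v s) (b : ℝ) :
    IsCk 1 (g.current b v) s := by
  have h1 : IsCk 1 v s := hv.of_le (by norm_num)
  have h2 : IsCk 1 (fun p => g.gradSq v p / 2 + v p ^ 2) s := by
    have := ((IsCk.const (2⁻¹ : ℝ)).mul (g.isCk_gradSq hs hv)).add (h1.mul h1)
    have e : (fun p => g.gradSq v p / 2 + v p ^ 2)
        = fun p => 2⁻¹ * g.gradSq v p + v p * v p := by funext p; ring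
    rw [e]; exact this
  exact ((g.isCk_mult_apply hs hv b).smul ((g.isCk_density hs).smul (g.isCk_grad hs hv))).sub
    (h2.smul ((g.isCk_density hs).smul (g.isCk_mult hs b)))

theorem box_eq (v : Pt → ℝ) (p : Pt) : g.box v p
    = Real.exp (2 * g.η p) * Div (fun p => Real.exp (-2 * g.η p) • g.grad v p) p := rfl

theorem density_mul_box (v : Pt → ℝ) (p : Pt) : Real.exp (-2 * g.η p) * g.box v p
    = Div (fun p => Real.exp (-2 * g.η p) • g.grad v p) p := by
  rw [box_eq, ← mul_assoc, ← Real.exp_add]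
  simp

theorem grad_tangent {p : Pt} (hp : p ∈ closedSlab R T) (v : Pt → ℝ) :
    ⟪(p.2.2 : E3), (g.grad v p).2.2⟫ = 0 := by
  rw [real_inner_comm]
  simp only [grad, inner_add_left, real_inner_smul_left, g.U_tangent p hp,
    g.angInv_tangent hp (gradS_tangent v p)]
  ring

theorem mult_tangent {p : Pt} (hp : p ∈ closedSlab R T) (b : ℝ) :
    ⟪(p.2.2 : E3), (g.mult b p).2.2⟫ = 0 := by
  rw [real_inner_comm]
  simp [mult, g.U_tangent p hp]

/-- The derivative of `Xv`. -/
theorem D_mult_apply {p : Pt} (hp : p ∈ closedSlab R T) (hv : IsCk 2 v {p}) (b : ℝ) (Y : Vec) :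
    D (fun p => D v p (g.mult b p)) p Y = D (D v) p Y (g.mult b p)
      - (D g.W p Y / 2 * Dz v p + ⟪D g.U p Y, gradS v p⟫) := by
  have hs : ({p} : Set Pt) ⊆ closedSlab R T := singleton_subset_iff.mpr hp
  have hD : DiffAt (D v) p := (IsCk.D hv : IsCk 1 (D v) {p}).diffAt one_ne_zero rfl
  have hz : HasFDerivAt (lift (Dz v)) (D (Dz v) p) (emb p) :=
    DiffAt.hasFDerivAt ((IsCk.Dz hv : IsCk 1 (Dz v) {p}).diffAt one_ne_zero rfl)
  have ht : HasFDerivAt (lift (Dτ v)) (D (Dτ v) p) (emb p) :=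
    DiffAt.hasFDerivAt ((IsCk.Dτ hv : IsCk 1 (Dτ v) {p}).diffAt one_ne_zero rfl)
  have hn : HasFDerivAt (lift (gradS v)) (D (gradS v) p) (emb p) :=
    DiffAt.hasFDerivAt ((IsCk.gradS hv : IsCk 1 (gradS v) {p}).diffAt one_ne_zero rfl)
  have hW := DiffAt.hasFDerivAt (g.W_C1.diffAt one_ne_zero hp)
  have hU := DiffAt.hasFDerivAt (g.U_C1.diffAt one_ne_zero hp)
  have h := (ht.neg.add (((hW.const_mul (2⁻¹ : ℝ)).const_sub b).mul hz)).sub (hU.inner ℝ hn)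
  have e : lift (fun p => D v p (g.mult b p)) = fun y => -lift (Dτ v) y
      + (b - 2⁻¹ * lift g.W y) * lift (Dz v) y - ⟪lift g.U y, lift (gradS v) y⟫ := by
    funext y
    simp only [lift, D_mult]
    ring
  have h' : HasFDerivAt (lift fun p => D v p (g.mult b p)) _ (emb p) :=
    h.congr_of_eventuallyEq (Filter.Eventually.of_forall (congrFun e))
  rw [D, h'.fderiv, covector_apply (D (D v) p Y) (g.mult b p)]
  simp [D_Dτ hD, D_Dz hD, D_gradS hD, mult, fderivInnerCLM_apply]
  rw [real_inner_comm (g.U p)]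
  ring

/-- The derivative of `g^{ij} ∂_i v ∂_j v`. -/
theorem D_gradSq {p : Pt} (hp : p ∈ closedSlab R T) (hv : IsCk 2 v {p}) (Y : Vec) :
    D (g.gradSq v) p Y = 2 * D (D v) p Y (g.grad v p)
      + (D g.W p Y * Dz v p ^ 2 + 2 * Dz v p * ⟪D g.U p Y, gradS v p⟫
        + ⟪D g.angInv p Y (gradS v p), gradS v p⟫) := by
  have hs : ({p} : Set Pt) ⊆ closedSlab R T := singleton_subset_iff.mpr hp
  have hD : DiffAt (D v) p := (IsCk.D hv : IsCk 1 (D v) {p}).diffAt one_ne_zero rfl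
  have hz : HasFDerivAt (lift (Dz v)) (D (Dz v) p) (emb p) :=
    DiffAt.hasFDerivAt ((IsCk.Dz hv : IsCk 1 (Dz v) {p}).diffAt one_ne_zero rfl)
  have ht : HasFDerivAt (lift (Dτ v)) (D (Dτ v) p) (emb p) :=
    DiffAt.hasFDerivAt ((IsCk.Dτ hv : IsCk 1 (Dτ v) {p}).diffAt one_ne_zero rfl)
  have hn : HasFDerivAt (lift (gradS v)) (D (gradS v) p) (emb p) :=
    DiffAt.hasFDerivAt ((IsCk.gradS hv : IsCk 1 (gradS v) {p}).diffAt one_ne_zero rfl)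
  have hW := DiffAt.hasFDerivAt (g.W_C1.diffAt one_ne_zero hp)
  have hU := DiffAt.hasFDerivAt (g.U_C1.diffAt one_ne_zero hp)
  have hG := DiffAt.hasFDerivAt (g.isCk_angInv.diffAt one_ne_zero hp)
  have h := ((((hz.mul ht).const_mul (2 : ℝ)).add (hW.mul (hz.mul hz))).add
    ((hz.mul (hU.inner ℝ hn)).const_mul (2 : ℝ))).add ((hG.clm_apply hn).inner ℝ hn)
  have e : lift (g.gradSq v) = fun y => 2 * (lift (Dz v) y * lift (Dτ v) y)
      + lift g.W y * (lift (Dz v) y * lift (Dz v) y)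
      + 2 * (lift (Dz v) y * ⟪lift g.U y, lift (gradS v) y⟫)
      + ⟪lift g.angInv y (lift (gradS v) y), lift (gradS v) y⟫ := by
    funext y
    simp only [lift, gradSq_eq]
  have h' : HasFDerivAt (lift (g.gradSq v)) _ (emb p) :=
    h.congr_of_eventuallyEq (Filter.Eventually.of_forall (congrFun e))
  have hsym : ⟪g.angInv p (angular (D (D v) p Y)), gradS v p⟫
      = ⟪angular (D (D v) p Y), g.angInv p (gradS v p)⟫ := g.angInv_symm hp _ _
  rw [D, h'.fderiv, covector_apply (D (D v) p Y) (g.grad v p)]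
  simp [D_Dτ hD, D_Dz hD, D_gradS hD, grad, fderivInnerCLM_apply, inner_add_left, inner_add_right,
    real_inner_smul_right, hsym]
  rw [real_inner_comm (angular (D (D v) p Y)) (g.U p),
    real_inner_comm (angular (D (D v) p Y)) (g.angInv p (gradS v p))]
  ring

/-- The divergence of the energy current. -/
theorem Div_current {p : Pt} (hp : p ∈ closedSlab R T) (hv : IsCk 2 v {p}) (b : ℝ) :
    Div (g.current b v) p = Real.exp (-2 * g.η p) * (D v p (g.mult b p) * g.box v p
      - (D g.W p (g.grad v p) / 2 * Dz v p + ⟪D g.U p (g.grad v p), gradS v p⟫)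
      - (D g.W p (g.mult b p) * Dz v p ^ 2 + 2 * Dz v p * ⟪D g.U p (g.mult b p), gradS v p⟫
        + ⟪D g.angInv p (g.mult b p) (gradS v p), gradS v p⟫) / 2
      - (g.gradSq v p / 2 + v p ^ 2) * (Div (g.mult b) p - 2 * D g.η p (g.mult b p))
      - 2 * v p * D v p (g.mult b p)) := by
  have hs : ({p} : Set Pt) ⊆ closedSlab R T := singleton_subset_iff.mpr hp
  have hρ : DiffAt (fun p => Real.exp (-2 * g.η p)) p :=
    (g.isCk_density hs).diffAt one_ne_zero rfl
  have hg : DiffAt (g.grad v) p := (g.isCk_grad hs hv).diffAt one_ne_zero rfl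
  have hX : DiffAt (g.mult b) p := (g.isCk_mult hs b).diffAt one_ne_zero rfl
  have hXv := (g.isCk_mult_apply hs hv b).diffAt one_ne_zero rfl
  have hQ := (g.isCk_gradSq hs hv).diffAt one_ne_zero rfl
  have hv1 : DiffAt v p := hv.diffAt two_ne_zero rfl
  have hP : DiffAt (fun p => Real.exp (-2 * g.η p) • g.grad v p) p := DifferentiableAt.smul hρ hg
  have hPX : DiffAt (fun p => Real.exp (-2 * g.η p) • g.mult b p) p := DifferentiableAt.smul hρ hX
  have hq' : HasFDerivAt (lift fun p => g.gradSq v p / 2 + v p ^ 2)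
      ((2⁻¹ : ℝ) • D (g.gradSq v) p + (2 * v p) • D v p) (emb p) := by
    have h1 := (DiffAt.hasFDerivAt hQ).const_mul (2⁻¹ : ℝ)
    have h2 := (DiffAt.hasFDerivAt hv1).pow 2
    have e : lift (fun p => g.gradSq v p / 2 + v p ^ 2)
        = fun y => 2⁻¹ * lift (g.gradSq v) y + lift v y ^ 2 := by
      funext y; simp only [lift]; ring
    rw [e]
    refine (h1.add h2).congr_fderiv ?_
    simp
  have hq : DiffAt (fun p => g.gradSq v p / 2 + v p ^ 2) p := hq'.differentiableAt
  have hqD : ∀ Y, D (fun p => g.gradSq v p / 2 + v p ^ 2) p Y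
      = D (g.gradSq v) p Y / 2 + 2 * v p * D v p Y := fun Y => by
    rw [D, hq'.fderiv]
    simp
    ring
  -- The derivative of Xv along ∇v and half the derivative of |∇v|² along X contain the Hessian with
  -- its arguments exchanged. They cancel, and outside `box` no second derivative survives.
  have hsym := D_D_apply_comm hv (mem_singleton p) (g.grad_tangent hp v) (g.mult_tangent hp b)
  have hη : D (fun p => Real.exp (-2 * g.η p)) p (g.mult b p)
      = Real.exp (-2 * g.η p) * (-2 * D g.η p (g.mult b p)) := by
    have h0 : DiffAt (fun _ => (-2 : ℝ)) p := differentiableAt_const _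
    have h1 : DiffAt (fun p => -2 * g.η p) p :=
      DifferentiableAt.const_mul (g.η_C1.diffAt one_ne_zero hp) (-2 : ℝ)
    rw [D_exp h1, D_mul h0 (g.η_C1.diffAt one_ne_zero hp), D_const]
    simp
  have e : g.current b v = fun p => D v p (g.mult b p) • (Real.exp (-2 * g.η p) • g.grad v p)
    - (g.gradSq v p / 2 + v p ^ 2) • (Real.exp (-2 * g.η p) • g.mult b p) := rfl
  have d1 : DiffAt (fun p => D v p (g.mult b p) • (Real.exp (-2 * g.η p) • g.grad v p)) p :=
    DifferentiableAt.smul hXv hP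
  have d2 : DiffAt (fun p => (g.gradSq v p / 2 + v p ^ 2)
    • (Real.exp (-2 * g.η p) • g.mult b p)) p := DifferentiableAt.smul hq hPX
  rw [e, Div_sub d1 d2, Div_smul hXv hP,
    Div_smul hq hPX, Div_smul hρ hX, hη, ← density_mul_box, map_smul, map_smul,
    g.D_mult_apply hp hv, hqD, g.D_gradSq hp hv, hsym]
  simp only [smul_eq_mul]
  ring

end ConformalMetric

end AdSWave

namespace AdSWave

open ConformalMetric

/-! ### Pointwise estimates -/

/-- The pointwise density `v_τ² + v_z² + |∇_S v|² + v²`. -/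
def jet (v : Pt → ℝ) (p : Pt) : ℝ := Dτ v p ^ 2 + Dz v p ^ 2 + ‖gradS v p‖ ^ 2 + v p ^ 2

theorem jet_nonneg (v : Pt → ℝ) (p : Pt) : 0 ≤ jet v p := by
  unfold jet; positivity

theorem abs_Dτ_le (v : Pt → ℝ) (p : Pt) : |Dτ v p| ≤ Real.sqrt (jet v p) :=
  Real.abs_le_sqrt (by
    unfold jet
    have := sq_nonneg ‖gradS v p‖
    nlinarith [sq_nonneg (Dτ v p), sq_nonneg (Dz v p), sq_nonneg (v p)])

theorem abs_Dz_le (v : Pt → ℝ) (p : Pt) : |Dz v p| ≤ Real.sqrt (jet v p) :=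
  Real.abs_le_sqrt (by
    unfold jet
    have := sq_nonneg ‖gradS v p‖
    nlinarith [sq_nonneg (Dτ v p), sq_nonneg (Dz v p), sq_nonneg (v p)])

theorem norm_gradS_le (v : Pt → ℝ) (p : Pt) : ‖gradS v p‖ ≤ Real.sqrt (jet v p) :=
  Real.le_sqrt_of_sq_le (by
    unfold jet
    have := sq_nonneg ‖gradS v p‖
    nlinarith [sq_nonneg (Dτ v p), sq_nonneg (Dz v p), sq_nonneg (v p)])

theorem abs_le_sqrt_jet (v : Pt → ℝ) (p : Pt) : |v p| ≤ Real.sqrt (jet v p) :=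
  Real.abs_le_sqrt (by
    unfold jet
    have := sq_nonneg ‖gradS v p‖
    nlinarith [sq_nonneg (Dτ v p), sq_nonneg (Dz v p), sq_nonneg (v p)])

/-- A vector of norm at most `B` differentiates `v` to at most `3 B √jet`. -/
theorem abs_D_le (v : Pt → ℝ) (p : Pt) {Y : Vec} {B : ℝ} (hY : ‖Y‖ ≤ B) :
    |D v p Y| ≤ 3 * B * Real.sqrt (jet v p) := by
  have hB : 0 ≤ B := (norm_nonneg _).trans hY
  have h1 : |Y.1| ≤ B := (norm_fst_le Y).trans hY
  have h2 : |Y.2.1| ≤ B := ((norm_fst_le Y.2).trans (norm_snd_le Y)).trans hY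
  have h3 : ‖Y.2.2‖ ≤ B := ((norm_snd_le Y.2).trans (norm_snd_le Y)).trans hY
  rw [D_apply]
  have k1 : |Y.1 * Dτ v p| ≤ B * Real.sqrt (jet v p) := by
    rw [abs_mul]; exact mul_le_mul h1 (abs_Dτ_le v p) (abs_nonneg _) hB
  have k2 : |Y.2.1 * Dz v p| ≤ B * Real.sqrt (jet v p) := by
    rw [abs_mul]; exact mul_le_mul h2 (abs_Dz_le v p) (abs_nonneg _) hB
  have k3 : |⟪gradS v p, Y.2.2⟫| ≤ B * Real.sqrt (jet v p) := by
    refine (abs_real_inner_le_norm _ _).trans ?_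
    rw [mul_comm]; exact mul_le_mul h3 (norm_gradS_le v p) (norm_nonneg _) hB
  calc |Y.1 * Dτ v p + Y.2.1 * Dz v p + ⟪gradS v p, Y.2.2⟫|
      ≤ |Y.1 * Dτ v p + Y.2.1 * Dz v p| + |⟪gradS v p, Y.2.2⟫| := abs_add_le _ _
    _ ≤ |Y.1 * Dτ v p| + |Y.2.1 * Dz v p| + |⟪gradS v p, Y.2.2⟫| := by
        gcongr; exact abs_add_le _ _
    _ ≤ _ := by linarith

/-- The open coordinate slab. -/
def openSlab (R T : ℝ) : Set Pt := {p | p.1 ∈ Ioo 0 T ∧ p.2.1 ∈ Ioo 0 (1 / R)}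

theorem openSlab_subset {R T : ℝ} : openSlab R T ⊆ closedSlab R T := fun _ hp =>
  ⟨Ioo_subset_Icc_self hp.1, Ioo_subset_Icc_self hp.2⟩

namespace ConformalMetric

variable {Λ R T : ℝ} (g : ConformalMetric Λ R T) {v : Pt → ℝ}

/-- The conformal area factor is determined by the angular part of the inverse metric. -/
theorem D_eta {p : Pt} (hp : p ∈ openSlab R T) {Y : Vec} (hY : ⟪(p.2.2 : E3), Y.2.2⟫ = 0) :
    2 * D g.η p Y = Real.exp (-2 * g.η p) * ⟪D g.angInv p Y (p.2.2 : E3), (p.2.2 : E3)⟫ := by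
  have hp' := openSlab_subset hp
  set N : Pt → E3 := fun p => (emb p).2.2 with hN
  have hNd : DiffAt N p := by
    have : IsCk 1 N {p} := IsCk.of_comp_emb (Φ := fun y : Vec => y.2.2) fun q _ =>
      contDiffAt_snd.snd
    exact this.diffAt one_ne_zero rfl
  have hND : D N p Y = Y.2.2 := by
    rw [hN, D_comp_emb (Φ := fun y : Vec => y.2.2) (differentiable_snd.snd _) hY]
    have h3 : HasFDerivAt (fun y : Vec => y.2.2) ((ContinuousLinearMap.snd ℝ ℝ E3).comp
        (ContinuousLinearMap.snd ℝ ℝ (ℝ × E3))) (emb p) :=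
      ((ContinuousLinearMap.snd ℝ ℝ E3).comp
        (ContinuousLinearMap.snd ℝ ℝ (ℝ × E3))).hasFDerivAt
    rw [h3.fderiv]; rfl
  have hG : DiffAt g.angInv p := g.isCk_angInv.diffAt one_ne_zero hp'
  have hη : DiffAt g.η p := g.η_C1.diffAt one_ne_zero hp'
  have h0 : DiffAt (fun _ => (2 : ℝ)) p := differentiableAt_const _
  have h2η : DiffAt (fun p => 2 * g.η p) p := DifferentiableAt.const_mul hη (2 : ℝ)
  have hE : DiffAt (fun p => Real.exp (2 * g.η p)) p := DifferentiableAt.exp h2η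
  -- The eigenvalue relation is known on the slab only; an interior point is needed to have it in a
  -- whole neighbourhood before differentiating.
  have hev : lift (fun p => g.angInv p (N p)) =ᶠ[nhds (emb p)]
      lift fun p => Real.exp (2 * g.η p) • N p := by
    have h1 : ∀ᶠ y : Vec in nhds (emb p), y.1 ∈ Ioo 0 T :=
      continuousAt_fst.eventually_mem (isOpen_Ioo.mem_nhds hp.1)
    have h2 : ∀ᶠ y : Vec in nhds (emb p), y.2.1 ∈ Ioo 0 (1 / R) :=
      continuousAt_snd.fst.eventually_mem (isOpen_Ioo.mem_nhds hp.2)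
    filter_upwards [h1, h2] with y a b
    exact g.angInv_normal (openSlab_subset ⟨a, b⟩)
  have hD : D (fun p => g.angInv p (N p)) p Y = D (fun p => Real.exp (2 * g.η p) • N p) p Y := by
    rw [D, hev.fderiv_eq]; rfl
  rw [D_clm_apply hG hNd, D_smul hE hNd, D_exp h2η, D_mul h0 hη, D_const, hND] at hD
  -- Pairing with x discards the terms in which the base point x is differentiated, since both are
  -- tangent.
  have hi := congrArg (fun ξ : E3 => ⟪ξ, (p.2.2 : E3)⟫) hD
  have hNp : N p = (p.2.2 : E3) := rfl
  have ht : ⟪g.angInv p Y.2.2, (p.2.2 : E3)⟫ = 0 := g.angInv_tangent hp' (by rwa [real_inner_comm])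
  have hY' : ⟪Y.2.2, (p.2.2 : E3)⟫ = 0 := by rwa [real_inner_comm]
  simp only [inner_add_left, real_inner_smul_left, hNp, ht, hY', sphere_inner_self] at hi
  have he : Real.exp (-2 * g.η p) * Real.exp (2 * g.η p) = 1 := by
    rw [← Real.exp_add]; simp
  have hz : (0 : Vec →L[ℝ] ℝ) Y = 0 := rfl
  rw [hz] at hi
  linear_combination (-2 * D g.η p Y) * he - Real.exp (-2 * g.η p) * hi

/-- Bounds, by one constant `κ ≥ 1`, for the metric and its first derivatives at a point. -/
structure BoundedAt (κ : ℝ) (p : Pt) : Prop where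
  one_le : 1 ≤ κ
  mem : p ∈ openSlab R T
  W_le : ‖g.W p‖ ≤ κ
  DW_le : ‖D g.W p‖ ≤ κ
  U_le : ‖g.U p‖ ≤ κ
  DU_le : ‖D g.U p‖ ≤ κ
  G_le : ‖g.angInv p‖ ≤ κ
  DG_le : ‖D g.angInv p‖ ≤ κ
  nondeg : ∀ ξ : E3, ‖ξ‖ ^ 2 ≤ κ * ⟪g.angInv p ξ, ξ⟫

theorem exp_eta_mul (p : Pt) : Real.exp (-2 * g.η p) * Real.exp (2 * g.η p) = 1 := by
  rw [← Real.exp_add]; simp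

theorem norm_angInv_normal {p : Pt} (hp : p ∈ closedSlab R T) :
    Real.exp (2 * g.η p) = ‖g.angInv p (p.2.2 : E3)‖ := by
  rw [g.angInv_normal hp, norm_smul]
  simp

/-- An upper bound on g^{AB} bounds its normal eigenvalue e^{2η}, hence the density e^{-2η} from
below. The opposite bound `BoundedAt.density_le` uses nondegeneracy in the same direction. -/
theorem one_le_mul_density {p : Pt} (hp : p ∈ closedSlab R T) {κ : ℝ} (h : ‖g.angInv p‖ ≤ κ) :
    1 ≤ κ * Real.exp (-2 * g.η p) := by
  have h1 : Real.exp (2 * g.η p) ≤ κ := by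
    rw [g.norm_angInv_normal hp]
    refine ((g.angInv p).le_opNorm _).trans ?_
    simpa using h
  calc 1 = Real.exp (2 * g.η p) * Real.exp (-2 * g.η p) := by rw [mul_comm, g.exp_eta_mul]
    _ ≤ _ := by gcongr

variable {g}

/-! ### Error terms bounded by powers of κ -/

namespace BoundedAt

variable {κ : ℝ} {p : Pt} (hb : g.BoundedAt κ p)

include hb

theorem density_le : Real.exp (-2 * g.η p) ≤ κ := by
  have h := hb.nondeg (p.2.2 : E3)
  rw [g.angInv_normal (openSlab_subset hb.mem), real_inner_smul_left, sphere_inner_self] at h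
  have h1 : (1 : ℝ) ≤ κ * Real.exp (2 * g.η p) := by simpa using h
  calc Real.exp (-2 * g.η p) = Real.exp (-2 * g.η p) * 1 := by ring
    _ ≤ Real.exp (-2 * g.η p) * (κ * Real.exp (2 * g.η p)) := by gcongr
    _ = κ * (Real.exp (-2 * g.η p) * Real.exp (2 * g.η p)) := by ring
    _ = κ := by rw [g.exp_eta_mul, mul_one]

theorem norm_mult_le {b : ℝ} (hbκ : |b| ≤ κ) : ‖g.mult b p‖ ≤ 2 * κ := by
  have h1 := hb.one_le
  have h2 : |g.W p| ≤ κ := hb.W_le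
  have h3 := hb.U_le
  rw [mult, Prod.norm_def, Prod.norm_def]
  refine max_le ?_ (max_le ?_ ?_)
  · simp; linarith
  · rw [Real.norm_eq_abs]
    refine (abs_sub _ _).trans ?_
    rw [abs_div, abs_two]
    linarith
  · simp only [norm_neg]; linarith

theorem norm_grad_le (v : Pt → ℝ) : ‖g.grad v p‖ ≤ 3 * κ * Real.sqrt (jet v p) := by
  have h1 := hb.one_le
  have h2 : |g.W p| ≤ κ := hb.W_le
  have h3 := hb.U_le
  have h4 := hb.G_le
  have hr := Real.sqrt_nonneg (jet v p)
  have hz := abs_Dz_le v p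
  have ht := abs_Dτ_le v p
  have hn := norm_gradS_le v p
  have hκ : 0 ≤ κ := by linarith
  have hr1 : Real.sqrt (jet v p) ≤ κ * Real.sqrt (jet v p) := le_mul_of_one_le_left hr h1
  have k1 : |g.W p * Dz v p| ≤ κ * Real.sqrt (jet v p) := by
    rw [abs_mul]; exact mul_le_mul h2 hz (abs_nonneg _) hκ
  have k2 : |⟪g.U p, gradS v p⟫| ≤ κ * Real.sqrt (jet v p) :=
    (abs_real_inner_le_norm _ _).trans (mul_le_mul h3 hn (norm_nonneg _) hκ)
  have k3 : ‖Dz v p • g.U p‖ ≤ κ * Real.sqrt (jet v p) := by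
    rw [norm_smul, mul_comm]; exact mul_le_mul h3 hz (norm_nonneg _) hκ
  have k4 : ‖g.angInv p (gradS v p)‖ ≤ κ * Real.sqrt (jet v p) :=
    ((g.angInv p).le_opNorm _).trans (mul_le_mul h4 hn (norm_nonneg _) hκ)
  rw [grad, Prod.norm_def, Prod.norm_def]
  refine max_le ?_ (max_le ?_ ?_)
  · rw [Real.norm_eq_abs]; linarith
  · rw [Real.norm_eq_abs]
    refine (abs_add_le _ _).trans ?_
    have := abs_add_le (Dτ v p) (g.W p * Dz v p)
    linarith
  · refine (norm_add_le _ _).trans ?_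
    linarith

theorem abs_mult_apply_le {b : ℝ} (hbκ : |b| ≤ κ) (v : Pt → ℝ) :
    |D v p (g.mult b p)| ≤ 6 * κ * Real.sqrt (jet v p) := by
  have := abs_D_le v p (hb.norm_mult_le hbκ)
  linarith

theorem abs_gradSq_le (v : Pt → ℝ) : |g.gradSq v p| ≤ 9 * κ * jet v p := by
  have := abs_D_le v p (hb.norm_grad_le v)
  refine this.trans (le_of_eq ?_)
  calc _ = 9 * κ * (Real.sqrt (jet v p) * Real.sqrt (jet v p)) := by ring
    _ = _ := by rw [Real.mul_self_sqrt (jet_nonneg v p)]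

theorem abs_Div_mult_le (b : ℝ) : |Div (g.mult b) p| ≤ 4 * κ := by
  have hp := openSlab_subset hb.mem
  have hU := g.U_C1.diffAt one_ne_zero hp
  have hW := DiffAt.hasFDerivAt (g.W_C1.diffAt one_ne_zero hp)
  have e : Div (g.mult b) p = -(Dz g.W p / 2) - divS g.U p := by
    have e1 : Dτ (fun y => (g.mult b y).1) p = 0 := by
      have : (fun y => (g.mult b y).1) = fun _ => (-1 : ℝ) := rfl
      rw [this, Dτ, D_const]; rfl
    have e2 : Dz (fun y => (g.mult b y).2.1) p = -(Dz g.W p / 2) := by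
      have h := (hW.const_mul (2⁻¹ : ℝ)).const_sub b
      have e : lift (fun y => (g.mult b y).2.1) = fun y => b - 2⁻¹ * lift g.W y := by
        funext y; simp only [lift, mult]; ring
      rw [Dz, D, e, h.fderiv]
      simp [Dz]
      ring
    have e3 : divS (fun y => (g.mult b y).2.2) p = -divS g.U p := by
      have h : HasFDerivAt (lift fun y => (g.mult b y).2.2) (-D g.U p) (emb p) :=
        (DiffAt.hasFDerivAt hU).neg
      simp only [divS]
      rw [D, h.fderiv]
      simp
    rw [Div, e1, e2, e3]; ring
  have k1 : |Dz g.W p| ≤ κ := by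
    have := (D g.W p).le_opNorm (0, 1, 0)
    refine this.trans ?_
    simpa [Prod.norm_def] using hb.DW_le
  have k2 : ∀ i : Fin 3, |(D g.U p (0, 0, EuclideanSpace.single i 1)) i| ≤ κ := fun i => by
    refine (PiLp.norm_apply_le (D g.U p (0, 0, EuclideanSpace.single i 1)) i).trans ?_
    refine ((D g.U p).le_opNorm _).trans ?_
    simpa [Prod.norm_def] using hb.DU_le
  have k3 : |divS g.U p| ≤ 3 * κ := by
    refine (Finset.abs_sum_le_sum_abs _ _).trans ?_
    refine (Finset.sum_le_sum fun i _ => k2 i).trans ?_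
    simp
  rw [e]
  refine (abs_sub _ _).trans ?_
  rw [abs_neg, abs_div, abs_two]
  have := hb.one_le
  linarith

theorem abs_D_eta_mult_le {b : ℝ} (hbκ : |b| ≤ κ) : |2 * D g.η p (g.mult b p)| ≤ 2 * κ ^ 3 := by
  have hp := openSlab_subset hb.mem
  have hκ : 0 ≤ κ := by linarith [hb.one_le]
  rw [g.D_eta hb.mem (g.mult_tangent hp b), abs_mul, abs_of_pos (Real.exp_pos _)]
  have h1 : |⟪D g.angInv p (g.mult b p) (p.2.2 : E3), (p.2.2 : E3)⟫| ≤ κ * (2 * κ) := by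
    refine (abs_real_inner_le_norm _ _).trans ?_
    have : ‖(p.2.2 : E3)‖ = 1 := by simp
    rw [this, mul_one]
    refine ((D g.angInv p (g.mult b p)).le_opNorm _).trans ?_
    rw [this, mul_one]
    exact ((D g.angInv p).le_opNorm _).trans
      (mul_le_mul hb.DG_le (hb.norm_mult_le hbκ) (norm_nonneg _) hκ)
  calc _ ≤ κ * (κ * (2 * κ)) := mul_le_mul hb.density_le h1 (abs_nonneg _) hκ
    _ = _ := by ring

/-- The error terms in the divergence of the energy current. -/
theorem Div_current_le (hv : IsCk 2 v {p}) {b : ℝ} (hbκ : |b| ≤ κ) {a : Vec} {ω f : ℝ}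
    (ha : ‖a‖ ≤ κ) (hω : |ω| ≤ κ) (heq : g.box v p + D v p a + ω * v p = f) :
    Div (g.current b v) p
      ≤ Real.exp (-2 * g.η p) * (120 * κ ^ 4 * jet v p + 6 * κ * f ^ 2) := by
  have hp := openSlab_subset hb.mem
  have h1 := hb.one_le
  have hκ : 0 ≤ κ := by linarith
  rw [g.Div_current hp hv b]
  refine mul_le_mul_of_nonneg_left ?_ (Real.exp_pos _).le
  set r := Real.sqrt (jet v p) with hr
  have hr0 : 0 ≤ r := Real.sqrt_nonneg _
  have hr2 : r * r = jet v p := Real.mul_self_sqrt (jet_nonneg v p)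
  have hXv := hb.abs_mult_apply_le hbκ v
  rw [← hr] at hXv
  have hz := abs_Dz_le v p
  have hn := norm_gradS_le v p
  have hv0 := abs_le_sqrt_jet v p
  rw [← hr] at hz hn hv0
  have hX := hb.norm_mult_le hbκ
  have hg := hb.norm_grad_le v
  rw [← hr] at hg
  -- The equation is used here only: 3κ comes from the first-order term through `abs_D_le`, and κ
  -- from ω.
  have hbox : |g.box v p| ≤ |f| + 4 * κ * r := by
    have e : g.box v p = f - D v p a - ω * v p := by linarith
    have k1 := abs_D_le v p ha
    rw [← hr] at k1
    have k2 : |ω * v p| ≤ κ * r := by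
      rw [abs_mul]; exact mul_le_mul hω hv0 (abs_nonneg _) hκ
    rw [e]
    have k3 := abs_sub (f - D v p a) (ω * v p)
    have k4 := abs_sub f (D v p a)
    linarith
  have t1 : D v p (g.mult b p) * g.box v p ≤ 6 * κ * r * (|f| + 4 * κ * r) := by
    refine (le_abs_self _).trans ?_
    rw [abs_mul]
    exact mul_le_mul hXv hbox (abs_nonneg _) (by positivity)
  have s1 : |D g.W p (g.grad v p)| ≤ κ * (3 * κ * r) :=
    ((D g.W p).le_opNorm _).trans (mul_le_mul hb.DW_le hg (norm_nonneg _) hκ)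
  have s2 : ‖D g.U p (g.grad v p)‖ ≤ κ * (3 * κ * r) :=
    ((D g.U p).le_opNorm _).trans (mul_le_mul hb.DU_le hg (norm_nonneg _) hκ)
  have s3 : |D g.W p (g.mult b p)| ≤ κ * (2 * κ) :=
    ((D g.W p).le_opNorm _).trans (mul_le_mul hb.DW_le hX (norm_nonneg _) hκ)
  have s4 : ‖D g.U p (g.mult b p)‖ ≤ κ * (2 * κ) :=
    ((D g.U p).le_opNorm _).trans (mul_le_mul hb.DU_le hX (norm_nonneg _) hκ)
  have s5 : ‖D g.angInv p (g.mult b p)‖ ≤ κ * (2 * κ) :=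
    ((D g.angInv p).le_opNorm _).trans (mul_le_mul hb.DG_le hX (norm_nonneg _) hκ)
  have t2 : |D g.W p (g.grad v p) * Dz v p| ≤ κ * (3 * κ * r) * r := by
    rw [abs_mul]; exact mul_le_mul s1 hz (abs_nonneg _) (by positivity)
  have t3 : |⟪D g.U p (g.grad v p), gradS v p⟫| ≤ κ * (3 * κ * r) * r :=
    (abs_real_inner_le_norm _ _).trans (mul_le_mul s2 hn (norm_nonneg _) (by positivity))
  have hz2 : Dz v p ^ 2 ≤ r * r := by
    rw [← sq_abs, sq]; exact mul_le_mul hz hz (abs_nonneg _) hr0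
  have hv2 : v p ^ 2 ≤ r * r := by
    rw [← sq_abs, sq]; exact mul_le_mul hv0 hv0 (abs_nonneg _) hr0
  have t4 : |D g.W p (g.mult b p) * Dz v p ^ 2| ≤ κ * (2 * κ) * (r * r) := by
    rw [abs_mul, abs_of_nonneg (sq_nonneg (Dz v p))]
    exact mul_le_mul s3 hz2 (sq_nonneg _) (by positivity)
  have t5 : |Dz v p * ⟪D g.U p (g.mult b p), gradS v p⟫| ≤ r * (κ * (2 * κ) * r) := by
    rw [abs_mul]
    exact mul_le_mul hz ((abs_real_inner_le_norm _ _).trans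
      (mul_le_mul s4 hn (norm_nonneg _) (by positivity))) (abs_nonneg _) hr0
  have t6 : |⟪D g.angInv p (g.mult b p) (gradS v p), gradS v p⟫| ≤ κ * (2 * κ) * r * r := by
    refine (abs_real_inner_le_norm _ _).trans (mul_le_mul ?_ hn (norm_nonneg _) (by positivity))
    exact ((D g.angInv p (g.mult b p)).le_opNorm _).trans
      (mul_le_mul s5 hn (norm_nonneg _) (by positivity))
  have hQ := hb.abs_gradSq_le v
  rw [← hr2] at hQ
  have u1 : |g.gradSq v p / 2 + v p ^ 2| ≤ 6 * κ * (r * r) := by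
    refine (abs_add_le _ _).trans ?_
    rw [abs_div, abs_two, abs_of_nonneg (sq_nonneg (v p))]
    have : r * r ≤ κ * (r * r) := le_mul_of_one_le_left (by positivity) h1
    linarith [mul_self_nonneg r]
  have u2 : |Div (g.mult b) p - 2 * D g.η p (g.mult b p)| ≤ 4 * κ + 2 * κ ^ 3 := by
    refine (abs_sub _ _).trans (add_le_add (hb.abs_Div_mult_le b) (hb.abs_D_eta_mult_le hbκ))
  have t7 : |(g.gradSq v p / 2 + v p ^ 2) * (Div (g.mult b) p - 2 * D g.η p (g.mult b p))|
      ≤ 6 * κ * (r * r) * (4 * κ + 2 * κ ^ 3) := by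
    rw [abs_mul]; exact mul_le_mul u1 u2 (abs_nonneg _) (by positivity)
  have t8 : |v p * D v p (g.mult b p)| ≤ r * (6 * κ * r) := by
    rw [abs_mul]; exact mul_le_mul hv0 hXv (abs_nonneg _) hr0
  rw [← hr2]
  -- The source meets the jet only in the product of Xv and □v, and is split off by Young's
  -- inequality.
  have hf : r * |f| ≤ r * r + f ^ 2 := by
    rw [← sq_abs f]; nlinarith [sq_nonneg (r - |f|), sq_nonneg r, sq_nonneg |f|]
  have hf' : κ * (r * |f|) ≤ κ * (r * r + f ^ 2) := mul_le_mul_of_nonneg_left hf hκ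
  -- Since κ ≥ 1, all powers of κ are raised to the fourth, and the coefficients of the jet then add
  -- up to less than 120.
  have q2 : κ * (r * r) ≤ κ ^ 4 * (r * r) := by
    have : κ ≤ κ ^ 4 := le_self_pow₀ h1 (by norm_num)
    gcongr
  have q3 : κ ^ 2 * (r * r) ≤ κ ^ 4 * (r * r) := by
    have : κ ^ 2 ≤ κ ^ 4 := pow_le_pow_right₀ h1 (by norm_num)
    gcongr
  have a2 := abs_le.mp t2
  have a3 := abs_le.mp t3
  have a4 := abs_le.mp t4
  have a5 := abs_le.mp t5
  have a6 := abs_le.mp t6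
  have a7 := abs_le.mp t7
  have a8 := abs_le.mp t8
  ring_nf at *
  linarith [a2.1, a3.1, a4.1, a5.1, a6.1, a7.1, a8.1]

end BoundedAt

end ConformalMetric

end AdSWave

/-! ### The weight and the signs of the fluxes -/

namespace AdSWave

open ConformalMetric

theorem hasFDerivAt_weight (q l : ℝ) (p : Pt) :
    HasFDerivAt (lift (weight q l)) (weight q l p • (-((q * l) • ContinuousLinearMap.fst ℝ ℝ (ℝ × E3))
      + q • (ContinuousLinearMap.fst ℝ ℝ E3).comp (ContinuousLinearMap.snd ℝ ℝ (ℝ × E3))))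
      (emb p) := by
  have h1 : HasFDerivAt (fun y : Vec => y.1) (ContinuousLinearMap.fst ℝ ℝ (ℝ × E3)) (emb p) :=
    (ContinuousLinearMap.fst ℝ ℝ (ℝ × E3)).hasFDerivAt
  have h2 : HasFDerivAt (fun y : Vec => y.2.1) ((ContinuousLinearMap.fst ℝ ℝ E3).comp
        (ContinuousLinearMap.snd ℝ ℝ (ℝ × E3))) (emb p) :=
    ((ContinuousLinearMap.fst ℝ ℝ E3).comp
        (ContinuousLinearMap.snd ℝ ℝ (ℝ × E3))).hasFDerivAt
  exact ((h1.const_mul (q * l)).neg.add (h2.const_mul q)).exp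

theorem isCk_weight (q l : ℝ) (s : Set Pt) : IsCk 1 (weight q l) s :=
  IsCk.comp_time (f := fun y : ℝ × ℝ => Real.exp (-(q * l * y.1) + q * y.2)) (by fun_prop)

theorem weight_pos (q l : ℝ) (p : Pt) : 0 < weight q l p := Real.exp_pos _

/-- The differential of log h is -q (l dτ - dz), so the derivative of the weight brings in q times
the flux of Z through the level sets of h. -/
theorem Div_weight_smul {q l : ℝ} {Z : Pt → Vec} {p : Pt} (hZ : DiffAt Z p) :
    Div (fun p => weight q l p • Z p) p
      = weight q l p * (Div Z p - q * (l * (Z p).1 - (Z p).2.1)) := by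
  rw [Div_smul (hasFDerivAt_weight q l p).differentiableAt hZ, D, (hasFDerivAt_weight q l p).fderiv]
  simp
  ring

theorem Dz_ext {T : ℝ} {ζ : ℝ × S2 → ℝ} (hζ : IsConeGraph T ζ) {p : Pt} (hp : p.1 ∈ Icc 0 T) :
    Dz (ext ζ) p = 0 :=
  (hasDerivAt_radial (hζ.diffAt_ext (p := (p.1, p.2.1, p.2.2)) hp)).unique
    (hasDerivAt_const p.2.1 (ζ (p.1, p.2.2)))

theorem Dz_defFun {T : ℝ} {ζ : ℝ × S2 → ℝ} (hζ : IsConeGraph T ζ) {p : Pt} (hp : p.1 ∈ Icc 0 T) :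
    Dz (defFun ζ) p = -1 := by
  have h := Dz_ext hζ hp
  rw [Dz] at h ⊢
  rw [D_defFun (hζ.diffAt_ext hp), h]
  simp

theorem IsCk.continuousAt_jet {v : Pt → ℝ} {s : Set Pt} (hv : IsCk 2 v s) {p : Pt} (hp : p ∈ s) :
    ContinuousAt (jet v) p := by
  have h1 : ContinuousAt (AdSWave.Dτ v) p := IsCk.continuousAt (k := 1) (IsCk.Dτ hv) hp
  have h2 : ContinuousAt (AdSWave.Dz v) p := IsCk.continuousAt (k := 1) (IsCk.Dz hv) hp
  have h3 : ContinuousAt (AdSWave.gradS v) p := IsCk.continuousAt (k := 1) (IsCk.gradS hv) hp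
  exact (((h1.pow 2).add (h2.pow 2)).add (h3.norm.pow 2)).add ((hv.continuousAt hp).pow 2)

namespace ConformalMetric

variable {Λ R T : ℝ} {g : ConformalMetric Λ R T} {v : Pt → ℝ} {ζ : ℝ × S2 → ℝ}

theorem IsNullCone.isConeGraph (h : g.IsNullCone ζ) (hT : 0 < T) : IsConeGraph T ζ where
  time_pos := hT
  contDiff := h.contDiff.ext_of_defFun
  start := h.start
  pos y hy := (h.inside y hy).1

theorem IsNullCone.subgraph_subset (h : g.IsNullCone ζ) : subgraph T ζ ⊆ openSlab R T :=
  fun p hp => ⟨hp.1, hp.2.1, hp.2.2.trans_le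
    (h.inside (p.1, p.2.2) (Ioo_subset_Ioc_self hp.1)).2⟩

theorem IsNullCone.closedSubgraph_subset (h : g.IsNullCone ζ) (hR : 0 < R) :
    closedSubgraph T ζ ⊆ closedSlab R T := by
  rintro p ⟨h1, h2⟩
  refine ⟨h1, h2.1, h2.2.trans ?_⟩
  rcases h1.1.eq_or_lt with h0 | h0
  · rw [← h0, h.start]; positivity
  · exact (h.inside (p.1, p.2.2) ⟨h0, h1.2⟩).2

/-- The energy current dominates all first derivatives. -/
theorem BoundedAt.jet_le {κ : ℝ} {p : Pt} (hb : g.BoundedAt κ p) {b : ℝ} (hb0 : 0 < b)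
    (hbκ : 1 ≤ κ * b) (v : Pt → ℝ) :
    Real.exp (-2 * g.η p) * jet v p
      ≤ 8 * κ ^ 3 * ((κ + 1) * (g.current b v p).1 - (g.current b v p).2.1) := by
  have h1 := hb.one_le
  have hκ : 0 ≤ κ := by linarith
  have hW := abs_le.mp hb.W_le
  rw [current_time, current_radial]
  set ν := ⟪g.angInv p (gradS v p), gradS v p⟫ with hν
  set w := D v p (g.N2 p) with hw
  set m := Real.exp (-2 * g.η p) with hm
  have hm0 : 0 < m := Real.exp_pos _
  have hν1 : ‖gradS v p‖ ^ 2 ≤ κ * ν := hb.nondeg _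
  have hν0 : 0 ≤ ν := g.angInv_nonneg (openSlab_subset hb.mem) _
  have e : 8 * κ ^ 3 * ((κ + 1) * (m * (b * Dz v p ^ 2 + ν / 2 + v p ^ 2))
      - m * (b * g.W p / 2 * Dz v p ^ 2 - w ^ 2 - (b - g.W p / 2) * (ν / 2 + v p ^ 2)))
      = m * (8 * κ ^ 3 * ((κ + 1 - g.W p / 2) * (b * Dz v p ^ 2 + ν / 2 + v p ^ 2)
        + b * (ν / 2 + v p ^ 2) + w ^ 2)) := by ring
  rw [e]
  refine mul_le_mul_of_nonneg_left ?_ hm0.le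
  have hpos : 0 ≤ b * Dz v p ^ 2 + ν / 2 + v p ^ 2 := by positivity
  -- This is the reason for l = κ + 1: since W ≤ κ, the factor l - W/2 is at least one.
  have k1 : b * Dz v p ^ 2 + ν / 2 + v p ^ 2
      ≤ (κ + 1 - g.W p / 2) * (b * Dz v p ^ 2 + ν / 2 + v p ^ 2) :=
    le_mul_of_one_le_left hpos (by linarith [hW.2])
  have k2 : 0 ≤ b * (ν / 2 + v p ^ 2) := by positivity
  have hk : 8 * κ ^ 3 * (b * Dz v p ^ 2 + ν / 2 + v p ^ 2 + w ^ 2)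
      ≤ 8 * κ ^ 3 * ((κ + 1 - g.W p / 2) * (b * Dz v p ^ 2 + ν / 2 + v p ^ 2)
        + b * (ν / 2 + v p ^ 2) + w ^ 2) :=
    mul_le_mul_of_nonneg_left (by linarith) (by positivity)
  refine le_trans ?_ hk
  -- The quadratic form contains ∂_τ v only through N₂ v, from which it is recovered at the cost of
  -- ∂_z v and the angular gradient.
  have hτ : Dτ v p ^ 2 ≤ 3 * (w ^ 2 + κ ^ 2 * Dz v p ^ 2 + κ ^ 2 * ‖gradS v p‖ ^ 2) := by
    have ht : Dτ v p = -w - g.W p / 2 * Dz v p - ⟪g.U p, gradS v p⟫ := by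
      rw [hw, D_N2]; ring
    have j1 : (g.W p / 2 * Dz v p) ^ 2 ≤ κ ^ 2 * Dz v p ^ 2 := by
      rw [mul_pow]
      refine mul_le_mul_of_nonneg_right (sq_le_sq' ?_ ?_) (sq_nonneg _)
      · linarith [hW.1]
      · linarith [hW.2]
    have j2 : ⟪g.U p, gradS v p⟫ ^ 2 ≤ κ ^ 2 * ‖gradS v p‖ ^ 2 := by
      rw [← mul_pow, ← sq_abs]
      refine pow_le_pow_left₀ (abs_nonneg _) ((abs_real_inner_le_norm _ _).trans ?_) 2
      exact mul_le_mul_of_nonneg_right hb.U_le (norm_nonneg _)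
    rw [ht]
    nlinarith [sq_nonneg (w - g.W p / 2 * Dz v p), sq_nonneg (w - ⟪g.U p, gradS v p⟫),
      sq_nonneg (g.W p / 2 * Dz v p - ⟪g.U p, gradS v p⟫)]
  have c2 : 1 ≤ κ ^ 2 := one_le_pow₀ h1
  have c3 : 1 ≤ κ ^ 3 := one_le_pow₀ h1
  have d1 : κ ^ 2 * Dz v p ^ 2 ≤ κ ^ 3 * (b * Dz v p ^ 2) := by
    have := mul_le_mul_of_nonneg_left hbκ (mul_nonneg (sq_nonneg κ) (sq_nonneg (Dz v p)))
    linarith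
  have d2 : κ ^ 2 * ‖gradS v p‖ ^ 2 ≤ κ ^ 3 * ν := by
    have := mul_le_mul_of_nonneg_left hν1 (sq_nonneg κ)
    linarith
  have d3 : Dz v p ^ 2 ≤ κ ^ 2 * Dz v p ^ 2 := le_mul_of_one_le_left (sq_nonneg _) c2
  have d4 : ‖gradS v p‖ ^ 2 ≤ κ ^ 2 * ‖gradS v p‖ ^ 2 := le_mul_of_one_le_left (sq_nonneg _) c2
  have d5 : v p ^ 2 ≤ κ ^ 3 * v p ^ 2 := le_mul_of_one_le_left (sq_nonneg _) c3
  have d6 : w ^ 2 ≤ κ ^ 3 * w ^ 2 := le_mul_of_one_le_left (sq_nonneg _) c3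
  have d7 : 0 ≤ κ ^ 3 * v p ^ 2 := by positivity
  have d8 : 0 ≤ κ ^ 3 * w ^ 2 := by positivity
  have d9 : 0 ≤ κ ^ 3 * (b * Dz v p ^ 2) := by positivity
  -- The angular term decides the constant: 3κ² + 1 ≤ 4κ² copies of ‖∇_S v‖² need 4κ³ν = 8κ³ · ν/2.
  unfold jet
  nlinarith

/-- The pointwise estimate of the divergence of the weighted energy current. -/
theorem BoundedAt.Div_weighted_le {κ : ℝ} {p : Pt} (hb : g.BoundedAt κ p) (hv : IsCk 2 v {p})
    {b : ℝ} (hb0 : 0 < b) (hbκ : 1 ≤ κ * b) (hbκ' : b ≤ κ) {a : Vec} {ω f : ℝ}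
    (ha : ‖a‖ ≤ κ) (hω : |ω| ≤ κ) (heq : g.box v p + D v p a + ω * v p = f) {q : ℝ}
    (hq : 1920 * κ ^ 7 ≤ q) :
    16 * κ ^ 4 * Div (fun p => weight q (κ + 1) p • g.current b v p) p
      ≤ -(q * (weight q (κ + 1) p * jet v p))
        + 96 * κ ^ 6 * (weight q (κ + 1) p * f ^ 2) := by
  have h1 := hb.one_le
  have hκ : 0 ≤ κ := by linarith
  have hs : ({p} : Set Pt) ⊆ closedSlab R T := singleton_subset_iff.mpr (openSlab_subset hb.mem)
  rw [Div_weight_smul ((g.isCk_current hs hv b).diffAt one_ne_zero rfl)]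
  have e1 := hb.Div_current_le hv (b := b) (by rwa [abs_of_pos hb0]) ha hω heq
  have e2 := hb.jet_le hb0 hbκ v
  have e3 := g.one_le_mul_density (openSlab_subset hb.mem) hb.G_le
  have e4 := hb.density_le
  have hm0 := Real.exp_pos (-2 * g.η p)
  set m := Real.exp (-2 * g.η p)
  set L := (κ + 1) * (g.current b v p).1 - (g.current b v p).2.1
  set d := Div (g.current b v) p
  set J := jet v p with hJ
  have hJ0 : 0 ≤ J := jet_nonneg v p
  have hq0 : 0 ≤ q := le_trans (by positivity) hq
  suffices h : 16 * κ ^ 4 * (d - q * L) ≤ -(q * J) + 96 * κ ^ 6 * f ^ 2 by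
    have := mul_le_mul_of_nonneg_left h (weight_pos q (κ + 1) p).le
    linarith
  have s1 : 16 * κ ^ 4 * d ≤ 16 * κ ^ 4 * (m * (120 * κ ^ 4 * J + 6 * κ * f ^ 2)) :=
    mul_le_mul_of_nonneg_left e1 (by positivity)
  -- Two copies of κ q m J are available. One absorbs the error terms by `s3`, where 1920 = 16 ·
  -- 120; the other is at least q J by `s4`.
  have s2 : 2 * κ * q * (m * J) ≤ 2 * κ * q * (8 * κ ^ 3 * L) :=
    mul_le_mul_of_nonneg_left e2 (by positivity)
  have s3 : κ * (m * J) * (1920 * κ ^ 7) ≤ κ * (m * J) * q :=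
    mul_le_mul_of_nonneg_left hq (by positivity)
  have s4 : 1 * (q * J) ≤ κ * m * (q * J) := mul_le_mul_of_nonneg_right e3 (by positivity)
  have s5 : 96 * κ ^ 5 * f ^ 2 * m ≤ 96 * κ ^ 5 * f ^ 2 * κ :=
    mul_le_mul_of_nonneg_left e4 (by positivity)
  linarith

/-- The flux of the energy current through conformal infinity. -/
theorem current_radial_infinity_le {p : Pt} (hp : p ∈ closedSlab R T) (hz : p.2.1 = 0)
    {b κ : ℝ} (hb : b = -Λ / 12) (hb0 : 0 < b) (hbκ : 1 ≤ κ * b) (hbκ' : b ≤ κ) (hκ : 1 ≤ κ)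
    (v : Pt → ℝ) :
    κ ^ 2 * (g.current b v p).2.1
      ≤ -(Dz v p ^ 2) + 3 * κ ^ 3 * (v p ^ 2 + (Dτ v p ^ 2 + ‖gradS v p‖ ^ 2)) := by
  -- Here b - W/2 = -b is negative.
  have hW : g.W p = 4 * b := by rw [g.W_infinity p hp hz, hb]; ring
  have hη := g.η_infinity p hp hz
  have hU := (g.U_infinity p hp hz).1
  have hG : g.angInv p = ContinuousLinearMap.id ℝ E3 := by
    rw [angInv, g.h_infinity p hp hz, hη, mul_zero, Real.exp_zero, one_smul]
    exact Ring.inverse_one (E3 →L[ℝ] E3)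
  rw [current_radial, D_N2, hW, hη, hU, hG]
  simp only [mul_zero, Real.exp_zero, inner_zero_left, ContinuousLinearMap.id_apply,
    real_inner_self_eq_norm_sq]
  set z := Dz v p
  set t := Dτ v p
  set n := ‖gradS v p‖ ^ 2 with hn
  have hn0 : 0 ≤ n := sq_nonneg _
  have hκ0 : 0 ≤ κ := by linarith
  -- The terms in z and t are -2b²z² - 4btz - t² = -b²z² - (bz + 2t)² + 3t²: half of the good term
  -- pays for the mixed one.
  have a1 : 1 * (b * (4 * b) / 2 * z ^ 2 - (-(t + 4 * b / 2 * z + 0)) ^ 2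
      - (b - 4 * b / 2) * (n / 2 + v p ^ 2)) ≤ -(b * z) ^ 2 + 3 * t ^ 2 + b * (n + v p ^ 2) := by
    nlinarith [sq_nonneg (b * z + 2 * t), mul_nonneg hb0.le hn0]
  have a2 := mul_le_mul_of_nonneg_left a1 (sq_nonneg κ)
  refine a2.trans ?_
  have a3 : 1 * z ^ 2 ≤ (κ * b) ^ 2 * z ^ 2 :=
    mul_le_mul_of_nonneg_right (one_le_pow₀ hbκ) (sq_nonneg _)
  have a4 : κ ^ 2 * t ^ 2 ≤ κ ^ 3 * t ^ 2 :=
    mul_le_mul_of_nonneg_right (pow_le_pow_right₀ hκ (by norm_num)) (sq_nonneg _)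
  have a5 : κ ^ 2 * (n + v p ^ 2) * b ≤ κ ^ 2 * (n + v p ^ 2) * κ :=
    mul_le_mul_of_nonneg_left hbκ' (by positivity)
  have a6 : 0 ≤ κ ^ 3 * (n + v p ^ 2) := by positivity
  nlinarith

/-- The flux of the energy current through `τ = T`. -/
theorem le_current_time {p : Pt} (hp : p ∈ closedSlab R T) {b κ : ℝ} (hb0 : 0 < b)
    (hbκ : 1 ≤ κ * b) (hκ : 1 ≤ κ) (hm : 1 ≤ κ * Real.exp (-2 * g.η p))
    (hG : ‖gradS v p‖ ^ 2 ≤ κ * ⟪g.angInv p (gradS v p), gradS v p⟫) :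
    v p ^ 2 + (Dz v p ^ 2 + ‖gradS v p‖ ^ 2) ≤ 2 * κ ^ 2 * (g.current b v p).1 := by
  rw [current_time]
  have hν0 := g.angInv_nonneg hp (gradS v p)
  set ν := ⟪g.angInv p (gradS v p), gradS v p⟫
  set m := Real.exp (-2 * g.η p)
  have a1 : 1 * (2 * κ * (b * Dz v p ^ 2 + ν / 2 + v p ^ 2))
      ≤ κ * m * (2 * κ * (b * Dz v p ^ 2 + ν / 2 + v p ^ 2)) :=
    mul_le_mul_of_nonneg_right hm (by positivity)
  have a2 : 1 * Dz v p ^ 2 ≤ κ * b * Dz v p ^ 2 :=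
    mul_le_mul_of_nonneg_right hbκ (sq_nonneg _)
  have a3 : 1 * v p ^ 2 ≤ κ * v p ^ 2 := mul_le_mul_of_nonneg_right hκ (sq_nonneg _)
  nlinarith [sq_nonneg (v p), sq_nonneg (Dz v p)]

end ConformalMetric

end AdSWave

namespace AdSWave

open ConformalMetric

/-! ### The integrated estimate -/

namespace ConformalMetric

variable {Λ R T : ℝ} {g : ConformalMetric Λ R T} {v : Pt → ℝ} {ζ : ℝ × S2 → ℝ}

theorem continuousAt_box {s : Set Pt} (hs : s ⊆ closedSlab R T) (hv : IsCk 2 v s) {p : Pt}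
    (hp : p ∈ s) : ContinuousAt (g.box v) p := by
  have h1 : IsCk 1 (fun p => Real.exp (-2 * g.η p) • g.grad v p) s :=
    (g.isCk_density hs).smul (g.isCk_grad hs hv)
  have h2 : ContinuousAt (fun p => Real.exp (2 * g.η p)) p :=
    ((continuousAt_const.mul (g.η_C1.continuousAt (hs hp))).rexp)
  have e : g.box v = fun p => Real.exp (2 * g.η p)
    * Div (fun p => Real.exp (-2 * g.η p) • g.grad v p) p := rfl
  rw [e]
  exact h2.mul (h1.continuousAt_Div hp)

/-- The right-hand side of the wave equation is square integrable. -/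
theorem integrableOn_source (hζ : IsConeGraph T ζ) (hs : closedSubgraph T ζ ⊆ closedSlab R T)
    (hv : IsCk 2 v (closedSubgraph T ζ)) {a : Pt → Vec} {ω f : Pt → ℝ} {κ : ℝ}
    (ha : AEStronglyMeasurable a (vol4.restrict (subgraph T ζ)))
    (hω : AEStronglyMeasurable ω (vol4.restrict (subgraph T ζ)))
    (haκ : ∀ᵐ p ∂vol4.restrict (subgraph T ζ), ‖a p‖ ≤ κ)
    (hωκ : ∀ᵐ p ∂vol4.restrict (subgraph T ζ), |ω p| ≤ κ)
    (heq : ∀ᵐ p ∂vol4.restrict (subgraph T ζ), g.box v p + D v p (a p) + ω p * v p = f p)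
    {w : Pt → ℝ} (hw : ∀ p ∈ closedSubgraph T ζ, ContinuousAt w p) (hw0 : ∀ p, 0 ≤ w p) :
    IntegrableOn (fun p => w p * f p ^ 2) (subgraph T ζ) vol4 := by
  have meas : ∀ {G : Type} [NormedAddCommGroup G] {F : Pt → G},
      (∀ p ∈ closedSubgraph T ζ, ContinuousAt F p) →
      ∀ [SecondCountableTopology G],
      AEStronglyMeasurable F (vol4.restrict (subgraph T ζ)) := fun hF =>
    ContinuousOn.aestronglyMeasurable
      (fun p hp => (hF p (subgraph_subset_closedSubgraph hp)).continuousWithinAt)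
      hζ.isOpen_subgraph.measurableSet
  have cb : ∀ p ∈ closedSubgraph T ζ, ContinuousAt (g.box v) p := fun p hp =>
    continuousAt_box hs hv hp
  have cj : ∀ p ∈ closedSubgraph T ζ, ContinuousAt (jet v) p := fun p hp => hv.continuousAt_jet hp
  have hD : AEStronglyMeasurable (fun p => D v p (a p)) (vol4.restrict (subgraph T ζ)) :=
    isBoundedBilinearMap_apply.continuous.comp_aestronglyMeasurable
      ((meas fun p hp => hv.continuousAt_D two_ne_zero hp).prodMk ha)
  -- The source is not assumed measurable; the equation makes it so.
  have hf : AEStronglyMeasurable f (vol4.restrict (subgraph T ζ)) :=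
    (((meas cb).add hD).add (hω.mul (meas fun p hp => hv.continuousAt hp))).congr heq
  -- The dominating function comes from (x + y + z)² ≤ 3(x² + y² + z²), with 30κ² = 3(9κ² + κ²).
  have hi : IntegrableOn (fun p => w p * (3 * g.box v p ^ 2 + 30 * κ ^ 2 * jet v p))
      (subgraph T ζ) vol4 :=
    hζ.integrableOn_subgraph fun p hp => (hw p hp).mul
      ((continuousAt_const.mul ((cb p hp).pow 2)).add (continuousAt_const.mul (cj p hp)))
  refine Integrable.mono' hi ((meas hw).mul (hf.pow 2)) ?_
  filter_upwards [haκ, hωκ, heq] with p h1 h2 h3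
  have hj := jet_nonneg v p
  have k1 := abs_D_le v p h1
  have k2 : |ω p * v p| ≤ κ * Real.sqrt (jet v p) := by
    rw [abs_mul]
    exact mul_le_mul h2 (abs_le_sqrt_jet v p) (abs_nonneg _) ((abs_nonneg _).trans h2)
  have l1 : D v p (a p) ^ 2 ≤ 9 * κ ^ 2 * jet v p := by
    rw [← sq_abs]
    refine (pow_le_pow_left₀ (abs_nonneg _) k1 2).trans (le_of_eq ?_)
    rw [mul_pow, Real.sq_sqrt hj]; ring
  have l2 : (ω p * v p) ^ 2 ≤ κ ^ 2 * jet v p := by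
    rw [← sq_abs]
    refine (pow_le_pow_left₀ (abs_nonneg _) k2 2).trans (le_of_eq ?_)
    rw [mul_pow, Real.sq_sqrt hj]
  rw [Real.norm_eq_abs, abs_of_nonneg (mul_nonneg (hw0 p) (sq_nonneg _)), ← h3]
  refine mul_le_mul_of_nonneg_left ?_ (hw0 p)
  nlinarith [sq_nonneg (g.box v p - D v p (a p)), sq_nonneg (g.box v p - ω p * v p),
    sq_nonneg (D v p (a p) - ω p * v p)]

/-- The energy estimate for the squares of the norms. -/
theorem energy_estimate (hR : 0 < R) (hT : 0 < T) (hcone : g.IsNullCone ζ) {κ b : ℝ}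
    (hbd : ∀ p ∈ subgraph T ζ, g.BoundedAt κ p) (hb : b = -Λ / 12) (hb0 : 0 < b)
    (hbκ : 1 ≤ κ * b) (hbκ' : b + 1 ≤ κ) (hκ : 1 ≤ κ) (hv : IsCk 2 v (closedSubgraph T ζ))
    {a : Pt → Vec} {ω f : Pt → ℝ}
    (ha : AEStronglyMeasurable a (vol4.restrict (subgraph T ζ)))
    (hω : AEStronglyMeasurable ω (vol4.restrict (subgraph T ζ)))
    (haκ : ∀ᵐ p ∂vol4.restrict (subgraph T ζ), ‖a p‖ ≤ κ)
    (hωκ : ∀ᵐ p ∂vol4.restrict (subgraph T ζ), |ω p| ≤ κ)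
    (heq : ∀ᵐ p ∂vol4.restrict (subgraph T ζ), g.box v p + D v p (a p) + ω p * v p = f p)
    {q : ℝ} (hq : 1920 * κ ^ 7 ≤ q) :
    0 ≤ g.nullEnergy (weight q (κ + 1)) ζ v 1 1 ∧
    q * ∫ p in subgraph T ζ, weight q (κ + 1) p * jet v p ∂vol4
      + ∫ y in {y : ℝ × S2 | y.1 ∈ Ioo 0 (ζ (T, y.2))}, weight q (κ + 1) (T, y)
          * (v (T, y) ^ 2 + (Dz v (T, y) ^ 2 + ‖gradS v (T, y)‖ ^ 2)) ∂vol3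
      + ∫ y in Ioo 0 T ×ˢ univ, weight q (κ + 1) (onInfinity y) * Dz v (onInfinity y) ^ 2 ∂vol3
    ≤ 96 * κ ^ 6 * (g.nullEnergy (weight q (κ + 1)) ζ v 1 1
      + ∫ y in Ioo 0 T ×ˢ univ, weight q (κ + 1) (onInfinity y) * (v (onInfinity y) ^ 2
          + (Dτ v (onInfinity y) ^ 2 + ‖gradS v (onInfinity y)‖ ^ 2)) ∂vol3
      + ∫ p in subgraph T ζ, weight q (κ + 1) p * f p ^ 2 ∂vol4) := by
  have hζ := hcone.isConeGraph hT
  have hs := hcone.closedSubgraph_subset hR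
  have hT' : T ∈ Icc 0 T := ⟨hT.le, le_rfl⟩
  have hκ0 : 0 ≤ κ := by linarith
  set w := weight q (κ + 1) with hw
  have w0 : ∀ p, 0 < w p := weight_pos q (κ + 1)
  have cw : ∀ p ∈ closedSubgraph T ζ, ContinuousAt w p := fun p hp =>
    (isCk_weight q (κ + 1) _).continuousAt hp
  have cz : ∀ p ∈ closedSubgraph T ζ, ContinuousAt (Dz v) p := fun p hp =>
    IsCk.continuousAt (k := 1) (IsCk.Dz hv) hp
  have ct : ∀ p ∈ closedSubgraph T ζ, ContinuousAt (Dτ v) p := fun p hp =>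
    IsCk.continuousAt (k := 1) (IsCk.Dτ hv) hp
  have cn : ∀ p ∈ closedSubgraph T ζ, ContinuousAt (gradS v) p := fun p hp =>
    IsCk.continuousAt (k := 1) (IsCk.gradS hv) hp
  have cv : ∀ p ∈ closedSubgraph T ζ, ContinuousAt v p := fun p hp => hv.continuousAt hp
  -- the divergence theorem
  have hM : ∀ b, IsCk 1 (fun p => w p • g.current b v p) (closedSubgraph T ζ) := fun b =>
    (isCk_weight q (κ + 1) _).smul (g.isCk_current hs hv b)
  have hdiv := hζ.integral_Div (hM b) fun p hp => by
    simp only [Prod.smul_snd, real_inner_smul_left, g.current_tangent (hs hp) b v, mul_zero]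
  -- the interior
  have hint : 16 * κ ^ 4 * ∫ p in subgraph T ζ, Div (fun p => w p • g.current b v p) p ∂vol4
      ≤ -(q * ∫ p in subgraph T ζ, w p * jet v p ∂vol4)
        + 96 * κ ^ 6 * ∫ p in subgraph T ζ, w p * f p ^ 2 ∂vol4 := by
    have i1 : IntegrableOn (fun p => w p * jet v p) (subgraph T ζ) vol4 :=
      hζ.integrableOn_subgraph fun p hp => (cw p hp).mul (hv.continuousAt_jet hp)
    -- Integrability is essential: otherwise the integral of the source would be zero by convention
    -- and could not bound anything.
    have i2 : IntegrableOn (fun p => w p * f p ^ 2) (subgraph T ζ) vol4 :=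
      integrableOn_source hζ hs hv ha hω haκ hωκ heq cw fun p => (w0 p).le
    have i3 : IntegrableOn (fun p => Div (fun p => w p • g.current b v p) p) (subgraph T ζ) vol4 :=
      hζ.integrableOn_subgraph fun p hp => (hM b).continuousAt_Div hp
    have i1' : IntegrableOn (fun p => -(q * (w p * jet v p))) (subgraph T ζ) vol4 :=
      (i1.const_mul q).neg
    rw [← integral_const_mul, ← integral_const_mul, ← integral_const_mul, ← integral_neg,
      ← integral_add i1' (i2.const_mul _)]
    refine integral_mono_ae (i3.const_mul _) (i1'.add (i2.const_mul _)) ?_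
    filter_upwards [haκ, hωκ, heq, ae_restrict_mem hζ.isOpen_subgraph.measurableSet]
      with p h1 h2 h3 hp
    exact (hbd p hp).Div_weighted_le
      (hv.mono (singleton_subset_iff.mpr (subgraph_subset_closedSubgraph hp))) hb0 hbκ
      (by linarith) h1 h2 h3 hq
  -- the final slice
  have hslice : ∫ y in {y : ℝ × S2 | y.1 ∈ Ioo 0 (ζ (T, y.2))}, w (T, y)
          * (v (T, y) ^ 2 + (Dz v (T, y) ^ 2 + ‖gradS v (T, y)‖ ^ 2)) ∂vol3
      ≤ 2 * κ ^ 2 * ∫ y in {y : ℝ × S2 | y.1 ∈ Ioo 0 (ζ (T, y.2))},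
          (w (T, y) • g.current b v (T, y)).1 ∂vol3 := by
    have i1 := (hζ.integrableOn_slice (F := fun p => w p * (v p ^ 2 + (Dz v p ^ 2
      + ‖gradS v p‖ ^ 2))) fun p hp => (cw p hp).mul (((cv p hp).pow 2).add
        (((cz p hp).pow 2).add ((cn p hp).norm.pow 2)))).1
    have i2 := (hζ.integrableOn_slice (F := fun p => (w p • g.current b v p).1)
      fun p hp => (hM b).fst.continuousAt hp).1
    have hm : MeasurableSet {y : ℝ × S2 | y.1 ∈ Ioo 0 (ζ (T, y.2))} :=
      ((isOpen_lt continuous_const continuous_fst).inter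
        (isOpen_lt continuous_fst ((hζ.continuous_time hT').comp continuous_snd))).measurableSet
    rw [← integral_const_mul]
    refine setIntegral_mono_on i1 (i2.const_mul _) hm fun y hy => ?_
    have hp : ((T, y) : Pt) ∈ closedSubgraph T ζ := ⟨hT', Ioo_subset_Icc_self hy⟩
    -- The slice lies in the boundary of the region, so this bound and `m2` are limits of bounds
    -- from the interior.
    have m1 : 1 ≤ κ * Real.exp (-2 * g.η (T, y)) := by
      have := hζ.le_on_closedSubgraph (F := fun p => -(κ * Real.exp (-2 * g.η p))) (B := -1)
        (fun p hp => (continuousAt_const.mul ((g.isCk_density hs).continuousAt hp)).neg)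
        (fun p hp => by
          have := g.one_le_mul_density (openSlab_subset (hbd p hp).mem) (hbd p hp).G_le
          linarith) hp
      linarith
    have m2 : ∀ ξ : E3, ‖ξ‖ ^ 2 ≤ κ * ⟪g.angInv (T, y) ξ, ξ⟫ := fun ξ => by
      have := hζ.le_on_closedSubgraph (F := fun p => -(κ * ⟪g.angInv p ξ, ξ⟫)) (B := -(‖ξ‖ ^ 2))
        (fun p hp => (continuousAt_const.mul
          (((g.isCk_angInv.continuousAt (hs hp)).clm_apply continuousAt_const).inner
            continuousAt_const)).neg)
        (fun p hp => by
          have := (hbd p hp).nondeg ξ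
          linarith) hp
      linarith
    have h := mul_le_mul_of_nonneg_left
      (g.le_current_time (hs hp) hb0 hbκ hκ m1 (m2 (gradS v (T, y)))) (w0 (T, y)).le
    refine h.trans (le_of_eq ?_)
    simp only [Prod.smul_fst, smul_eq_mul]
    ring
  -- conformal infinity
  have hinf : κ ^ 2 * ∫ y in Ioo 0 T ×ˢ univ,
        (w (onInfinity y) • g.current b v (onInfinity y)).2.1 ∂vol3
      ≤ -(∫ y in Ioo 0 T ×ˢ univ, w (onInfinity y) * Dz v (onInfinity y) ^ 2 ∂vol3)
        + 3 * κ ^ 3 * ∫ y in Ioo 0 T ×ˢ univ, w (onInfinity y) * (v (onInfinity y) ^ 2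
          + (Dτ v (onInfinity y) ^ 2 + ‖gradS v (onInfinity y)‖ ^ 2)) ∂vol3 := by
    have i1 := hζ.integrableOn_onInfinity (F := fun p => (w p • g.current b v p).2.1)
      fun p hp => (hM b).snd_fst.continuousAt hp
    have i2 := hζ.integrableOn_onInfinity (F := fun p => w p * Dz v p ^ 2)
      fun p hp => (cw p hp).mul ((cz p hp).pow 2)
    have i3 := hζ.integrableOn_onInfinity (F := fun p => w p * (v p ^ 2 + (Dτ v p ^ 2
      + ‖gradS v p‖ ^ 2))) fun p hp => (cw p hp).mul (((cv p hp).pow 2).add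
        (((ct p hp).pow 2).add ((cn p hp).norm.pow 2)))
    have i2' : IntegrableOn (fun y => -(w (onInfinity y) * Dz v (onInfinity y) ^ 2))
      (Ioo 0 T ×ˢ univ) vol3 := i2.neg
    rw [← integral_const_mul, ← integral_const_mul, ← integral_neg,
      ← integral_add i2' (i3.const_mul _)]
    refine setIntegral_mono_on (i1.const_mul _) (i2'.add (i3.const_mul _))
      (measurableSet_Ioo.prod MeasurableSet.univ) fun y hy => ?_
    have hp := hs (hζ.onInfinity_mem (y := y) (Ioo_subset_Icc_self hy.1))
    have h := mul_le_mul_of_nonneg_left (g.current_radial_infinity_le hp rfl hb hb0 hbκ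
      (by linarith) hκ v) (w0 (onInfinity y)).le
    refine le_trans (le_of_eq ?_) (h.trans (le_of_eq ?_))
    · simp only [Prod.smul_snd, Prod.smul_fst, smul_eq_mul]; ring
    · ring
  -- the null cone
  have hflux : ∀ b, ∀ y ∈ Ioo (0 : ℝ) T ×ˢ (univ : Set S2),
      D (defFun ζ) (onGraph ζ y) (w (onGraph ζ y) • g.current b v (onGraph ζ y))
        = w (onGraph ζ y) * g.energyDensity ζ v b 1 (onGraph ζ y)
          * Real.exp (-2 * g.η (onGraph ζ y)) := fun b y hy => by
    have hy' : y.1 ∈ Icc 0 T := Ioo_subset_Icc_self hy.1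
    have h := g.flux_eq_energyDensity (hs (hζ.onGraph_mem hy')) (Dz_defFun hζ hy')
      (hcone.null y hy') b v
    rw [map_smul, h, smul_eq_mul]
    ring
  have hmeas : MeasurableSet (Ioo (0 : ℝ) T ×ˢ (univ : Set S2)) :=
    measurableSet_Ioo.prod MeasurableSet.univ
  have hfi : ∀ b, IntegrableOn (fun y => w (onGraph ζ y) * g.energyDensity ζ v b 1 (onGraph ζ y)
          * Real.exp (-2 * g.η (onGraph ζ y))) (Ioo (0 : ℝ) T ×ˢ (univ : Set S2)) vol3 := fun b =>
    (hζ.integrableOn_onGraph (F := fun p => D (defFun ζ) p (w p • g.current b v p))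
      fun p hp => hζ.continuousAt_flux (hM b) hp).congr_fun (fun y hy => hflux b y hy) hmeas
  have hED : ∀ y ∈ Ioo (0 : ℝ) T ×ˢ (univ : Set S2),
      0 ≤ g.energyDensity ζ v 1 1 (onGraph ζ y) ∧ g.energyDensity ζ v b 1 (onGraph ζ y)
        ≤ (b + 1) * g.energyDensity ζ v 1 1 (onGraph ζ y) := fun y hy => by
    have hy' : y.1 ∈ Icc 0 T := Ioo_subset_Icc_self hy.1
    exact g.energyDensity_nonneg_le (hs (hζ.onGraph_mem hy')) (Dz_defFun hζ hy')
      (hcone.null y hy') hb0.le v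
  have hN0 : 0 ≤ g.nullEnergy w ζ v 1 1 := setIntegral_nonneg hmeas fun y hy =>
    mul_nonneg (mul_nonneg (w0 _).le (hED y hy).1) (Real.exp_pos _).le
  have hnull : ∫ y in Ioo 0 T ×ˢ univ, D (defFun ζ) (onGraph ζ y)
        (w (onGraph ζ y) • g.current b v (onGraph ζ y)) ∂vol3
      ≤ κ * g.nullEnergy w ζ v 1 1 := by
    rw [setIntegral_congr_fun hmeas (hflux b), nullEnergy, ← integral_const_mul]
    refine setIntegral_mono_on (hfi b) ((hfi 1).const_mul κ) hmeas fun y hy => ?_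
    have h1 : g.energyDensity ζ v b 1 (onGraph ζ y) ≤ κ * g.energyDensity ζ v 1 1 (onGraph ζ y) :=
      (hED y hy).2.trans (mul_le_mul_of_nonneg_right hbκ' (hED y hy).1)
    have h2 := mul_le_mul_of_nonneg_left h1
      (mul_nonneg (w0 (onGraph ζ y)).le (Real.exp_pos (-2 * g.η (onGraph ζ y))).le)
    linarith
  refine ⟨hN0, ?_⟩
  rw [hdiv] at hint
  set A := ∫ p in subgraph T ζ, w p * jet v p ∂vol4
  set B := ∫ y in {y : ℝ × S2 | y.1 ∈ Ioo 0 (ζ (T, y.2))}, w (T, y)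
          * (v (T, y) ^ 2 + (Dz v (T, y) ^ 2 + ‖gradS v (T, y)‖ ^ 2)) ∂vol3 with hB
  set Z := ∫ y in Ioo 0 T ×ˢ univ, w (onInfinity y) * Dz v (onInfinity y) ^ 2 ∂vol3 with hZ
  set N := g.nullEnergy w ζ v 1 1
  set I := ∫ y in Ioo 0 T ×ˢ univ, w (onInfinity y) * (v (onInfinity y) ^ 2
          + (Dτ v (onInfinity y) ^ 2 + ‖gradS v (onInfinity y)‖ ^ 2)) ∂vol3 with hI
  set F := ∫ p in subgraph T ζ, w p * f p ^ 2 ∂vol4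
  set S := ∫ y in {y : ℝ × S2 | y.1 ∈ Ioo 0 (ζ (T, y.2))},
          (w (T, y) • g.current b v (T, y)).1 ∂vol3
  set Hf := ∫ y in Ioo 0 T ×ˢ univ, D (defFun ζ) (onGraph ζ y)
        (w (onGraph ζ y) • g.current b v (onGraph ζ y)) ∂vol3
  set Zf := ∫ y in Ioo 0 T ×ˢ univ, (w (onInfinity y) • g.current b v (onInfinity y)).2.1 ∂vol3
  have hB0 : 0 ≤ B := integral_nonneg fun y => mul_nonneg (w0 _).le (by positivity)
  have hZ0 : 0 ≤ Z := integral_nonneg fun y => mul_nonneg (w0 _).le (by positivity)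
  have hI0 : 0 ≤ I := integral_nonneg fun y => mul_nonneg (w0 _).le (by positivity)
  have c2 : 1 ≤ κ ^ 2 := one_le_pow₀ hκ
  -- The multipliers match the factor 16κ⁴ in `hint`: 8κ² · 2κ² and 16κ² · κ². The cone then costs
  -- 16κ⁵ and infinity 48κ⁵, both below 96κ⁶.
  have r1 := mul_le_mul_of_nonneg_left hslice (by positivity : 0 ≤ 8 * κ ^ 2)
  have r2 := mul_le_mul_of_nonneg_left hinf (by positivity : 0 ≤ 16 * κ ^ 2)
  have r3 := mul_le_mul_of_nonneg_left hnull (by positivity : 0 ≤ 16 * κ ^ 4)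
  have r4 : 1 * B ≤ 8 * κ ^ 2 * B := mul_le_mul_of_nonneg_right (by linarith) hB0
  have r5 : 1 * Z ≤ 16 * κ ^ 2 * Z := mul_le_mul_of_nonneg_right (by linarith) hZ0
  have p56 : κ ^ 5 ≤ κ ^ 6 := pow_le_pow_right₀ hκ (by norm_num)
  have r6 : κ ^ 5 * N ≤ κ ^ 6 * N := mul_le_mul_of_nonneg_right p56 hN0
  have r7 : κ ^ 5 * I ≤ κ ^ 6 * I := mul_le_mul_of_nonneg_right p56 hI0
  have r8 : 0 ≤ κ ^ 6 * N := by positivity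
  have r9 : 0 ≤ κ ^ 6 * I := by positivity
  linarith

end ConformalMetric

/-- Each of the five square roots on the left is at most the root of the whole right-hand side,
whence the factor 5. On the right the root is subadditive. -/
theorem sqrt_estimate {q A₀ A₁ B₀ B₁ Z N I₀ I₁ F C : ℝ} (hq : 0 ≤ q) (hA₀ : 0 ≤ A₀)
    (hA₁ : 0 ≤ A₁) (hB₀ : 0 ≤ B₀) (hB₁ : 0 ≤ B₁) (hZ : 0 ≤ Z) (hN : 0 ≤ N) (hI₀ : 0 ≤ I₀)
    (hI₁ : 0 ≤ I₁) (hF : 0 ≤ F) (hC : 0 ≤ C)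
    (h : q * (A₀ + A₁) + (B₀ + B₁) + Z ≤ C * (N + (I₀ + I₁) + F)) :
    Real.sqrt q * (Real.sqrt A₀ + Real.sqrt A₁) + (Real.sqrt B₀ + Real.sqrt B₁) + Real.sqrt Z
      ≤ 5 * Real.sqrt C * (Real.sqrt N + (Real.sqrt I₀ + Real.sqrt I₁) + Real.sqrt F) := by
  have hS : Real.sqrt (N + (I₀ + I₁) + F)
      ≤ Real.sqrt N + (Real.sqrt I₀ + Real.sqrt I₁) + Real.sqrt F := by
    rw [Real.sqrt_le_left (by positivity)]
    have e1 := Real.sq_sqrt hN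
    have e2 := Real.sq_sqrt hI₀
    have e3 := Real.sq_sqrt hI₁
    have e4 := Real.sq_sqrt hF
    have p1 := Real.sqrt_nonneg N
    have p2 := Real.sqrt_nonneg I₀
    have p3 := Real.sqrt_nonneg I₁
    have p4 := Real.sqrt_nonneg F
    nlinarith [mul_nonneg p1 p2, mul_nonneg p1 p3, mul_nonneg p1 p4, mul_nonneg p2 p3,
      mul_nonneg p2 p4, mul_nonneg p3 p4]
  have key : ∀ {x : ℝ}, x ≤ C * (N + (I₀ + I₁) + F) →
      Real.sqrt x ≤ Real.sqrt C * (Real.sqrt N + (Real.sqrt I₀ + Real.sqrt I₁) + Real.sqrt F) :=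
    fun hx => (Real.sqrt_le_sqrt hx).trans (by
      rw [Real.sqrt_mul hC]
      exact mul_le_mul_of_nonneg_left hS (Real.sqrt_nonneg _))
  have m0 := mul_nonneg hq hA₀
  have m1 := mul_nonneg hq hA₁
  have k1 := key (x := q * A₀) (by linarith)
  have k2 := key (x := q * A₁) (by linarith)
  have k3 := key (x := B₀) (by linarith)
  have k4 := key (x := B₁) (by linarith)
  have k5 := key (x := Z) (by linarith)
  rw [Real.sqrt_mul hq] at k1 k2
  linarith

end AdSWave

/-! ### Assembling the norms and the common constant -/

namespace AdSWave

open ConformalMetric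

/-- The sum of the squares of the two parts of an `H¹` norm. -/
theorem integral_sq_add_integral_sq {X : Type*} [MeasurableSpace X] {μ : Measure X} {s : Set X}
    {w F P : X → ℝ} (hP : ∀ x, 0 ≤ P x) (hF : IntegrableOn (fun x => w x * F x ^ 2) s μ)
    (hwP : IntegrableOn (fun x => w x * P x) s μ) :
    ∫ x in s, w x * F x ^ 2 ∂μ + ∫ x in s, w x * Real.sqrt (P x) ^ 2 ∂μ
      = ∫ x in s, w x * (F x ^ 2 + P x) ∂μ := by
  simp only [Real.sq_sqrt (hP _)]
  rw [← integral_add hF hwP]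
  simp only [mul_add]

/-- One constant that bounds the metric and its first derivatives. -/
theorem ConformalMetric.boundedAt_of_bounds {Λ R T : ℝ} {g : ConformalMetric Λ R T} {s : Set Pt}
    {K c κ : ℝ} (hc : 0 < c) (hK : |K| ≤ κ) (hcκ : 1 / c ≤ κ) (hκ : 1 ≤ κ)
    (hs : s ⊆ openSlab R T) (hb : g.InvC1BoundOn s K) (hn : g.NondegOn s c) :
    ∀ p ∈ s, g.BoundedAt κ p := fun p hp => by
  have hK' : K ≤ κ := (le_abs_self K).trans hK
  obtain ⟨hW, hU, hG⟩ := hb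
  refine ⟨hκ, hs hp, (hW p hp).1.trans hK', (hW p hp).2.trans hK', (hU p hp).1.trans hK',
    (hU p hp).2.trans hK', (hG p hp).1.trans hK', (hG p hp).2.trans hK', fun ξ => ?_⟩
  have h1 := hn p hp ξ
  have h2 : 0 ≤ ⟪g.angInv p ξ, ξ⟫ := le_trans (by positivity) h1
  calc ‖ξ‖ ^ 2 = 1 / c * (c * ‖ξ‖ ^ 2) := by field_simp
    _ ≤ 1 / c * ⟪g.angInv p ξ, ξ⟫ := by gcongr
    _ ≤ κ * ⟪g.angInv p ξ, ξ⟫ := by gcongr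

end AdSWave

end

/-! ### Choice of constants and conclusion -/

theorem mainTheorem5 (Λ : ℝ) (hΛ : Λ < 0) (K c Kω Ka : ℝ) (hc : 0 < c) :
    ∃ q₀ l C : ℝ, 0 < q₀ ∧ 0 < l ∧ 0 < C ∧
      ∀ (R T : ℝ), 0 < R → 0 < T →
      ∀ (g : AdSWave.ConformalMetric Λ R T) (ζ : ℝ × AdSWave.S2 → ℝ), g.IsNullCone ζ →
        g.InvC1BoundOn (g.region ζ) K → g.NondegOn (g.region ζ) c →
      ∀ (a : AdSWave.Pt → AdSWave.Vec) (ω v f : AdSWave.Pt → ℝ),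
        AEStronglyMeasurable a (AdSWave.vol4.restrict (g.region ζ)) →
        AEStronglyMeasurable ω (AdSWave.vol4.restrict (g.region ζ)) →
        (∀ᵐ p ∂AdSWave.vol4.restrict (g.region ζ), ‖a p‖ ≤ Ka) →
        (∀ᵐ p ∂AdSWave.vol4.restrict (g.region ζ), |ω p| ≤ Kω) →
        AdSWave.IsCk 2 v (g.closedRegion ζ) →
        (∀ᵐ p ∂AdSWave.vol4.restrict (g.region ζ),
          g.box v p + AdSWave.D v p (a p) + ω p * v p = f p) →
      ∀ q : ℝ, q₀ ≤ q →
        Real.sqrt q * AdSWave.wH1 (g.region ζ) (AdSWave.weight q l) v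
          + AdSWave.wH1Slice T {y | y.1 ∈ Ioo 0 (ζ (T, y.2))} (AdSWave.weight q l) v
          + AdSWave.wL2Infinity T (AdSWave.weight q l) (AdSWave.Dz v)
        ≤ C * (Real.sqrt (g.nullEnergy (AdSWave.weight q l) ζ v 1 1)
          + AdSWave.wH1Infinity T (AdSWave.weight q l) v
          + AdSWave.wL2 AdSWave.vol4 (g.region ζ) (AdSWave.weight q l) f) := by
  -- At infinity W = -Λ/3 = 4b. Any value strictly between 0 and -Λ/6 would give (∂_z v)² the right
  -- sign there.
  set b : ℝ := -Λ / 12 with hb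
  have hb0 : 0 < b := by rw [hb]; linarith
  obtain ⟨κ, hκ, hKκ, hcκ, hωκ, haκ, hbκ', hbi⟩ : ∃ κ : ℝ, 1 ≤ κ ∧ |K| ≤ κ ∧ 1 / c ≤ κ ∧ |Kω| ≤ κ
      ∧ |Ka| ≤ κ ∧ b + 1 ≤ κ ∧ 1 / b ≤ κ := by
    have h1 := abs_nonneg K
    have h2 := abs_nonneg Kω
    have h3 := abs_nonneg Ka
    have h4 : 0 < 1 / c := by positivity
    have h5 : 0 < 1 / b := by positivity
    -- A sum of nonnegative terms dominates each of them. Absolute values appear because the signs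
    -- of K, Kω and Ka are unrestricted.
    exact ⟨1 + |K| + 1 / c + |Kω| + |Ka| + b + 1 / b, by linarith, by linarith, by linarith,
      by linarith, by linarith, by linarith, by linarith⟩
  have hκ0 : 0 < κ := by linarith
  have hbκ : 1 ≤ κ * b := by
    calc 1 = 1 / b * b := by field_simp
      _ ≤ κ * b := by gcongr
  -- The threshold for q is that of `BoundedAt.Div_weighted_le`, l comes from `BoundedAt.jet_le`,
  -- and the last constant combines `energy_estimate` with `sqrt_estimate`.
  refine ⟨1920 * κ ^ 7, κ + 1, 5 * Real.sqrt (96 * κ ^ 6), by positivity, by positivity,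
    by positivity, ?_⟩
  intro R T hR hT g ζ hcone hbound hnondeg a ω v f ham hωm ha hω hv heq q hq
  have hζ := hcone.isConeGraph hT
  have hbd := AdSWave.ConformalMetric.boundedAt_of_bounds hc hKκ hcκ hκ hcone.subgraph_subset
    hbound hnondeg
  obtain ⟨hN, hmain⟩ := AdSWave.ConformalMetric.energy_estimate hR hT hcone hbd hb hb0 hbκ hbκ' hκ
    hv ham hωm (ha.mono fun p h => h.trans ((le_abs_self _).trans haκ))
    (hω.mono fun p h => h.trans ((le_abs_self _).trans hωκ)) heq hq
  have hq0 : 0 ≤ q := le_trans (by positivity) hq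
  set w := AdSWave.weight q (κ + 1) with hw
  have w0 : ∀ p, 0 ≤ w p := fun p => (AdSWave.weight_pos q (κ + 1) p).le
  have cw : ∀ p ∈ AdSWave.closedSubgraph T ζ, ContinuousAt w p := fun p hp =>
    (AdSWave.isCk_weight q (κ + 1) _).continuousAt hp
  have cz : ∀ p ∈ AdSWave.closedSubgraph T ζ, ContinuousAt (AdSWave.Dz v) p := fun p hp =>
    AdSWave.IsCk.continuousAt (k := 1) (AdSWave.IsCk.Dz hv) hp
  have ct : ∀ p ∈ AdSWave.closedSubgraph T ζ, ContinuousAt (AdSWave.Dτ v) p := fun p hp =>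
    AdSWave.IsCk.continuousAt (k := 1) (AdSWave.IsCk.Dτ hv) hp
  have cn : ∀ p ∈ AdSWave.closedSubgraph T ζ, ContinuousAt (AdSWave.gradS v) p := fun p hp =>
    AdSWave.IsCk.continuousAt (k := 1) (AdSWave.IsCk.gradS hv) hp
  have cv : ∀ p ∈ AdSWave.closedSubgraph T ζ, ContinuousAt v p := fun p hp => hv.continuousAt hp
  -- Each H¹ norm is a sum of two square roots, so the integrals of the squares are split into two
  -- before roots are taken.
  have eA := AdSWave.integral_sq_add_integral_sq
    (P := fun p => AdSWave.Dτ v p ^ 2 + AdSWave.Dz v p ^ 2 + ‖AdSWave.gradS v p‖ ^ 2)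
    (fun p => by positivity)
    (hζ.integrableOn_subgraph fun p hp => (cw p hp).mul ((cv p hp).pow 2))
    (hζ.integrableOn_subgraph fun p hp => (cw p hp).mul
      ((((ct p hp).pow 2).add ((cz p hp).pow 2)).add ((cn p hp).norm.pow 2)))
  have eB := AdSWave.integral_sq_add_integral_sq (F := fun y => v (T, y))
    (P := fun y => AdSWave.Dz v (T, y) ^ 2 + ‖AdSWave.gradS v (T, y)‖ ^ 2)
    (fun p => by positivity)
    (hζ.integrableOn_slice fun p hp => (cw p hp).mul ((cv p hp).pow 2)).1
    (hζ.integrableOn_slice fun p hp => (cw p hp).mul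
      (((cz p hp).pow 2).add ((cn p hp).norm.pow 2))).1
  have eI := AdSWave.integral_sq_add_integral_sq (F := fun y => v (AdSWave.onInfinity y))
    (P := fun y => AdSWave.Dτ v (AdSWave.onInfinity y) ^ 2
      + ‖AdSWave.gradS v (AdSWave.onInfinity y)‖ ^ 2)
    (fun p => by positivity)
    (hζ.integrableOn_onInfinity fun p hp => (cw p hp).mul ((cv p hp).pow 2))
    (hζ.integrableOn_onInfinity fun p hp => (cw p hp).mul
      (((ct p hp).pow 2).add ((cn p hp).norm.pow 2)))
  have hJ : ∫ p in AdSWave.subgraph T ζ, w p * AdSWave.jet v p ∂AdSWave.vol4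
      = ∫ p in AdSWave.subgraph T ζ, w p * (v p ^ 2 + (AdSWave.Dτ v p ^ 2 + AdSWave.Dz v p ^ 2
        + ‖AdSWave.gradS v p‖ ^ 2)) ∂AdSWave.vol4 := by
    refine integral_congr_ae (Filter.Eventually.of_forall fun p => ?_)
    simp only [AdSWave.jet]
    ring
  rw [hJ, ← eA, ← eB, ← eI] at hmain
  have nn : ∀ {X : Type} [MeasurableSpace X] {μ : Measure X} {s : Set X} {u F : X → ℝ},
      (∀ x, 0 ≤ u x) → 0 ≤ ∫ x in s, u x * F x ^ 2 ∂μ := fun hu =>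
    integral_nonneg fun x => mul_nonneg (hu x) (sq_nonneg _)
  exact AdSWave.sqrt_estimate hq0 (nn fun _ => w0 _) (nn fun _ => w0 _) (nn fun _ => w0 _)
    (nn fun _ => w0 _) (nn fun _ => w0 _) hN (nn fun _ => w0 _) (nn fun _ => w0 _)
    (nn fun _ => w0 _) (by positivity) hmain
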